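/- **Definitions.** A *mixture density* is a probability density $\varphi$ on $[-1,1]$ with $\int_{-1}^1\frac{\varphi(x)}{1-x^2}\,dx<\infty$. It is *associated* with a spectral density $f$ on $[-\pi,\pi]$ if, for some $\sigma_\varepsilon^2>0$, $$f(\lambda)=\frac{\sigma_\varepsilon^2}{2\pi}\int_{-1}^1\frac{\varphi(x)}{|1-xe^{i\lambda}|^2}\,dx\quad\text{for a.e. }\lambda\in[-\pi,\pi].$$ An *aggregated process* is a zero mean stationary Gaussian process $X=\{X_t,t\in\mathbf Z\}$ which is the limit, in the sense of finite dimensional distributions, of $N^{-1/2}\sum_{j=1}^N Y^{(j)}_t$ as $N\to\infty$. Here $Y^{(j)}_t=a^{(j)}Y^{(j)}_{t-1}+\varepsilon^{(j)}_t$ are stationary random-coefficient AR(1) processes, the $a^{(j)}$ are i.i.d. and have a mixture density, the $\varepsilon^{(j)}_t$ are i.i.d. with mean zero and variance $\sigma_\varepsilon^2\in(0,\infty)$, and the families $\{a^{(j)}\}$ and $\{\varepsilon^{(j)}_t\}$ are independent. The process $X$ has spectral density $f$ if ${\rm Cov}(X_h,X_0)=\int_{-\pi}^{\pi}e^{ih\lambda}f(\lambda)\,d\lambda$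 for all $h\in\mathbf Z$. For a spectral density $f$ with $\log f$ integrable on $[-\pi,\pi]$, put $$h_f(z)=\exp\Big\{\frac1{4\pi}\int_{-\pi}^{\pi}\frac{e^{i\lambda}+z}{e^{i\lambda}-z}\log f(\lambda)\,d\lambda\Big\}\quad(|z|<1),\qquad \sigma^2(f)=2\pi\exp\Big\{\frac1{2\pi}\int_{-\pi}^{\pi}\log f(\lambda)\,d\lambda\Big\}.$$ Let $0<d<1/2$. *Assumption A* (with parameter $d$): $X_t=\sum_{j\ge0}\psi_jZ_{t-j}$ in mean square, where the $Z_t$ are i.i.d. with zero mean and finite fourth moment, $\psi_j\sim c\,j^{d-1}$ for some $c\ne0$, and $|\psi_j-\psi_{j+1}|=O(j^{d-2})$. *Assumption B* (with parameter $d$): the mixture density satisfies $\varphi(x)=(1-x)^{1-2d}\psi(x)$ for a.e. $x$, where $\psi\ge0$ vanishes outside $[-1,1]$, is left-continuous at $x=1$, and $\psi(1)\ne0$. **Proposition.** Let $f(\lambda)=f(\lambda;d)\,g(\lambda)$ for a.e. $\lambda\in[-\pi,\pi]$, where $f(\lambda;d)=\frac1{2\pi}\big(2\sin\frac{|\lambda|}2\big)^{-2d}$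 is the FARIMA$(0,d,0)$ spectral density and $g$ is a $2\pi$-periodic function, real analytic on $[-\pi,\pi]$, with which a mixture density $\varphi_g$ is associated. (i) If $\varphi_g$ is supported in $[-a_*,0]$ for some $0<a_*<1$, then there is a mixture density associated with $f$, and every mixture density associated with $f$ satisfies Assumption B with parameter $d$. (ii) Let $X$ be an aggregated process with spectral density $f$. Then $\log f$ is integrable on $[-\pi,\pi]$ and $$\sigma^2(f)=\exp\Big\{\frac1{2\pi}\int_{-\pi}^{\pi}\log g(\lambda)\,d\lambda\Big\}=\frac{\sigma^2(g)}{2\pi}.$$ Let $\psi_j$ and $g_k$ be the Taylor coefficients at $0$ of $h_f(z)/h_f(0)$ and $h_g(z)/h_g(0)$. Then $\psi_0=1$, $\sum_j\psi_j^2<\infty$, and $$X_t=\sum_{j=0}^\infty\psi_jZ_{t-j},\qquad t\in\mathbf Z,$$ in mean square, where the $Z_t$ are i.i.d. $N(0,\sigma^2(f))$ and $Z_t$ is the innovation of $X$, that is, $X_t-Z_t$ is the best linear predictor of $X_t$ from $\{X_s,\ s<t\}$. Moreover $\sum_k|g_k|<\infty$, $\sum_kg_k\ne0$, and $$\psi_j\sim\frac{\sum_{k=0}^\infty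 g_k}{\Gamma(d)}\,j^{d-1},\qquad |\psi_j-\psi_{j+1}|=O(j^{d-2})\qquad(j\to\infty).$$ Hence $X$ satisfies Assumption A with parameter $d$. -/

import Mathlib

open MeasureTheory ProbabilityTheory Filter Asymptotics Set
open scoped Topology

noncomputable section

/-- A mixture density: a probability density `φ` on `[-1, 1]` (an a.e. class) such that
`∫ φ(x) / (1 - x²) dx < ∞`. -/
structure IsMixtureDensity (φ : ℝ → ℝ) : Prop where
  nonneg : ∀ᵐ x, 0 ≤ φ x
  support : ∀ᵐ x, x ∉ Icc (-1 : ℝ) 1 → φ x = 0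
  integrable : Integrable φ
  integral_eq_one : ∫ x, φ x = 1
  integrable_div : IntegrableOn (fun x => φ x / (1 - x ^ 2)) (Icc (-1) 1)

/-- The spectral density of the aggregated process with mixture density `φ` and noise
variance `s`. -/
def aggregatedDensity (φ : ℝ → ℝ) (s : ℝ) (w : ℝ) : ℝ :=
  s / (2 * Real.pi) *
    ∫ x in (-1 : ℝ)..1, φ x / ‖1 - (x : ℂ) * Complex.exp (Complex.I * w)‖ ^ 2

/-- The mixture density `φ` is associated with the spectral density `f` on `[-π, π]`:
for some noise variance `s > 0`, `f` is the spectral density of the aggregated process.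
Spectral densities are a.e. classes. -/
structure IsAssociated (φ f : ℝ → ℝ) : Prop where
  isMixtureDensity : IsMixtureDensity φ
  exists_variance : ∃ s : ℝ, 0 < s ∧
    f =ᵐ[volume.restrict (Icc (-Real.pi) Real.pi)] aggregatedDensity φ s

/-- The FARIMA(0, d, 0) spectral density on `[-π, π]` (the value at `0`, where the density is
infinite, is irrelevant). -/
def farimaDensity (d : ℝ) (w : ℝ) : ℝ :=
  1 / (2 * Real.pi) * (2 * Real.sin (|w| / 2)) ^ (-2 * d)

/-- Assumption B with parameter `d`: `φ(x) = (1 - x)^(1 - 2d) ψ(x)` (as densities), with `ψ`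
nonnegative, supported in `[-1, 1]`, nonzero and (left-)continuous at the endpoint `1`. -/
def AssumptionB (φ : ℝ → ℝ) (d : ℝ) : Prop :=
  IsMixtureDensity φ ∧ 0 < d ∧ d < 1 / 2 ∧
  ∃ ψ : ℝ → ℝ, (∀ x, 0 ≤ ψ x) ∧ (∀ x, x ∉ Icc (-1 : ℝ) 1 → ψ x = 0) ∧
    ContinuousWithinAt ψ (Iic 1) 1 ∧ ψ 1 ≠ 0 ∧
    φ =ᵐ[volume] fun x => (1 - x) ^ (1 - 2 * d) * ψ x

/-- Strict stationarity of a real process indexed by `ℤ`. -/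
def IsStationaryProcess {Ω : Type*} [MeasurableSpace Ω] (X : ℤ → Ω → ℝ) (P : Measure Ω) : Prop :=
  ∀ n : ℤ, IdentDistrib (fun ω t => X (t + n) ω) (fun ω t => X t ω) P P

/-- Independent copies `Y j` of the stationary random-coefficient AR(1) process
`Y_t = a Y_{t-1} + ε_t`, where the coefficients `a j` have density `φ`, the innovations `ε j t`
are centred with variance `s`, and all of the `a j`, `ε j t` are mutually independent. -/
structure IsRandomCoeffAR1 {Ω : Type*} [MeasurableSpace Ω] (φ : ℝ → ℝ) (s : ℝ)
    (a : ℕ → Ω → ℝ) (ε Y : ℕ → ℤ → Ω → ℝ) (P : Measure Ω) : Prop where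
  aemeasurable_coeff : ∀ j, AEMeasurable (a j) P
  law_coeff : ∀ j, P.map (a j) = volume.withDensity fun x => ENNReal.ofReal (φ x)
  identDistrib_noise : ∀ j t, IdentDistrib (ε j t) (ε 0 0) P P
  memLp_noise : MemLp (ε 0 0) 2 P
  mean_noise : ∫ ω, ε 0 0 ω ∂P = 0
  variance_noise : ∫ ω, ε 0 0 ω ^ 2 ∂P = s
  indep : iIndepFun (Sum.elim a fun p : ℕ × ℤ => ε p.1 p.2) P
  stationary : ∀ j, IsStationaryProcess (Y j) P
  recursion : ∀ j t, ∀ᵐ ω ∂P, Y j t ω = a j ω * Y j (t - 1) ω + ε j t ω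

/-- An aggregated process: a zero mean stationary Gaussian process that is the limit, in the
sense of weak convergence of finite dimensional distributions, of the normalized sums
`N^{-1/2} ∑_{j < N} Y j t` of independent random-coefficient AR(1) processes whose
coefficient has a mixture density. -/
structure IsAggregatedProcess {Ω : Type*} [MeasurableSpace Ω] (X : ℤ → Ω → ℝ)
    (μ : Measure Ω) [IsProbabilityMeasure μ] : Prop where
  gaussian : IsGaussianProcess X μ
  mean_zero : ∀ t, ∫ ω, X t ω ∂μ = 0
  stationary : IsStationaryProcess X μ
  limit : ∃ (φ : ℝ → ℝ) (s : ℝ) (Ω' : Type) (_ : MeasurableSpace Ω') (P : Measure Ω')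
    (_ : IsProbabilityMeasure P) (a : ℕ → Ω' → ℝ) (ε Y : ℕ → ℤ → Ω' → ℝ),
    IsMixtureDensity φ ∧ 0 < s ∧ IsRandomCoeffAR1 φ s a ε Y P ∧
    ∀ I : Finset ℤ, TendstoInDistribution
      (fun (N : ℕ) ω => I.restrict fun t => (Real.sqrt N)⁻¹ * ∑ j ∈ Finset.range N, Y j t ω)
      atTop (fun ω => I.restrict fun t => X t ω) (fun _ => P) μ

/-- `f` is a spectral density of the process `X`: `f` is nonnegative and integrable on `[-π, π]`
and `Cov(X_s, X_t) = ∫_{-π}^{π} e^{i (s - t) w} f(w) dw`. -/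
structure HasSpectralDensity {Ω : Type*} [MeasurableSpace Ω] (X : ℤ → Ω → ℝ)
    (μ : Measure Ω) (f : ℝ → ℝ) : Prop where
  nonneg : ∀ᵐ w ∂volume.restrict (Icc (-Real.pi) Real.pi), 0 ≤ f w
  integrable : IntegrableOn f (Icc (-Real.pi) Real.pi)
  covariance : ∀ s t : ℤ, ((cov[X s, X t; μ] : ℝ) : ℂ) =
    ∫ w in (-Real.pi)..Real.pi, Complex.exp (Complex.I * ((s - t : ℤ) : ℂ) * w) * (f w : ℂ)

/-- The outer function `h` of the spectral density `f`, for `|z| < 1`. -/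
def outerFunction (f : ℝ → ℝ) (z : ℂ) : ℂ :=
  Complex.exp (1 / (4 * (Real.pi : ℂ)) * ∫ w in (-Real.pi)..Real.pi,
    (Complex.exp (Complex.I * w) + z) / (Complex.exp (Complex.I * w) - z) *
      (Real.log (f w) : ℂ))

/-- The Taylor coefficients at `0` of the normalized outer function `h(z) / h(0)`; they are real
since the spectral density of a real process is even. -/
def maCoeff (f : ℝ → ℝ) (j : ℕ) : ℝ :=
  (iteratedDeriv j (fun z : ℂ => outerFunction f z / outerFunction f 0) 0
    / (j.factorial : ℂ)).re

/-- The innovation variance `2π exp((2π)⁻¹ ∫_{-π}^{π} log f)`. -/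
def innovationVariance (f : ℝ → ℝ) : ℝ :=
  2 * Real.pi *
    Real.exp (1 / (2 * Real.pi) * ∫ w in (-Real.pi)..Real.pi, Real.log (f w))

/-- `X_t = ∑_{j ≥ 0} ψ_j Z_{t-j}` for all `t`, with convergence in mean square. -/
def IsLinearSequence {Ω : Type*} [MeasurableSpace Ω] (X Z : ℤ → Ω → ℝ) (ψ : ℕ → ℝ)
    (μ : Measure Ω) : Prop :=
  ∀ t : ℤ, Tendsto
    (fun n : ℕ => eLpNorm (fun ω => X t ω - ∑ j ∈ Finset.range n, ψ j * Z (t - j) ω) 2 μ)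
    atTop (𝓝 0)

/-- `Z` is the innovation process of the zero mean process `X`: `X_t - Z_t` is the best linear
predictor of `X_t`, i.e. it lies in the mean square closure of the span of `X_s`, `s < t`, and
`Z_t` is orthogonal to all `X_s`, `s < t`. -/
def IsInnovation {Ω : Type*} [MeasurableSpace Ω] (X Z : ℤ → Ω → ℝ) (μ : Measure Ω) : Prop :=
  ∀ t : ℤ, MemLp (Z t) 2 μ ∧ (∀ s < t, ∫ ω, Z t ω * X s ω ∂μ = 0) ∧
    ∀ δ : ℝ, 0 < δ → ∃ c : ℤ →₀ ℝ, (∀ s ∈ c.support, s < t) ∧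
      eLpNorm (fun ω => X t ω - Z t ω - ∑ s ∈ c.support, c s * X s ω) 2 μ < ENNReal.ofReal δ

/-- Assumption A with parameter `d`. -/
def AssumptionA {Ω : Type*} [MeasurableSpace Ω] (X : ℤ → Ω → ℝ) (μ : Measure Ω)
    (d : ℝ) : Prop :=
  0 < d ∧ d < 1 / 2 ∧ ∃ (Z : ℤ → Ω → ℝ) (ψ : ℕ → ℝ) (c : ℝ),
    iIndepFun Z μ ∧ (∀ t, IdentDistrib (Z t) (Z 0) μ μ) ∧ ∫ ω, Z 0 ω ∂μ = 0 ∧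
    MemLp (Z 0) 4 μ ∧ IsLinearSequence X Z ψ μ ∧ c ≠ 0 ∧
    (ψ ~[atTop] fun j : ℕ => c * (j : ℝ) ^ (d - 1)) ∧
    ((fun j : ℕ => |ψ j - ψ (j + 1)|) =O[atTop] fun j : ℕ => (j : ℝ) ^ (d - 2))

end

/-! Part (ii) works with logarithms. The FARIMA factor is a power of `|1 - e^{iw}|`, whose logarithm
has cosine coefficients `-1 / (2n)`, so for `n ≥ 1` those of `log f` are `d / n + l n`, with `l n`
the coefficients of `log g`. Expanding the Herglotz kernel turns cosine coefficients of the
logarithm into Taylor coefficients of the exponent. Hence `h_f(z) / h_f(0) = (1 - z)^{-d} · h_g(z) /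
h_g(0)`, and the `ψ_j` are the convolution of `powCoeff d` with the `g_k` (`maCoeff_eq_expCoeff`,
`cosCoeff_log`, `expCoeff_add`).

An associated density is bounded below by a positive constant, so `log g` is smooth and periodic, `l
n = O(n^{-4})`, and this decay survives exponentiation of both `l` and `-l`
(`summable_sq_mul_expCoeff`). The `g_k` are therefore summable with weight `(k + 1)^2`, their sum is
nonzero because the reciprocal series is summable too, and the convolution inherits the size and the
increments of `powCoeff d` (`tendsto_convolution_mul_rpow`, `abs_convolution_sub_le`).

The reciprocal of `∑ ψ_j z^j` has absolutely summable coefficients `π_j`, so `Z_t = ∑ π_j X_{t-j}`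
converges in `L²`. The covariances of `X` are `σ² ∑ ψ_k ψ_{k+h}`, by a radial limit of Parseval's
identity (`integral_exp_mul_eq_tsum`). Up to the factor `σ²`, all inner products agree with those in
`ℓ²(ℤ)`, where the moving average of the standard basis is inverted exactly. Limits in `L²` of
centred Gaussian variables are Gaussian, so orthogonality of the `Z_t` is independence
(`exists_gaussian_innovations`).

Part (i) is explicit. The FARIMA density is a mixture with weight proportional to `x^{d-1}
(1-x)^{1-2d} (1+x)` on `(0, 1)`. If one weight lives on `(0, 1)` and the other on `(-1, 0)`, partial
fractions with nonnegative bounded coefficients turn the product of the two spectral densities into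
a single mixture (`integral_productMixing_div_norm_sq`), which to the left of `1` is `(1-x)^{1-2d}`
times a function continuous and positive at `1`. A spectral density determines the moments of `φ(x)
/ (1 - x²)` and hence `φ` (`ae_eq_of_aggregatedDensity_ae_eq`), so what holds for this mixture holds
for every associated one. -/

noncomputable section

/-! ### Exponentials of power series -/

/-- The Taylor coefficients of `exp (∑_{n ≥ 1} c n * z ^ n)`. -/
def expCoeff (c : ℕ → ℝ) : ℕ → ℝ
  | 0 => 1
  | j + 1 => (∑ i : Fin (j + 1), (i + 1 : ℝ) * c (i + 1) * expCoeff c (j - i)) / (j + 1)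
termination_by n => n
decreasing_by omega

theorem expCoeff_zero (c : ℕ → ℝ) : expCoeff c 0 = 1 := by
  rw [expCoeff]

theorem succ_mul_expCoeff_succ (c : ℕ → ℝ) (j : ℕ) :
    (j + 1 : ℝ) * expCoeff c (j + 1) =
      ∑ i ∈ Finset.range (j + 1), (i + 1 : ℝ) * c (i + 1) * expCoeff c (j - i) := by
  rw [expCoeff, Finset.sum_range]
  field_simp

theorem eq_expCoeff {c q : ℕ → ℝ} (h0 : q 0 = 1)
    (h : ∀ j : ℕ, (j + 1 : ℝ) * q (j + 1) =
      ∑ i ∈ Finset.range (j + 1), (i + 1 : ℝ) * c (i + 1) * q (j - i)) : q = expCoeff c := by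
  funext n
  induction n using Nat.strong_induction_on with
  | _ n ih =>
    cases n with
    | zero => rw [h0, expCoeff_zero]
    | succ j =>
      have h1 : (j + 1 : ℝ) * q (j + 1) = (j + 1 : ℝ) * expCoeff c (j + 1) := by
        rw [h, succ_mul_expCoeff_succ]
        refine Finset.sum_congr rfl fun i _ => ?_
        rw [ih (j - i) (by omega)]
      exact mul_left_cancel₀ (by positivity) h1

/-- The value `c 0` never enters, so junk values such as `d / 0 = 0`, or a different zeroth cosine
coefficient, are harmless. -/
theorem expCoeff_congr {c c' : ℕ → ℝ} (h : ∀ n, c (n + 1) = c' (n + 1)) :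
    expCoeff c = expCoeff c' := by
  refine eq_expCoeff (expCoeff_zero c) fun j => ?_
  rw [succ_mul_expCoeff_succ]
  exact Finset.sum_congr rfl fun i _ => by rw [h]

theorem expCoeff_const_zero (n : ℕ) : expCoeff (fun _ => 0) (n + 1) = 0 := by
  have := succ_mul_expCoeff_succ (fun _ => 0) n
  simp only [mul_zero, zero_mul, Finset.sum_const_zero, mul_eq_zero] at this
  exact this.resolve_left (by positivity)

/-- The defining recursion is the formal differential equation `P' = C' P`; together with `P(0) = 1`
it determines `P`. -/
theorem derivative_mk_expCoeff (c : ℕ → ℝ) :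
    PowerSeries.derivative ℝ (PowerSeries.mk (expCoeff c)) =
      PowerSeries.derivative ℝ (PowerSeries.mk c) * PowerSeries.mk (expCoeff c) := by
  ext j
  rw [PowerSeries.coeff_mul, Finset.Nat.sum_antidiagonal_eq_sum_range_succ_mk]
  simp only [PowerSeries.coeff_derivative, PowerSeries.coeff_mk]
  rw [mul_comm, succ_mul_expCoeff_succ]
  exact Finset.sum_congr rfl fun i _ => by ring

theorem eq_expCoeff_of_derivative {c : ℕ → ℝ} {P : PowerSeries ℝ} (h0 : P.coeff 0 = 1)
    (h : PowerSeries.derivative ℝ P = PowerSeries.derivative ℝ (PowerSeries.mk c) * P) :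
    P = PowerSeries.mk (expCoeff c) := by
  have : (fun n => P.coeff n) = expCoeff c := by
    refine eq_expCoeff h0 fun j => ?_
    have := congrArg (PowerSeries.coeff j) h
    rw [PowerSeries.coeff_mul, Finset.Nat.sum_antidiagonal_eq_sum_range_succ_mk] at this
    simp only [PowerSeries.coeff_derivative,
      PowerSeries.coeff_mk] at this
    rw [mul_comm, this]
    exact Finset.sum_congr rfl fun i _ => by ring
  ext n
  rw [PowerSeries.coeff_mk, ← this]

/-- By the Leibniz rule the product solves the differential equation belonging to the sum of the
exponents. -/
theorem mk_expCoeff_add (c c' : ℕ → ℝ) :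
    PowerSeries.mk (expCoeff (fun n => c n + c' n)) =
      PowerSeries.mk (expCoeff c) * PowerSeries.mk (expCoeff c') := by
  refine (eq_expCoeff_of_derivative ?_ ?_).symm
  · simp [PowerSeries.coeff_mul, expCoeff_zero]
  · have : PowerSeries.mk (fun n => c n + c' n) = PowerSeries.mk c + PowerSeries.mk c' := by
      ext n; simp
    rw [Derivation.leibniz, derivative_mk_expCoeff, derivative_mk_expCoeff, this, map_add]
    simp only [smul_eq_mul]
    ring

theorem expCoeff_add (c c' : ℕ → ℝ) (j : ℕ) :
    expCoeff (fun n => c n + c' n) j =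
      ∑ i ∈ Finset.range (j + 1), expCoeff c i * expCoeff c' (j - i) := by
  have := congrArg (PowerSeries.coeff j) (mk_expCoeff_add c c')
  rw [PowerSeries.coeff_mul, Finset.Nat.sum_antidiagonal_eq_sum_range_succ_mk] at this
  simpa using this

theorem sum_expCoeff_mul_expCoeff_neg (c : ℕ → ℝ) (j : ℕ) :
    ∑ i ∈ Finset.range (j + 1), expCoeff c i * expCoeff (fun n => -c n) (j - i) =
      if j = 0 then 1 else 0 := by
  rw [← expCoeff_add]
  simp only [add_neg_cancel]
  cases j with
  | zero => simp [expCoeff_zero]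
  | succ n => simp [expCoeff_const_zero]

/-- Polynomial decay of `c` passes to the Taylor coefficients of `exp (∑ c n * z ^ n)`. -/
theorem summable_sq_mul_expCoeff {c : ℕ → ℝ}
    (hc : Summable fun n : ℕ => (n : ℝ) * (n + 1) * |c n|) :
    Summable fun k : ℕ => (k + 1 : ℝ) ^ 2 * |expCoeff c k| := by
  set q := expCoeff c with hq
  set a : ℕ → ℝ := fun k => (k + 1 : ℝ) * |q k| with ha
  set β : ℕ → ℝ := fun n => ((n : ℝ) + 1) * (n + 2) * |c (n + 1)| with hβ
  have ha0 : ∀ k, 0 ≤ a k := fun k => by positivity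
  have hβ0 : ∀ k, 0 ≤ β k := fun k => by positivity
  have hβs : Summable β := by
    refine ((summable_nat_add_iff 1).2 hc).congr fun n => ?_
    simp only [hβ]; push_cast; ring
  set B := ∑' n, β n with hB
  have hB0 : 0 ≤ B := tsum_nonneg hβ0
  have hstep : ∀ j : ℕ, (j + 1 : ℝ) * a (j + 1) ≤ ∑ i ∈ Finset.range (j + 1), β i * a (j - i) := by
    intro j
    have h1 : (j + 1 : ℝ) * |q (j + 1)| ≤
        ∑ i ∈ Finset.range (j + 1), (i + 1 : ℝ) * |c (i + 1)| * |q (j - i)| := by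
      have h2 := congrArg abs (succ_mul_expCoeff_succ c j)
      rw [abs_mul, abs_of_nonneg (by positivity : (0 : ℝ) ≤ j + 1)] at h2
      rw [hq, h2]
      refine (Finset.abs_sum_le_sum_abs _ _).trans (Finset.sum_le_sum fun i _ => ?_)
      rw [abs_mul, abs_mul, abs_of_nonneg (by positivity : (0 : ℝ) ≤ (i : ℝ) + 1)]
    calc (j + 1 : ℝ) * a (j + 1) = (j + 2) * ((j + 1 : ℝ) * |q (j + 1)|) := by
          simp only [ha]; push_cast; ring
      _ ≤ (j + 2) * ∑ i ∈ Finset.range (j + 1), (i + 1 : ℝ) * |c (i + 1)| * |q (j - i)| := by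
          gcongr
      _ = ∑ i ∈ Finset.range (j + 1), (j + 2) * ((i + 1 : ℝ) * |c (i + 1)| * |q (j - i)|) :=
          Finset.mul_sum _ _ _
      _ ≤ _ := by
          refine Finset.sum_le_sum fun i hi => ?_
          have hij : i ≤ j := by simpa [Nat.lt_succ_iff] using hi
          -- This submultiplicativity lets the weight `j + 2` be distributed over the two factors of
          -- the convolution.
          have h3 : (j + 2 : ℝ) ≤ (i + 2) * ((j - i : ℕ) + 1) := by
            rw [Nat.cast_sub hij]
            have : (i : ℝ) ≤ j := by exact_mod_cast hij
            nlinarith [(Nat.cast_nonneg i : (0 : ℝ) ≤ i)]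
          calc (j + 2) * ((i + 1 : ℝ) * |c (i + 1)| * |q (j - i)|)
              ≤ ((i + 2) * ((j - i : ℕ) + 1)) * ((i + 1 : ℝ) * |c (i + 1)| * |q (j - i)|) := by
                gcongr
            _ = β i * a (j - i) := by simp only [hβ, ha]; ring
  have hsum : ∀ K : ℕ, ∑ j ∈ Finset.range K, (j + 1 : ℝ) * a (j + 1) ≤
      B * ∑ m ∈ Finset.range K, a m := by
    intro K
    refine (Finset.sum_le_sum fun j _ => hstep j).trans ?_
    rw [Finset.sum_range_diag_flip K fun i m => β i * a m]
    calc ∑ m ∈ Finset.range K, ∑ k ∈ Finset.range (K - m), β m * a k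
        ≤ ∑ m ∈ Finset.range K, ∑ k ∈ Finset.range K, β m * a k := by
          refine Finset.sum_le_sum fun m _ => Finset.sum_le_sum_of_subset_of_nonneg ?_ ?_
          · exact Finset.range_mono (Nat.sub_le _ _)
          · intro i _ _; exact mul_nonneg (hβ0 _) (ha0 _)
      _ = (∑ m ∈ Finset.range K, β m) * ∑ k ∈ Finset.range K, a k :=
          (Finset.sum_mul_sum _ _ _ _).symm
      _ ≤ _ := by
          gcongr
          exact hβs.sum_le_tsum _ fun i _ => hβ0 i
  -- Beyond `N` the weight `j` beats the constant: `N (S K - S N) ≤ ∑ j a j ≤ B S K` with `N ≥ 2B +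
  -- 1` forces `S K ≤ 2 S N`. So the weighted partial sums, bounded by `B S K`, stay bounded.
  obtain ⟨N, hN⟩ := exists_nat_ge (2 * B + 1)
  set S := fun K => ∑ m ∈ Finset.range K, a m with hS
  have hSmono : Monotone S := fun m n hmn =>
    Finset.sum_le_sum_of_subset_of_nonneg (Finset.range_mono hmn) fun i _ _ => ha0 i
  have hbd : ∀ K, S K ≤ 2 * S N := by
    intro K
    have h0 : 0 ≤ S N := Finset.sum_nonneg fun i _ => ha0 i
    rcases le_total K N with h | h
    · linarith [hSmono h]
    · have h1 : (N : ℝ) * (S K - S N) ≤ ∑ j ∈ Finset.range K, (j : ℝ) * a j := by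
        have : S K - S N = ∑ j ∈ Finset.Ico N K, a j := (Finset.sum_Ico_eq_sub _ h).symm
        rw [this, Finset.mul_sum]
        refine (Finset.sum_le_sum fun j hj => ?_).trans
          (Finset.sum_le_sum_of_subset_of_nonneg (s := Finset.Ico N K) ?_ ?_)
        · have : (N : ℝ) ≤ j := by exact_mod_cast (Finset.mem_Ico.1 hj).1
          exact mul_le_mul_of_nonneg_right this (ha0 j)
        · intro j hj; simpa using (Finset.mem_Ico.1 hj).2
        · intro j _ _; exact mul_nonneg (by positivity) (ha0 j)
      have h2 : ∑ j ∈ Finset.range K, (j : ℝ) * a j ≤ B * S K := by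
        cases K with
        | zero => simp [hS]
        | succ K =>
          rw [Finset.sum_range_succ']
          have h3 := hsum K
          push_cast
          simp only [zero_mul, add_zero]
          exact h3.trans (mul_le_mul_of_nonneg_left (hSmono K.le_succ) hB0)
      have h4 : 0 ≤ S K := Finset.sum_nonneg fun i _ => ha0 i
      nlinarith
  have hmain : Summable fun j : ℕ => (j + 1 : ℝ) * a (j + 1) := by
    refine summable_of_sum_range_le (c := B * (2 * S N)) (fun j => mul_nonneg (by positivity) (ha0 _))
      fun K => (hsum K).trans (mul_le_mul_of_nonneg_left (hbd K) hB0)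
  refine (summable_nat_add_iff 1).1 ?_
  refine Summable.of_nonneg_of_le (fun j => by positivity) (fun j => ?_) (hmain.mul_left 2)
  simp only [ha]
  push_cast
  have : (0 : ℝ) ≤ |q (j + 1)| := abs_nonneg _
  have h5 : (0 : ℝ) ≤ j := Nat.cast_nonneg j
  nlinarith [mul_nonneg h5 this, mul_nonneg (mul_nonneg h5 h5) this]

theorem summable_abs_of_summable_sq_mul {g : ℕ → ℝ}
    (hg : Summable fun k : ℕ => (k + 1 : ℝ) ^ 2 * |g k|) : Summable fun k => |g k| := by
  refine Summable.of_nonneg_of_le (fun k => abs_nonneg _) (fun k => ?_) hg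
  have : (1 : ℝ) ≤ (k + 1 : ℝ) ^ 2 := by
    have : (0 : ℝ) ≤ k := Nat.cast_nonneg k
    nlinarith
  nlinarith [abs_nonneg (g k)]

/-- The Cauchy product with the series of `exp (-∑ c n z^n)` is `1`, so the two sums at `z = 1`
multiply to `1`. -/
theorem tsum_expCoeff_ne_zero {c : ℕ → ℝ} (h1 : Summable fun k => |expCoeff c k|)
    (h2 : Summable fun k => |expCoeff (fun n => -c n) k|) : ∑' k, expCoeff c k ≠ 0 := by
  have := tsum_mul_tsum_eq_tsum_sum_range_of_summable_norm (f := expCoeff c)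
    (g := expCoeff fun n => -c n) h1 h2
  simp only [sum_expCoeff_mul_expCoeff_neg, tsum_ite_eq] at this
  intro h
  simp [h] at this

/-! ### Binomial coefficients -/

/-- The Taylor coefficients of `(1 - z) ^ (-α)`. -/
def powCoeff (α : ℝ) : ℕ → ℝ := expCoeff fun n => α / n

theorem powCoeff_zero (α : ℝ) : powCoeff α 0 = 1 := expCoeff_zero _

/-- Since `n * (α / n) = α`, the recursion of `expCoeff` expresses the next coefficient as `α` times
a partial sum; comparing two consecutive partial sums leaves a two-term recursion. -/
theorem succ_mul_powCoeff_succ (α : ℝ) (j : ℕ) :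
    (j + 1 : ℝ) * powCoeff α (j + 1) = (j + α) * powCoeff α j := by
  have key : ∀ j : ℕ, (j + 1 : ℝ) * powCoeff α (j + 1) =
      α * ∑ i ∈ Finset.range (j + 1), powCoeff α i := by
    intro j
    rw [powCoeff, succ_mul_expCoeff_succ, ← Finset.sum_range_reflect, Finset.mul_sum]
    refine Finset.sum_congr rfl fun i hi => ?_
    have hij : i ≤ j := by simpa [Nat.lt_succ_iff] using hi
    have : j - (j + 1 - 1 - i) = i := by omega
    rw [this]
    push_cast
    field_simp
  cases j with
  | zero => rw [key]; simp
  | succ j =>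
    rw [key, Finset.sum_range_succ, mul_add, ← key]
    push_cast
    ring

theorem powCoeff_nonneg {α : ℝ} (hα : 0 ≤ α) (j : ℕ) : 0 ≤ powCoeff α j := by
  induction j with
  | zero => rw [powCoeff_zero]; exact zero_le_one
  | succ j ih =>
    have := succ_mul_powCoeff_succ α j
    have h : 0 ≤ (j + 1 : ℝ) * powCoeff α (j + 1) := by rw [this]; positivity
    exact nonneg_of_mul_nonneg_right h (by positivity)

/-- After the constant term `1` all coefficients of `(1 - z)^d` are nonpositive, while all partial
sums are nonnegative; hence the remaining absolute values sum to at most `1`. -/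
theorem summable_abs_powCoeff_neg {d : ℝ} (h0 : 0 < d) (h1 : d < 1) :
    Summable fun j => |powCoeff (-d) j| := by
  have hneg : ∀ j, powCoeff (-d) (j + 1) ≤ 0 := by
    intro j
    induction j with
    | zero =>
      have := succ_mul_powCoeff_succ (-d) 0
      rw [powCoeff_zero] at this
      simp at this
      simp [this, h0.le]
    | succ j ih =>
      have := succ_mul_powCoeff_succ (-d) (j + 1)
      have h : ((j + 1 : ℕ) + 1 : ℝ) * powCoeff (-d) (j + 1 + 1) ≤ 0 := by
        rw [this]
        refine mul_nonpos_of_nonneg_of_nonpos ?_ ih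
        push_cast
        linarith [(Nat.cast_nonneg j : (0 : ℝ) ≤ j)]
      exact nonpos_of_mul_nonpos_right h (by positivity)
  have hpart : ∀ n : ℕ, -d * ∑ i ∈ Finset.range (n + 1), powCoeff (-d) i =
      (n + 1) * powCoeff (-d) (n + 1) := by
    intro n
    induction n with
    | zero =>
      rw [succ_mul_powCoeff_succ]; simp
    | succ n ih =>
      have := succ_mul_powCoeff_succ (-d) (n + 1)
      rw [Finset.sum_range_succ, mul_add, ih]
      push_cast at this ⊢
      linear_combination -this
  refine (summable_nat_add_iff 1).1 (summable_of_sum_range_le (c := 1) (fun n => abs_nonneg _) ?_)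
  intro n
  have h2 : 0 ≤ ∑ i ∈ Finset.range (n + 1), powCoeff (-d) i := by
    have := hpart n
    have h3 : ((n : ℝ) + 1) * powCoeff (-d) (n + 1) ≤ 0 :=
      mul_nonpos_of_nonneg_of_nonpos (by positivity) (hneg n)
    rw [← this] at h3
    by_contra hlt
    push Not at hlt
    nlinarith
  rw [Finset.sum_range_succ', powCoeff_zero] at h2
  have : ∑ i ∈ Finset.range n, |powCoeff (-d) (i + 1)| =
      -∑ i ∈ Finset.range n, powCoeff (-d) (i + 1) := by
    rw [← Finset.sum_neg_distrib]
    exact Finset.sum_congr rfl fun i _ => abs_of_nonpos (hneg i)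
  linarith

theorem powCoeff_mul_prod (d : ℝ) (n : ℕ) :
    powCoeff d n * (n.factorial : ℝ) * (d + n) = ∏ j ∈ Finset.range (n + 1), (d + j) := by
  induction n with
  | zero => simp [powCoeff_zero]
  | succ n ih =>
    rw [Finset.prod_range_succ, ← ih, Nat.factorial_succ]
    have := succ_mul_powCoeff_succ d n
    push_cast
    linear_combination (n.factorial : ℝ) * (d + (n + 1)) * this

/-- Up to the factor `n / (d + n)`, the sequence is the reciprocal of Euler's approximation
`Real.GammaSeq d n`. -/
theorem tendsto_powCoeff {d : ℝ} (hd : 0 < d) :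
    Tendsto (fun j : ℕ => powCoeff d j * (j : ℝ) ^ (1 - d)) atTop (𝓝 (Real.Gamma d)⁻¹) := by
  have h1 := (Real.GammaSeq_tendsto_Gamma d).inv₀ (Real.Gamma_pos_of_pos hd).ne'
  have h2 : Tendsto (fun j : ℕ => (j : ℝ) / (d + j)) atTop (𝓝 1) := by
    simpa [add_comm] using tendsto_natCast_div_add_atTop (𝕜 := ℝ) d
  have h3 := h1.mul h2
  rw [mul_one] at h3
  refine h3.congr' ?_
  filter_upwards [eventually_ge_atTop 1] with n hn
  have hn' : (0 : ℝ) < n := by exact_mod_cast hn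
  rw [Real.GammaSeq, ← powCoeff_mul_prod d, Real.rpow_sub hn', Real.rpow_one]
  have : (0 : ℝ) < (n : ℝ) ^ d := Real.rpow_pos_of_pos hn' d
  have h4 : (0 : ℝ) < n.factorial := by exact_mod_cast n.factorial_pos
  field_simp

theorem powCoeff_le {d : ℝ} (hd : 0 < d) :
    ∃ C, 0 < C ∧ ∀ j : ℕ, powCoeff d j ≤ C * (j + 1 : ℝ) ^ (d - 1) := by
  have h1 : Tendsto (fun j : ℕ => powCoeff d j * (j : ℝ) ^ (1 - d) *
      (((j : ℝ) + 1) / j) ^ (1 - d)) atTop (𝓝 ((Real.Gamma d)⁻¹ * 1 ^ (1 - d))) := by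
    refine (tendsto_powCoeff hd).mul ?_
    refine Tendsto.rpow_const ?_ (Or.inl one_ne_zero)
    have := (tendsto_natCast_div_add_atTop (𝕜 := ℝ) 1).inv₀ one_ne_zero
    simpa using this
  have h2 : Tendsto (fun j : ℕ => powCoeff d j * (j + 1 : ℝ) ^ (1 - d)) atTop
      (𝓝 ((Real.Gamma d)⁻¹ * 1 ^ (1 - d))) := by
    refine h1.congr' ?_
    filter_upwards [eventually_ge_atTop 1] with n hn
    have hn' : (0 : ℝ) < n := by exact_mod_cast hn
    rw [mul_assoc, ← Real.mul_rpow hn'.le (by positivity)]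
    congr 2
    field_simp
  obtain ⟨C, hC⟩ := h2.bddAbove_range
  refine ⟨max C 1, by positivity, fun j => ?_⟩
  have h3 : powCoeff d j * (j + 1 : ℝ) ^ (1 - d) ≤ max C 1 :=
    (hC (mem_range_self j)).trans (le_max_left _ _)
  have h4 : (0 : ℝ) < (j + 1 : ℝ) ^ (d - 1) := by positivity
  have h5 : (j + 1 : ℝ) ^ (1 - d) * (j + 1 : ℝ) ^ (d - 1) = 1 := by
    rw [← Real.rpow_add (by positivity)]; simp
  calc powCoeff d j = powCoeff d j * (j + 1 : ℝ) ^ (1 - d) * (j + 1 : ℝ) ^ (d - 1) := by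
        rw [mul_assoc, h5, mul_one]
    _ ≤ _ := by gcongr

theorem abs_powCoeff_sub_le {d : ℝ} (hd : 0 < d) (hd1 : d < 1) :
    ∃ C, 0 < C ∧ ∀ j : ℕ, |powCoeff d (j + 1) - powCoeff d j| ≤ C * (j + 1 : ℝ) ^ (d - 2) := by
  obtain ⟨C, hC0, hC⟩ := powCoeff_le hd
  refine ⟨C, hC0, fun j => ?_⟩
  have h1 : powCoeff d (j + 1) - powCoeff d j = -((1 - d) / (j + 1)) * powCoeff d j := by
    have := succ_mul_powCoeff_succ d j
    field_simp
    linear_combination this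
  rw [h1, abs_mul, abs_neg, abs_of_nonneg (powCoeff_nonneg hd.le j),
    abs_of_nonneg (div_nonneg (by linarith) (by positivity))]
  have h2 : (j + 1 : ℝ) ^ (d - 2) = (j + 1 : ℝ) ^ (d - 1) / (j + 1) := by
    rw [← Real.rpow_sub_one (by positivity)]; ring_nf
  rw [h2]
  calc (1 - d) / (j + 1) * powCoeff d j ≤ 1 / (j + 1) * (C * (j + 1 : ℝ) ^ (d - 1)) := by
        gcongr
        · exact powCoeff_nonneg hd.le j
        · linarith
        · exact hC j
    _ = _ := by ring

/-! ### Convolutions with power-law sequences -/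

/-- Dominated convergence for series: each fixed `k` contributes `g k * L`, because `(j / (j -
k))^(1 - d)` tends to `1`. The inequality `j ≤ (k + 1)(j - k + 1)` bounds the terms by `(k + 1)^2 |g
k|`, uniformly in `j`. -/
theorem tendsto_convolution_mul_rpow {d L : ℝ} (hd : 0 < d) (hd1 : d < 1) {b g : ℕ → ℝ} {C : ℝ}
    (hb : ∀ j : ℕ, |b j| ≤ C * (j + 1 : ℝ) ^ (d - 1))
    (hbL : Tendsto (fun j : ℕ => b j * (j : ℝ) ^ (1 - d)) atTop (𝓝 L))
    (hg : Summable fun k : ℕ => (k + 1 : ℝ) ^ 2 * |g k|) :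
    Tendsto (fun j : ℕ => (∑ k ∈ Finset.range (j + 1), g k * b (j - k)) * (j : ℝ) ^ (1 - d)) atTop
      (𝓝 ((∑' k, g k) * L)) := by
  have hC0 : 0 ≤ C := by simpa using (abs_nonneg _).trans (hb 0)
  have h := tendsto_tsum_of_dominated_convergence (𝓕 := atTop)
    (f := fun (j k : ℕ) => if k ∈ Finset.range (j + 1) then g k * b (j - k) * (j : ℝ) ^ (1 - d) else 0)
    (g := fun k => g k * L) (bound := fun k => C * ((k + 1 : ℝ) ^ 2 * |g k|))
    (hg.mul_left C) ?_ ?_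
  · rw [tsum_mul_right] at h
    refine h.congr fun j => ?_
    rw [tsum_eq_sum (s := Finset.range (j + 1)) (fun k hk => by rw [if_neg hk]), Finset.sum_mul]
    exact Finset.sum_congr rfl fun k hk => by rw [if_pos hk]
  · intro k
    have h1 : Tendsto (fun j : ℕ => g k * (b (j - k) * ((j - k : ℕ) : ℝ) ^ (1 - d)) *
        ((j : ℝ) / (j - k : ℕ)) ^ (1 - d)) atTop (𝓝 (g k * L * 1 ^ (1 - d))) := by
      refine Tendsto.mul ((hbL.comp (tendsto_sub_atTop_nat k)).const_mul _) ?_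
      refine Tendsto.rpow_const ?_ (Or.inl one_ne_zero)
      have h2 := (((tendsto_natCast_div_add_atTop (𝕜 := ℝ) k).comp (tendsto_sub_atTop_nat k)).inv₀
        one_ne_zero)
      rw [inv_one] at h2
      refine h2.congr' ?_
      filter_upwards [eventually_gt_atTop k] with j hj
      simp only [Function.comp_apply, inv_div]
      congr 1
      rw [Nat.cast_sub hj.le]; ring
    rw [Real.one_rpow, mul_one] at h1
    refine h1.congr' ?_
    filter_upwards [eventually_gt_atTop k] with j hj
    have hp : (0 : ℝ) < ((j - k : ℕ) : ℝ) := by exact_mod_cast Nat.sub_pos_of_lt hj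
    rw [if_pos (Finset.mem_range.2 (by omega)), mul_assoc, mul_assoc, mul_assoc,
      ← Real.mul_rpow hp.le (by positivity)]
    congr 4
    field_simp
  · refine Eventually.of_forall fun j k => ?_
    split_ifs with hk
    · have hkj : k ≤ j := by simpa [Nat.lt_succ_iff] using hk
      rw [norm_mul, norm_mul, Real.norm_eq_abs, Real.norm_eq_abs, Real.norm_eq_abs,
        abs_of_nonneg (by positivity : (0 : ℝ) ≤ (j : ℝ) ^ (1 - d))]
      have hkk : (k : ℝ) ≤ j := by exact_mod_cast hkj
      have hm : (0 : ℝ) < ((j - k : ℕ) : ℝ) + 1 := by positivity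
      have h2 : (j : ℝ) ≤ (k + 1) * (((j - k : ℕ) : ℝ) + 1) := by
        rw [Nat.cast_sub hkj]
        nlinarith [(Nat.cast_nonneg k : (0 : ℝ) ≤ k)]
      have h3 : (j : ℝ) ^ (1 - d) ≤ (k + 1) ^ 2 * (((j - k : ℕ) : ℝ) + 1) ^ (1 - d) := by
        calc (j : ℝ) ^ (1 - d) ≤ ((k + 1) * (((j - k : ℕ) : ℝ) + 1)) ^ (1 - d) := by
              gcongr
          _ = (k + 1 : ℝ) ^ (1 - d) * (((j - k : ℕ) : ℝ) + 1) ^ (1 - d) :=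
              Real.mul_rpow (by positivity) (by positivity)
          _ ≤ (k + 1 : ℝ) ^ (2 : ℝ) * (((j - k : ℕ) : ℝ) + 1) ^ (1 - d) := by
              gcongr
              · linarith [(Nat.cast_nonneg k : (0 : ℝ) ≤ k)]
              · linarith
          _ = _ := by norm_num
      have h5 : (((j - k : ℕ) : ℝ) + 1) ^ (d - 1) * (((j - k : ℕ) : ℝ) + 1) ^ (1 - d) = 1 := by
        rw [← Real.rpow_add (by positivity)]; simp
      calc |g k| * |b (j - k)| * (j : ℝ) ^ (1 - d)
          ≤ |g k| * (C * (((j - k : ℕ) : ℝ) + 1) ^ (d - 1)) *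
            ((k + 1) ^ 2 * (((j - k : ℕ) : ℝ) + 1) ^ (1 - d)) := by
            gcongr
            exact hb _
        _ = C * ((k + 1 : ℝ) ^ 2 * |g k|) * ((((j - k : ℕ) : ℝ) + 1) ^ (d - 1) *
            (((j - k : ℕ) : ℝ) + 1) ^ (1 - d)) := by ring
        _ = _ := by rw [h5, mul_one]
    · rw [norm_zero]; positivity

theorem abs_convolution_sub_le {d : ℝ} (hd : 0 < d) (hd1 : d < 1) {b g : ℕ → ℝ} {C : ℝ}
    (hb : ∀ j : ℕ, |b (j + 1) - b j| ≤ C * (j + 1 : ℝ) ^ (d - 2))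
    (hg : Summable fun k : ℕ => (k + 1 : ℝ) ^ 2 * |g k|) :
    (fun j : ℕ => |(∑ k ∈ Finset.range (j + 1), g k * b (j - k)) -
      ∑ k ∈ Finset.range (j + 1 + 1), g k * b (j + 1 - k)|) =O[atTop]
      fun j : ℕ => (j : ℝ) ^ (d - 2) := by
  have hC0 : 0 ≤ C := by simpa using (abs_nonneg _).trans (hb 0)
  set M := ∑' k : ℕ, (k + 1 : ℝ) ^ 2 * |g k| with hM
  have hM0 : 0 ≤ M := tsum_nonneg fun k => by positivity
  refine IsBigO.of_bound (C * M + M * |b 0|) ?_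
  filter_upwards [eventually_ge_atTop 1] with j hj
  have hj' : (1 : ℝ) ≤ j := by exact_mod_cast hj
  have hpow : ∀ k ≤ j, (((j - k : ℕ) : ℝ) + 1) ^ (d - 2) ≤ (k + 1) ^ 2 * (j : ℝ) ^ (d - 2) := by
    intro k hkj
    have hkk : (k : ℝ) ≤ j := by exact_mod_cast hkj
    have h2 : (j : ℝ) / (k + 1) ≤ (((j - k : ℕ) : ℝ) + 1) := by
      rw [div_le_iff₀ (by positivity), Nat.cast_sub hkj]
      nlinarith [(Nat.cast_nonneg k : (0 : ℝ) ≤ k)]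
    calc (((j - k : ℕ) : ℝ) + 1) ^ (d - 2) ≤ ((j : ℝ) / (k + 1)) ^ (d - 2) :=
          Real.rpow_le_rpow_of_nonpos (by positivity) h2 (by linarith)
      _ = (k + 1 : ℝ) ^ (2 - d) * (j : ℝ) ^ (d - 2) := by
          rw [Real.div_rpow (by positivity) (by positivity), div_eq_mul_inv,
            ← Real.rpow_neg (by positivity), neg_sub, mul_comm]
      _ ≤ (k + 1 : ℝ) ^ (2 : ℝ) * (j : ℝ) ^ (d - 2) := by
          gcongr
          · linarith [(Nat.cast_nonneg k : (0 : ℝ) ≤ k)]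
          · linarith
      _ = _ := by norm_num
  -- The longer sum has one unmatched term, `g (j + 1) * b 0`; it is split off and controlled by the
  -- decay of `g` alone. The matched terms are increments of `b`.
  rw [Finset.sum_range_succ _ (j + 1), ← sub_sub, ← Finset.sum_sub_distrib]
  simp only [norm_abs_eq_norm, Nat.sub_self]
  rw [Real.norm_of_nonneg (by positivity : (0 : ℝ) ≤ (j : ℝ) ^ (d - 2)), add_mul]
  refine (norm_sub_le _ _).trans (add_le_add ?_ ?_)
  · calc ‖∑ k ∈ Finset.range (j + 1), (g k * b (j - k) - g k * b (j + 1 - k))‖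
        ≤ ∑ k ∈ Finset.range (j + 1), C * (j : ℝ) ^ (d - 2) * ((k + 1 : ℝ) ^ 2 * |g k|) := by
          refine norm_sum_le_of_le _ fun k hk => ?_
          have hkj : k ≤ j := by simpa [Nat.lt_succ_iff] using hk
          have h1 : j + 1 - k = (j - k) + 1 := by omega
          rw [h1, ← mul_sub, norm_mul, Real.norm_eq_abs, Real.norm_eq_abs, abs_sub_comm]
          calc |g k| * |b (j - k + 1) - b (j - k)|
              ≤ |g k| * (C * ((k + 1) ^ 2 * (j : ℝ) ^ (d - 2))) := by
                gcongr
                exact (hb _).trans (by gcongr; exact hpow k hkj)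
            _ = _ := by ring
      _ = C * (j : ℝ) ^ (d - 2) * ∑ k ∈ Finset.range (j + 1), ((k + 1 : ℝ) ^ 2 * |g k|) :=
          (Finset.mul_sum _ _ _).symm
      _ ≤ C * (j : ℝ) ^ (d - 2) * M := by
          gcongr
          exact hg.sum_le_tsum _ fun k _ => by positivity
      _ = _ := by ring
  · rw [norm_mul, Real.norm_eq_abs, Real.norm_eq_abs, mul_right_comm]
    gcongr
    have h1 : ((j + 1 : ℕ) + 1 : ℝ) ^ 2 * |g (j + 1)| ≤ M :=
      hg.le_tsum (j + 1) fun k _ => by positivity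
    have h2 : ((j + 1 : ℕ) + 1 : ℝ) ^ (-2 : ℝ) ≤ (j : ℝ) ^ (d - 2) := by
      calc ((j + 1 : ℕ) + 1 : ℝ) ^ (-2 : ℝ) ≤ (j : ℝ) ^ (-2 : ℝ) :=
            Real.rpow_le_rpow_of_nonpos (by positivity) (by push_cast; linarith) (by norm_num)
        _ ≤ _ := Real.rpow_le_rpow_of_exponent_le hj' (by linarith)
    have h3 : ((j + 1 : ℕ) + 1 : ℝ) ^ (-2 : ℝ) = (((j + 1 : ℕ) + 1 : ℝ) ^ 2)⁻¹ := by
      rw [Real.rpow_neg (by positivity)]; norm_num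
    calc |g (j + 1)| = (((j + 1 : ℕ) + 1 : ℝ) ^ 2 * |g (j + 1)|) *
          (((j + 1 : ℕ) + 1 : ℝ) ^ 2)⁻¹ := by field_simp
      _ ≤ M * (j : ℝ) ^ (d - 2) := by
          gcongr
          rw [← h3]; exact h2

/-! ### Taylor coefficients of the exponential of an analytic function -/

theorem hasFPowerSeriesOnBall_of_hasSum {a : ℕ → ℂ} {M : ℝ} (ha : ∀ n, ‖a n‖ ≤ M) {S : ℂ → ℂ}
    (hS : ∀ z : ℂ, ‖z‖ < 1 → HasSum (fun n => a n * z ^ n) (S z)) :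
    HasFPowerSeriesOnBall S (FormalMultilinearSeries.ofScalars ℂ a) 0 1 where
  r_le := by
    have := (FormalMultilinearSeries.ofScalars ℂ a).le_radius_of_bound (r := 1) M fun n => by
      simpa using ha n
    simpa using this
  r_pos := one_pos
  hasSum := fun {y} hy => by
    have hy' : ‖y‖ < 1 := by
      rw [← ENNReal.ofReal_one, Metric.eball_ofReal] at hy
      simpa using hy
    simpa [FormalMultilinearSeries.ofScalars_apply_eq, mul_comm] using hS y hy'

theorem iteratedDeriv_eq_of_hasSum {a : ℕ → ℂ} {M : ℝ} (ha : ∀ n, ‖a n‖ ≤ M) {S : ℂ → ℂ}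
    (hS : ∀ z : ℂ, ‖z‖ < 1 → HasSum (fun n => a n * z ^ n) (S z)) (n : ℕ) :
    iteratedDeriv n S 0 = n.factorial * a n := by
  have h1 := hasFPowerSeriesOnBall_of_hasSum ha hS
  have h2 := h1.analyticAt.hasFPowerSeriesAt
  have h3 := h1.hasFPowerSeriesAt.eq_formalMultilinearSeries h2
  have h4 := congrArg (fun p => FormalMultilinearSeries.coeff p n) h3
  simp only [FormalMultilinearSeries.coeff_ofScalars] at h4
  rw [h4]
  have : (n.factorial : ℂ) ≠ 0 := by exact_mod_cast n.factorial_ne_zero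
  field_simp

section ExpTaylor

variable {c : ℕ → ℝ} {M : ℝ} {S F : ℂ → ℂ}

theorem norm_shifted_coeff_le (hc : ∀ n, |c n| ≤ M) (n : ℕ) :
    ‖(if n = 0 then 0 else (c n : ℂ))‖ ≤ M := by
  split_ifs
  · simpa using (abs_nonneg _).trans (hc 0)
  · simpa using hc n

/-- Differentiating gives `F' = S' F`. Leibniz's formula at `0`, divided by factorials, is the
recursion of `expCoeff`. -/
theorem iteratedDeriv_exp_eq (hc : ∀ n, |c n| ≤ M)
    (hS : ∀ z : ℂ, ‖z‖ < 1 → HasSum (fun n => (if n = 0 then 0 else (c n : ℂ)) * z ^ n) (S z))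
    (hF : ∀ z : ℂ, ‖z‖ < 1 → F z = Complex.exp (S z)) (j : ℕ) :
    iteratedDeriv j F 0 / (j.factorial : ℂ) = (expCoeff c j : ℂ) := by
  set a : ℕ → ℂ := fun n => if n = 0 then 0 else (c n : ℂ) with ha
  have hball : ∀ᶠ z : ℂ in 𝓝 0, ‖z‖ < 1 := by
    have := Metric.ball_mem_nhds (0 : ℂ) one_pos
    filter_upwards [this] with z hz using by simpa using hz
  have hSan : AnalyticAt ℂ S 0 :=
    (hasFPowerSeriesOnBall_of_hasSum (norm_shifted_coeff_le hc) hS).analyticAt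
  have hEan : AnalyticAt ℂ (fun z => Complex.exp (S z)) 0 := hSan.cexp
  have hFE : F =ᶠ[𝓝 0] fun z => Complex.exp (S z) := by
    filter_upwards [hball] with z hz using hF z hz
  have hS0 : S 0 = 0 := by
    have h1 := hS 0 (by simp)
    have h2 : HasSum (fun n => a n * (0 : ℂ) ^ n) 0 := by
      convert! hasSum_zero (α := ℂ) (β := ℕ) using 1
      funext n
      cases n <;> simp [ha]
    exact h1.unique h2
  have hderiv : deriv F =ᶠ[𝓝 0] fun z => deriv S z * F z := by
    refine hFE.deriv.trans ?_
    filter_upwards [hSan.eventually_analyticAt, hFE] with z hz hz'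
    rw [hz', (hz.differentiableAt.hasDerivAt.cexp).deriv, mul_comm]
  have hFan : AnalyticAt ℂ F 0 := hEan.congr hFE.symm
  have hF0 : F 0 = 1 := by rw [hF 0 (by simp), hS0, Complex.exp_zero]
  have hrec : ∀ j : ℕ, iteratedDeriv (j + 1) F 0 = ∑ i ∈ Finset.range (j + 1),
      (j.choose i : ℂ) * ((i + 1).factorial * a (i + 1)) * iteratedDeriv (j - i) F 0 := by
    intro j
    rw [iteratedDeriv_succ', hderiv.iteratedDeriv_eq,
      show (fun z => deriv S z * F z) = deriv S * F from rfl,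
      iteratedDeriv_mul hSan.deriv.contDiffAt hFan.contDiffAt]
    refine Finset.sum_congr rfl fun i _ => ?_
    rw [← iteratedDeriv_succ', iteratedDeriv_eq_of_hasSum (norm_shifted_coeff_le hc) hS]
  induction j using Nat.strong_induction_on with
  | _ j ih =>
    cases j with
    | zero => simp [hF0, expCoeff_zero]
    | succ j =>
      have hne : ∀ n : ℕ, (n.factorial : ℂ) ≠ 0 := fun n => by exact_mod_cast n.factorial_ne_zero
      have h1 : (j + 1 : ℂ) * (iteratedDeriv (j + 1) F 0 / ((j + 1).factorial : ℂ)) =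
          (j + 1 : ℂ) * (expCoeff c (j + 1) : ℂ) := by
        have h2 := congrArg (fun x : ℝ => (x : ℂ)) (succ_mul_expCoeff_succ c j)
        push_cast at h2
        rw [h2, hrec, mul_div_assoc', Finset.mul_sum, Finset.sum_div]
        refine Finset.sum_congr rfl fun i hi => ?_
        have hij : i ≤ j := by simpa [Nat.lt_succ_iff] using hi
        rw [← ih (j - i) (by omega), Nat.cast_choose ℂ hij, Nat.factorial_succ j,
          Nat.factorial_succ i]
        have h3 : (j + 1 : ℂ) ≠ 0 := by exact_mod_cast j.succ_ne_zero
        have := hne j; have := hne i; have := hne (j - i)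
        simp only [ha, if_neg i.succ_ne_zero]
        push_cast
        field_simp
      exact mul_left_cancel₀ (by exact_mod_cast j.succ_ne_zero) h1

theorem hasSum_expCoeff (hc : ∀ n, |c n| ≤ M)
    (hS : ∀ z : ℂ, ‖z‖ < 1 → HasSum (fun n => (if n = 0 then 0 else (c n : ℂ)) * z ^ n) (S z))
    {z : ℂ} (hz : ‖z‖ < 1) :
    HasSum (fun n => (expCoeff c n : ℂ) * z ^ n) (Complex.exp (S z)) := by
  have hd : DifferentiableOn ℂ (fun z => Complex.exp (S z)) (Metric.ball 0 1) := by
    have := (hasFPowerSeriesOnBall_of_hasSum (norm_shifted_coeff_le hc) hS).differentiableOn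
    have h2 : Metric.eball (0 : ℂ) 1 = Metric.ball 0 1 := by
      simpa using Metric.eball_ofReal (x := (0 : ℂ)) (ε := 1)
    rw [h2] at this
    exact this.cexp
  have := Complex.hasSum_taylorSeries_on_ball hd (z := z) (by simpa using hz)
  refine this.congr_fun fun n => ?_
  rw [← iteratedDeriv_exp_eq hc hS (fun z _ => rfl) n]
  simp only [sub_zero, smul_eq_mul]
  ring

end ExpTaylor

/-! ### Cosine coefficients and the Herglotz integral -/

theorem intervalIntegrable_ofReal {u : ℝ → ℝ} {a b : ℝ} (hu : IntervalIntegrable u volume a b) :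
    IntervalIntegrable (fun w => (u w : ℂ)) volume a b :=
  ⟨hu.1.ofReal, hu.2.ofReal⟩

/-- The `n`-th cosine coefficient of `L` on `[-π, π]`. -/
def cosCoeff (L : ℝ → ℝ) (n : ℕ) : ℝ :=
  1 / (2 * Real.pi) * ∫ w in (-Real.pi)..Real.pi, Real.cos (n * w) * L w

theorem abs_cosCoeff_le {L : ℝ → ℝ} (hL : IntervalIntegrable L volume (-Real.pi) Real.pi) (n : ℕ) :
    |cosCoeff L n| ≤ 1 / (2 * Real.pi) * ∫ w in (-Real.pi)..Real.pi, |L w| := by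
  have hpi := Real.pi_pos
  rw [cosCoeff, abs_mul, abs_of_pos (by positivity)]
  gcongr
  rw [← Real.norm_eq_abs]
  refine intervalIntegral.norm_integral_le_of_norm_le (g := fun w => |L w|) (by linarith) ?_ hL.norm
  refine Eventually.of_forall fun w _ => ?_
  rw [norm_mul]
  exact mul_le_of_le_one_left (norm_nonneg _) (Real.abs_cos_le_one _)

theorem integral_symmetric_eq_zero_of_odd {u : ℝ → ℝ} {a : ℝ}
    (hu : ∀ᵐ w, w ∈ uIoc (-a) a → u (-w) = -u w) : ∫ w in (-a)..a, u w = 0 := by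
  have h1 : ∫ w in (-a)..a, u (-w) = ∫ w in (-a)..a, u w := by
    rw [intervalIntegral.integral_comp_neg]; simp
  have h2 : ∫ w in (-a)..a, u (-w) = ∫ w in (-a)..a, -u w :=
    intervalIntegral.integral_congr_ae hu
  rw [intervalIntegral.integral_neg] at h2
  linarith

theorem integral_exp_neg_mul_eq_cosCoeff {L : ℝ → ℝ}
    (hL : IntervalIntegrable L volume (-Real.pi) Real.pi)
    (heven : ∀ᵐ w, w ∈ uIoc (-Real.pi) Real.pi → L (-w) = L w) (n : ℕ) :
    ∫ w in (-Real.pi)..Real.pi, Complex.exp (-(Complex.I * (n * w))) * (L w : ℂ) =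
      2 * Real.pi * cosCoeff L n := by
  have h1 : ∀ w : ℝ, Complex.exp (-(Complex.I * (n * w))) * (L w : ℂ) =
      ((Real.cos (n * w) * L w : ℝ) : ℂ) - Complex.I * ((Real.sin (n * w) * L w : ℝ) : ℂ) := by
    intro w
    rw [← mul_neg, mul_comm Complex.I, Complex.exp_mul_I]
    push_cast
    rw [Complex.cos_neg, Complex.sin_neg]
    ring
  have hc : IntervalIntegrable (fun w => Real.cos (n * w) * L w) volume (-Real.pi) Real.pi :=
    hL.continuousOn_mul (by fun_prop)
  have hs : IntervalIntegrable (fun w => Real.sin (n * w) * L w) volume (-Real.pi) Real.pi :=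
    hL.continuousOn_mul (by fun_prop)
  simp_rw [h1]
  rw [intervalIntegral.integral_sub, intervalIntegral.integral_const_mul,
    intervalIntegral.integral_ofReal, intervalIntegral.integral_ofReal,
    integral_symmetric_eq_zero_of_odd (u := fun w => Real.sin (n * w) * L w)]
  · rw [cosCoeff]
    push_cast
    have : (Real.pi : ℂ) ≠ 0 := by exact_mod_cast Real.pi_ne_zero
    field_simp
    simp
  · filter_upwards [heven] with w hw hw'
    rw [hw hw', mul_neg, Real.sin_neg, neg_mul]
  · exact intervalIntegrable_ofReal hc
  · exact (intervalIntegrable_ofReal hs).const_mul _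

/-- Expand `z / (e^{iw} - z) = ∑_{n ≥ 1} z^n e^{-inw}` and integrate termwise against `L`, the terms
being dominated by `‖z‖^n |L w|`. -/
theorem hasSum_herglotz {L : ℝ → ℝ} (hL : IntervalIntegrable L volume (-Real.pi) Real.pi)
    (heven : ∀ᵐ w, w ∈ uIoc (-Real.pi) Real.pi → L (-w) = L w) {z : ℂ} (hz : ‖z‖ < 1) :
    HasSum (fun n => (if n = 0 then 0 else (cosCoeff L n : ℂ)) * z ^ n)
      (1 / (2 * (Real.pi : ℂ)) * ∫ w in (-Real.pi)..Real.pi,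
        z / (Complex.exp (Complex.I * w) - z) * (L w : ℂ)) := by
  have hpi : (Real.pi : ℂ) ≠ 0 := by exact_mod_cast Real.pi_ne_zero
  have hexp : ∀ w : ℝ, ‖Complex.exp (Complex.I * w)‖ = 1 := fun w => by
    rw [mul_comm]; exact Complex.norm_exp_ofReal_mul_I w
  have key := intervalIntegral.hasSum_integral_of_dominated_convergence (μ := volume)
    (a := -Real.pi) (b := Real.pi)
    (F := fun (n : ℕ) (w : ℝ) => z ^ (n + 1) *
      (Complex.exp (-(Complex.I * ((n + 1 : ℕ) * w))) * (L w : ℂ)))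
    (f := fun w : ℝ => z / (Complex.exp (Complex.I * w) - z) * (L w : ℂ))
    (fun n w => ‖z‖ ^ (n + 1) * |L w|) ?_ ?_ ?_ ?_ ?_
  · refine (hasSum_nat_add_iff' 1).1 ?_
    simp only [Finset.range_one, Finset.sum_singleton, if_true, zero_mul, sub_zero]
    refine (key.mul_left (1 / (2 * (Real.pi : ℂ)))).congr_fun fun n => ?_
    rw [intervalIntegral.integral_const_mul, integral_exp_neg_mul_eq_cosCoeff hL heven,
      if_neg n.succ_ne_zero]
    field_simp
  · intro n
    refine AEStronglyMeasurable.const_mul (AEStronglyMeasurable.mul ?_ ?_) _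
    · exact Continuous.aestronglyMeasurable (by fun_prop)
    · exact Complex.continuous_ofReal.comp_aestronglyMeasurable hL.def'.aestronglyMeasurable
  · intro n
    refine Eventually.of_forall fun w _ => ?_
    rw [norm_mul, norm_mul, norm_pow, Complex.norm_real, Real.norm_eq_abs]
    have : ‖Complex.exp (-(Complex.I * ((n + 1 : ℕ) * w)))‖ = 1 := by
      have := Complex.norm_exp_ofReal_mul_I (-((n + 1 : ℕ) * w))
      rw [← this]; congr 2; push_cast; ring
    rw [this, one_mul]
  · refine Eventually.of_forall fun w _ => ?_
    exact ((summable_nat_add_iff 1).2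
      (summable_geometric_of_lt_one (norm_nonneg z) hz)).mul_right _
  · simp_rw [tsum_mul_right]
    exact hL.abs.const_mul _
  · refine Eventually.of_forall fun w _ => ?_
    have hlt : ‖z * Complex.exp (-(Complex.I * w))‖ < 1 := by
      rw [norm_mul, Complex.exp_neg, norm_inv, hexp]; simpa using hz
    have h1 := ((hasSum_geometric_of_norm_lt_one hlt).mul_left
      (z * Complex.exp (-(Complex.I * w)))).mul_right (L w : ℂ)
    have hE := Complex.exp_ne_zero (Complex.I * w)
    have hne : Complex.exp (Complex.I * w) - z ≠ 0 := by
      intro h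
      have := hexp w
      rw [sub_eq_zero.1 h] at this
      linarith
    have h2 : z / (Complex.exp (Complex.I * w) - z) =
        z * Complex.exp (-(Complex.I * w)) * (1 - z * Complex.exp (-(Complex.I * w)))⁻¹ := by
      rw [Complex.exp_neg]
      field_simp
    rw [h2]
    refine h1.congr_fun fun n => ?_
    rw [← pow_succ', mul_pow, ← Complex.exp_nat_mul, mul_assoc]
    congr 3
    push_cast; ring

/-- The kernel `(e^{iw} + z) / (e^{iw} - z)` is `1 + 2z / (e^{iw} - z)`, and division by the value
at `0` removes the `1`. -/
theorem outerFunction_div {f : ℝ → ℝ}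
    (hL : IntervalIntegrable (fun w => Real.log (f w)) volume (-Real.pi) Real.pi)
    {z : ℂ} (hz : ‖z‖ < 1) :
    outerFunction f z / outerFunction f 0 =
      Complex.exp (1 / (2 * (Real.pi : ℂ)) * ∫ w in (-Real.pi)..Real.pi,
        z / (Complex.exp (Complex.I * w) - z) * (Real.log (f w) : ℂ)) := by
  have hexp : ∀ w : ℝ, ‖Complex.exp (Complex.I * w)‖ = 1 := fun w => by
    rw [mul_comm]; exact Complex.norm_exp_ofReal_mul_I w
  have hL' : IntervalIntegrable (fun w => (Real.log (f w) : ℂ)) volume (-Real.pi) Real.pi :=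
    intervalIntegrable_ofReal hL
  have hne : ∀ w : ℝ, Complex.exp (Complex.I * w) - z ≠ 0 := by
    intro w h
    have := hexp w
    rw [sub_eq_zero.1 h] at this
    linarith
  have hint : IntervalIntegrable (fun w : ℝ => z / (Complex.exp (Complex.I * w) - z) *
      (Real.log (f w) : ℂ)) volume (-Real.pi) Real.pi := by
    refine hL'.continuousOn_mul (Continuous.continuousOn ?_)
    exact continuous_const.div (by fun_prop) hne
  rw [outerFunction, outerFunction, ← Complex.exp_sub, ← mul_sub]
  congr 1
  have h1 : ∀ w : ℝ, (Complex.exp (Complex.I * w) + z) / (Complex.exp (Complex.I * w) - z) *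
      (Real.log (f w) : ℂ) = (Real.log (f w) : ℂ) +
      2 * (z / (Complex.exp (Complex.I * w) - z) * (Real.log (f w) : ℂ)) := by
    intro w
    have := hne w
    field_simp
    ring
  have h2 : ∀ w : ℝ, (Complex.exp (Complex.I * w) + 0) / (Complex.exp (Complex.I * w) - 0) *
      (Real.log (f w) : ℂ) = (Real.log (f w) : ℂ) := by
    intro w
    rw [add_zero, sub_zero, div_self (Complex.exp_ne_zero _), one_mul]
  simp_rw [h1, h2]
  rw [intervalIntegral.integral_add hL' (hint.const_mul 2), intervalIntegral.integral_const_mul]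
  ring

/-- The Taylor coefficients of the normalized outer function in terms of the cosine coefficients
of the logarithm. -/
theorem maCoeff_eq_expCoeff {f : ℝ → ℝ}
    (hL : IntervalIntegrable (fun w => Real.log (f w)) volume (-Real.pi) Real.pi)
    (heven : ∀ᵐ w, w ∈ uIoc (-Real.pi) Real.pi → Real.log (f (-w)) = Real.log (f w)) :
    maCoeff f = expCoeff (cosCoeff fun w => Real.log (f w)) := by
  funext j
  rw [maCoeff, iteratedDeriv_exp_eq (abs_cosCoeff_le hL) (fun z hz => hasSum_herglotz hL heven hz)
    (fun z hz => outerFunction_div hL hz) j, Complex.ofReal_re]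

/-! ### Cosine coefficients of `log |1 - e^{iw}|` -/

theorem integral_cos_int_mul {m : ℤ} (hm : m ≠ 0) :
    ∫ w in (-Real.pi)..Real.pi, Real.cos (m * w) = 0 := by
  have hm' : (m : ℝ) ≠ 0 := by exact_mod_cast hm
  rw [intervalIntegral.integral_comp_mul_left (fun w => Real.cos w) hm', integral_cos]
  simp [Real.sin_int_mul_pi]

theorem integral_cos_mul_cos {n : ℕ} (k : ℕ) (hn : n ≠ 0) :
    ∫ w in (-Real.pi)..Real.pi, Real.cos (n * w) * Real.cos (k * w) =
      if k = n then Real.pi else 0 := by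
  have h1 : ∀ w : ℝ, Real.cos (n * w) * Real.cos (k * w) =
      1 / 2 * (Real.cos (((n + k : ℤ) : ℝ) * w) + Real.cos (((n - k : ℤ) : ℝ) * w)) := by
    intro w
    push_cast
    rw [add_mul, sub_mul, Real.cos_add, Real.cos_sub]
    ring
  have hi : ∀ m : ℤ, IntervalIntegrable (fun w : ℝ => Real.cos (m * w)) volume (-Real.pi) Real.pi :=
    fun m => Continuous.intervalIntegrable (by fun_prop) _ _
  simp_rw [h1]
  rw [intervalIntegral.integral_const_mul, intervalIntegral.integral_add (hi _) (hi _),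
    integral_cos_int_mul (by omega)]
  split_ifs with h
  · subst h
    simp only [sub_self, Int.cast_zero, zero_mul, Real.cos_zero, intervalIntegral.integral_const,
      smul_eq_mul]
    ring
  · rw [integral_cos_int_mul (by omega)]; simp

theorem norm_exp_I_mul (w : ℝ) : ‖Complex.exp (Complex.I * w)‖ = 1 := by
  rw [mul_comm]; exact Complex.norm_exp_ofReal_mul_I w

/-- The point `e^{iw}` is at distance `1 - r` from `r e^{iw}`, and `1 - r ≤ |1 - r e^{iw}|`. The
bound is uniform in `r` and provides the dominating functions for the limits `r → 1`. -/
theorem norm_one_sub_exp_le {r : ℝ} (h0 : 0 ≤ r) (h1 : r ≤ 1) (w : ℝ) :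
    ‖1 - Complex.exp (Complex.I * w)‖ ≤ 2 * ‖1 - r * Complex.exp (Complex.I * w)‖ := by
  have h2 : ‖((1 - r : ℝ) : ℂ) * Complex.exp (Complex.I * w)‖ = 1 - r := by
    rw [norm_mul, norm_exp_I_mul, Complex.norm_real, Real.norm_of_nonneg (by linarith), mul_one]
  have h3 : 1 - r ≤ ‖1 - r * Complex.exp (Complex.I * w)‖ := by
    have := norm_sub_norm_le (1 : ℂ) (r * Complex.exp (Complex.I * w))
    rwa [norm_one, norm_mul, norm_exp_I_mul, Complex.norm_real, Real.norm_of_nonneg h0,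
      mul_one] at this
  have h4 : 1 - Complex.exp (Complex.I * w) = (1 - r * Complex.exp (Complex.I * w)) -
      ((1 - r : ℝ) : ℂ) * Complex.exp (Complex.I * w) := by push_cast; ring
  calc _ ≤ ‖1 - r * Complex.exp (Complex.I * w)‖ +
        ‖((1 - r : ℝ) : ℂ) * Complex.exp (Complex.I * w)‖ := by rw [h4]; exact norm_sub_le _ _
    _ ≤ _ := by rw [h2]; linarith

theorem norm_one_sub_exp_eq {w : ℝ} (hw : w ∈ Icc (-Real.pi) Real.pi) :
    ‖1 - Complex.exp (Complex.I * w)‖ = 2 * Real.sin (|w| / 2) := by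
  rw [norm_sub_rev, Complex.norm_exp_I_mul_ofReal_sub_one, norm_mul, Real.norm_eq_abs,
    Real.norm_eq_abs, abs_two]
  congr 1
  have h1 : 0 ≤ Real.sin (|w| / 2) := by
    have := abs_le.2 hw
    exact Real.sin_nonneg_of_nonneg_of_le_pi (by positivity) (by linarith [Real.pi_pos])
  rcases abs_cases w with ⟨h, _⟩ | ⟨h, _⟩
  · rw [h] at h1 ⊢; exact abs_of_nonneg h1
  · rw [h] at h1 ⊢
    rw [neg_div, Real.sin_neg] at h1 ⊢
    exact abs_of_nonpos (by linarith)

theorem norm_one_sub_exp_pos {w : ℝ} (hw : w ∈ Icc (-Real.pi) Real.pi) (h0 : w ≠ 0) :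
    0 < ‖1 - Complex.exp (Complex.I * w)‖ := by
  rw [norm_one_sub_exp_eq hw]
  have := abs_le.2 hw
  have h2 := abs_pos.2 h0
  have := Real.sin_pos_of_pos_of_lt_pi (x := |w| / 2) (by linarith) (by linarith [Real.pi_pos])
  linarith

/-- Circle integrability of `log |z - 1|` is available on `[0, 2π]`; periodicity moves it to `[-π,
π]`. -/
theorem intervalIntegrable_log_norm_one_sub_exp :
    IntervalIntegrable (fun w : ℝ => Real.log ‖1 - Complex.exp (Complex.I * w)‖) volume
      (-Real.pi) Real.pi := by
  have h := circleIntegrable_log_norm_sub_const (a := 1) (c := 0) 1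
  rw [CircleIntegrable] at h
  have h2 : (fun θ : ℝ => Real.log ‖circleMap 0 1 θ - 1‖) =
      fun w : ℝ => Real.log ‖1 - Complex.exp (Complex.I * w)‖ := by
    funext θ
    rw [norm_sub_rev, circleMap, zero_add, Complex.ofReal_one, one_mul, mul_comm]
  have h3 : IntervalIntegrable (fun w : ℝ => Real.log ‖1 - Complex.exp (Complex.I * w)‖) volume
      0 (2 * Real.pi) := by rw [← h2]; exact h
  refine Function.Periodic.intervalIntegrable₀ (T := 2 * Real.pi) ?_ (by positivity) h3 _ _
  intro w
  have : Complex.exp (Complex.I * ((w + 2 * Real.pi : ℝ) : ℂ)) = Complex.exp (Complex.I * w) := by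
    rw [← Complex.exp_periodic (Complex.I * w)]
    congr 1; push_cast; ring
  simp only [this]

/-- For `r < 1`, `log |1 - r e^{iw}| = -∑ r^k cos(kw) / k` converges uniformly, and orthogonality of
the cosines selects `k = n`. -/
theorem cosCoeff_log_norm_one_sub_mul_exp {r : ℝ} (h0 : 0 ≤ r) (h1 : r < 1) {n : ℕ} (hn : n ≠ 0) :
    cosCoeff (fun w => Real.log ‖1 - r * Complex.exp (Complex.I * w)‖) n = -(r ^ n / (2 * n)) := by
  have hlt : ∀ w : ℝ, ‖(r : ℂ) * Complex.exp (Complex.I * w)‖ < 1 := fun w => by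
    rw [norm_mul, norm_exp_I_mul, Complex.norm_real, Real.norm_of_nonneg h0, mul_one]; exact h1
  have hser : ∀ w : ℝ, HasSum (fun k : ℕ => r ^ k / k * Real.cos (k * w))
      (-Real.log ‖1 - r * Complex.exp (Complex.I * w)‖) := by
    intro w
    have h := Complex.hasSum_re (Complex.hasSum_taylorSeries_neg_log (hlt w))
    rw [Complex.neg_re, Complex.log_re] at h
    refine h.congr_fun fun k => ?_
    rw [mul_pow, ← Complex.exp_nat_mul, ← Complex.ofReal_pow, mul_div_right_comm,
      ← Complex.ofReal_natCast, ← Complex.ofReal_div, Complex.re_ofReal_mul]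
    congr 1
    rw [show ((k : ℝ) : ℂ) * (Complex.I * w) = ((k * w : ℝ) : ℂ) * Complex.I by push_cast; ring,
      Complex.exp_ofReal_mul_I_re]
  have key := intervalIntegral.hasSum_integral_of_dominated_convergence (μ := volume)
    (a := -Real.pi) (b := Real.pi)
    (F := fun (k : ℕ) (w : ℝ) => Real.cos (n * w) * (r ^ k / k * Real.cos (k * w)))
    (f := fun w : ℝ => Real.cos (n * w) * -Real.log ‖1 - r * Complex.exp (Complex.I * w)‖)
    (fun k _ => r ^ k) ?_ ?_ ?_ ?_ ?_
  · have h2 : ∀ k : ℕ, ∫ w in (-Real.pi)..Real.pi, Real.cos (n * w) * (r ^ k / k * Real.cos (k * w))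
        = if k = n then r ^ n / n * Real.pi else 0 := by
      intro k
      simp_rw [mul_left_comm (Real.cos _)]
      rw [intervalIntegral.integral_const_mul, integral_cos_mul_cos k hn]
      split_ifs with h
      · rw [h]
      · simp
    simp_rw [h2, mul_neg, intervalIntegral.integral_neg] at key
    have h3 := key.unique (hasSum_ite_eq n _)
    rw [cosCoeff]
    have hpi := Real.pi_pos
    have h4 : ∫ w in (-Real.pi)..Real.pi,
        Real.cos (n * w) * Real.log ‖1 - r * Complex.exp (Complex.I * w)‖ =
        -(r ^ n / n * Real.pi) := by linarith
    rw [h4]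
    field_simp
  · intro k
    exact Continuous.aestronglyMeasurable (by fun_prop)
  · intro k
    refine Eventually.of_forall fun w _ => ?_
    rw [norm_mul, norm_mul, Real.norm_eq_abs, Real.norm_eq_abs, Real.norm_eq_abs, abs_div,
      abs_of_nonneg (pow_nonneg h0 k), Nat.abs_cast]
    have h2 : r ^ k / (k : ℝ) ≤ r ^ k := by
      rcases Nat.eq_zero_or_pos k with rfl | hk
      · simp
      · exact div_le_self (pow_nonneg h0 k) (by exact_mod_cast hk)
    calc |Real.cos (n * w)| * (r ^ k / k * |Real.cos (k * w)|) ≤ 1 * (r ^ k * 1) := by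
          gcongr
          · exact Real.abs_cos_le_one _
          · exact Real.abs_cos_le_one _
      _ = r ^ k := by ring
  · exact Eventually.of_forall fun w _ => summable_geometric_of_lt_one h0 h1
  · exact intervalIntegrable_const
  · exact Eventually.of_forall fun w _ => (hser w).mul_left _

/-- The logarithmic singularity at `w = 0` rules out uniform convergence, so the value is the limit
`r → 1` from inside the disc, dominated by `log 2 + |log |1 - e^{iw}||`. -/
theorem cosCoeff_log_norm_one_sub_exp {n : ℕ} (hn : n ≠ 0) :
    cosCoeff (fun w => Real.log ‖1 - Complex.exp (Complex.I * w)‖) n = -(1 / (2 * n)) := by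
  have hlog2 : 0 ≤ Real.log 2 := Real.log_nonneg (by norm_num)
  have hmem : ∀ᶠ r : ℝ in 𝓝[<] 1, 0 ≤ r ∧ r < 1 := by
    filter_upwards [Ioo_mem_nhdsLT (zero_lt_one (α := ℝ))] with r hr using ⟨hr.1.le, hr.2⟩
  have hne0 : ∀ᵐ w : ℝ, w ≠ 0 := by simp [ae_iff]
  have key := intervalIntegral.tendsto_integral_filter_of_dominated_convergence (μ := volume)
    (a := -Real.pi) (b := Real.pi) (l := 𝓝[<] (1 : ℝ))
    (F := fun (r : ℝ) (w : ℝ) => Real.cos (n * w) *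
      Real.log ‖1 - r * Complex.exp (Complex.I * w)‖)
    (f := fun w : ℝ => Real.cos (n * w) * Real.log ‖1 - Complex.exp (Complex.I * w)‖)
    (fun w => Real.log 2 + |Real.log ‖1 - Complex.exp (Complex.I * w)‖|) ?_ ?_ ?_ ?_
  · have h1 : Tendsto (fun r : ℝ => -(r ^ n / (2 * n))) (𝓝[<] (1 : ℝ))
        (𝓝 (-(1 ^ n / (2 * n)))) := by
      refine Tendsto.mono_left ?_ nhdsWithin_le_nhds
      exact Continuous.tendsto (by fun_prop) _
    have h2 := key.const_mul (1 / (2 * Real.pi))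
    rw [one_pow] at h1
    refine tendsto_nhds_unique (h2.congr' ?_) h1
    filter_upwards [hmem] with r hr
    rw [← cosCoeff_log_norm_one_sub_mul_exp hr.1 hr.2 hn, cosCoeff]
  · refine Eventually.of_forall fun r => Measurable.aestronglyMeasurable ?_
    fun_prop
  · filter_upwards [hmem] with r hr
    filter_upwards [hne0] with w hw hwI
    rw [uIoc_of_le (by linarith [Real.pi_pos])] at hwI
    have hpos := norm_one_sub_exp_pos ⟨hwI.1.le, hwI.2⟩ hw
    have hle := norm_one_sub_exp_le hr.1 hr.2.le w
    have hpos' : 0 < ‖1 - r * Complex.exp (Complex.I * w)‖ := by linarith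
    rw [norm_mul, Real.norm_eq_abs, Real.norm_eq_abs]
    refine (mul_le_of_le_one_left (abs_nonneg _) (Real.abs_cos_le_one _)).trans ?_
    rw [abs_le]
    constructor
    · have := Real.log_le_log hpos hle
      rw [Real.log_mul two_ne_zero hpos'.ne'] at this
      linarith [neg_abs_le (Real.log ‖1 - Complex.exp (Complex.I * w)‖)]
    · have h2 : ‖1 - r * Complex.exp (Complex.I * w)‖ ≤ 2 := by
        refine (norm_sub_le _ _).trans ?_
        rw [norm_one, norm_mul, norm_exp_I_mul, Complex.norm_real, Real.norm_of_nonneg hr.1]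
        linarith [hr.2]
      have := Real.log_le_log hpos' h2
      linarith [abs_nonneg (Real.log ‖1 - Complex.exp (Complex.I * w)‖)]
  · exact intervalIntegrable_const.add intervalIntegrable_log_norm_one_sub_exp.abs
  · filter_upwards [hne0] with w hw hwI
    rw [uIoc_of_le (by linarith [Real.pi_pos])] at hwI
    have hpos := norm_one_sub_exp_pos ⟨hwI.1.le, hwI.2⟩ hw
    refine Tendsto.const_mul _ ?_
    have h1 : Tendsto (fun r : ℝ => ‖1 - r * Complex.exp (Complex.I * w)‖) (𝓝[<] 1)
        (𝓝 ‖1 - ((1 : ℝ) : ℂ) * Complex.exp (Complex.I * w)‖) := by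
      refine Tendsto.mono_left ?_ nhdsWithin_le_nhds
      exact Continuous.tendsto (by fun_prop) _
    rw [Complex.ofReal_one, one_mul] at h1
    exact h1.log hpos.ne'

/-- This is the vanishing circle average of `log |z - 1|`, shifted by periodicity to `[-π, π]`. -/
theorem integral_log_norm_one_sub_exp :
    ∫ w in (-Real.pi)..Real.pi, Real.log ‖1 - Complex.exp (Complex.I * w)‖ = 0 := by
  have h := circleAverage_log_norm_sub_const₁ (a := 1) (by simp)
  rw [Real.circleAverage, smul_eq_mul, mul_eq_zero] at h
  have h1 := h.resolve_left (by have := Real.pi_pos; positivity)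
  have h2 : ∀ w : ℝ, Real.log ‖circleMap 0 1 w - 1‖ =
      Real.log ‖1 - Complex.exp (Complex.I * w)‖ := by
    intro θ
    rw [norm_sub_rev, circleMap, zero_add, Complex.ofReal_one, one_mul, mul_comm]
  have hper : Function.Periodic (fun w : ℝ => Real.log ‖1 - Complex.exp (Complex.I * w)‖)
      (2 * Real.pi) := by
    intro w
    have : Complex.exp (Complex.I * ((w + 2 * Real.pi : ℝ) : ℂ)) =
        Complex.exp (Complex.I * w) := by
      rw [← Complex.exp_periodic (Complex.I * w)]
      congr 1; push_cast; ring
    simp only [this]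
  have h3 := hper.intervalIntegral_add_eq (-Real.pi) 0
  simp_rw [h2] at h1
  rw [zero_add, h1] at h3
  rw [← h3]
  congr 1; ring

/-! ### Fourier series of smooth periodic functions -/

/-- Two integrations by parts: the boundary terms vanish first because `sin (nπ) = 0`, then because
`deriv L` is periodic. -/
theorem cosCoeff_deriv_deriv {L : ℝ → ℝ} (hL : ContDiff ℝ 2 L)
    (hper : Function.Periodic L (2 * Real.pi)) {n : ℕ} (hn : n ≠ 0) :
    cosCoeff L n = -(1 / (n : ℝ) ^ 2) * cosCoeff (deriv (deriv L)) n := by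
  have hn' : (n : ℝ) ≠ 0 := by exact_mod_cast hn
  have hL1 : ContDiff ℝ 1 (deriv L) := by
    have : ContDiff ℝ (1 + 1) L := by convert! hL using 1
    exact (contDiff_succ_iff_deriv.1 this).2.2
  have hL2 : Continuous (deriv (deriv L)) := hL1.continuous_deriv le_rfl
  have hd : ∀ x, HasDerivAt L (deriv L x) x := fun x =>
    ((hL.differentiable (by norm_num)) x).hasDerivAt
  have hd1 : ∀ x, HasDerivAt (deriv L) (deriv (deriv L) x) x := fun x =>
    ((hL1.differentiable (by norm_num)) x).hasDerivAt
  have hperd : deriv L Real.pi = deriv L (-Real.pi) := by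
    have h : (fun x => L (x + 2 * Real.pi)) = L := funext hper
    have h2 := deriv_comp_add_const L (2 * Real.pi) (-Real.pi)
    rw [h] at h2
    rw [h2]; congr 1; ring
  have hS : ∀ x : ℝ, HasDerivAt (fun x : ℝ => Real.sin (n * x)) (n * Real.cos (n * x)) x := by
    intro x
    convert! (Real.hasDerivAt_sin (n * x)).comp x ((hasDerivAt_id x).const_mul (n : ℝ)) using 1
    ring
  have hC : ∀ x : ℝ, HasDerivAt (fun x : ℝ => Real.cos (n * x)) (-(n * Real.sin (n * x))) x := by
    intro x
    convert! (Real.hasDerivAt_cos (n * x)).comp x ((hasDerivAt_id x).const_mul (n : ℝ)) using 1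
    ring
  have h1 := intervalIntegral.integral_mul_deriv_eq_deriv_mul (a := -Real.pi) (b := Real.pi)
    (fun x _ => hd x) (fun x _ => hS x) (hL1.continuous.intervalIntegrable _ _)
    (Continuous.intervalIntegrable (by fun_prop) _ _)
  have h2 := intervalIntegral.integral_mul_deriv_eq_deriv_mul (a := -Real.pi) (b := Real.pi)
    (fun x _ => hd1 x) (fun x _ => hC x) (hL2.intervalIntegrable _ _)
    (Continuous.intervalIntegrable (by fun_prop) _ _)
  have e1 : ∫ x in (-Real.pi)..Real.pi, L x * (n * Real.cos (n * x)) =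
      n * ∫ x in (-Real.pi)..Real.pi, Real.cos (n * x) * L x := by
    rw [← intervalIntegral.integral_const_mul]
    exact intervalIntegral.integral_congr fun x _ => by ring
  have e2 : ∫ x in (-Real.pi)..Real.pi, deriv L x * -(n * Real.sin (n * x)) =
      -(n * ∫ x in (-Real.pi)..Real.pi, deriv L x * Real.sin (n * x)) := by
    rw [← intervalIntegral.integral_const_mul, ← intervalIntegral.integral_neg]
    exact intervalIntegral.integral_congr fun x _ => by ring
  have e3 : ∫ x in (-Real.pi)..Real.pi, deriv (deriv L) x * Real.cos (n * x) =
      ∫ x in (-Real.pi)..Real.pi, Real.cos (n * x) * deriv (deriv L) x :=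
    intervalIntegral.integral_congr fun x _ => by ring
  rw [e1] at h1
  rw [e2, e3] at h2
  simp only [mul_neg, Real.sin_neg, Real.cos_neg, Real.sin_nat_mul_pi, hperd, neg_zero, mul_zero,
    sub_self, zero_sub] at h1 h2
  rw [cosCoeff, cosCoeff]
  set A := ∫ x in (-Real.pi)..Real.pi, Real.cos (n * x) * L x
  set B := ∫ x in (-Real.pi)..Real.pi, deriv L x * Real.sin (n * x)
  set D := ∫ x in (-Real.pi)..Real.pi, Real.cos (n * x) * deriv (deriv L) x
  have h3 : (n : ℝ) ^ 2 * A = -D := by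
    rw [pow_two, mul_assoc, h1]; linarith
  have h4 : A = -(1 / (n : ℝ) ^ 2) * D := by
    field_simp; linarith
  rw [h4]; ring

theorem periodic_deriv {L : ℝ → ℝ} {T : ℝ} (h : Function.Periodic L T) :
    Function.Periodic (deriv L) T := by
  intro x
  have h2 := deriv_comp_add_const L T x
  rw [funext h] at h2
  exact h2.symm

/-- Four derivatives give decay `n^{-4}`, which leaves a summable `n^{-2}` after the weight `n (n +
1)`. -/
theorem summable_mul_cosCoeff {L : ℝ → ℝ} (hL : ContDiff ℝ 4 L)
    (hper : Function.Periodic L (2 * Real.pi)) :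
    Summable fun n : ℕ => (n : ℝ) * (n + 1) * |cosCoeff L n| := by
  have hL1 : ContDiff ℝ 3 (deriv L) := by
    have : ContDiff ℝ (3 + 1) L := by convert! hL using 1
    exact (contDiff_succ_iff_deriv.1 this).2.2
  have hL2 : ContDiff ℝ 2 (deriv (deriv L)) := by
    have : ContDiff ℝ (2 + 1) (deriv L) := by convert! hL1 using 1
    exact (contDiff_succ_iff_deriv.1 this).2.2
  have hL3 : ContDiff ℝ 1 (deriv (deriv (deriv L))) := by
    have : ContDiff ℝ (1 + 1) (deriv (deriv L)) := by convert! hL2 using 1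
    exact (contDiff_succ_iff_deriv.1 this).2.2
  have hL4 : Continuous (deriv (deriv (deriv (deriv L)))) := hL3.continuous_deriv le_rfl
  set K := 1 / (2 * Real.pi) *
    ∫ w in (-Real.pi)..Real.pi, |deriv (deriv (deriv (deriv L))) w| with hK
  have hb : ∀ n : ℕ, |cosCoeff L (n + 1)| ≤ K / ((n + 1 : ℕ) : ℝ) ^ 4 := by
    intro n
    rw [cosCoeff_deriv_deriv (hL.of_le (by norm_num)) hper n.succ_ne_zero,
      cosCoeff_deriv_deriv hL2 (periodic_deriv (periodic_deriv hper)) n.succ_ne_zero]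
    have := abs_cosCoeff_le (hL4.intervalIntegrable (-Real.pi) Real.pi) (n + 1)
    rw [← hK] at this
    rw [abs_mul, abs_mul, abs_neg, abs_of_nonneg (by positivity : (0 : ℝ) ≤ 1 / ((n + 1 : ℕ) : ℝ) ^ 2)]
    calc _ ≤ 1 / ((n + 1 : ℕ) : ℝ) ^ 2 * (1 / ((n + 1 : ℕ) : ℝ) ^ 2 * K) := by gcongr
      _ = _ := by field_simp
  refine (summable_nat_add_iff 1).1 ?_
  have hs : Summable fun n : ℕ => 2 * K * (1 / ((n + 1 : ℕ) : ℝ) ^ 2) :=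
    ((summable_nat_add_iff 1).2 (Real.summable_one_div_nat_pow.2 one_lt_two)).mul_left _
  refine Summable.of_nonneg_of_le (fun n => by positivity) (fun n => ?_) hs
  have hK0 : 0 ≤ K := by
    have := (abs_nonneg _).trans (hb 0)
    simpa using this
  calc ((n + 1 : ℕ) : ℝ) * ((n + 1 : ℕ) + 1) * |cosCoeff L (n + 1)|
      ≤ ((n + 1 : ℕ) : ℝ) * (2 * (n + 1 : ℕ)) * (K / ((n + 1 : ℕ) : ℝ) ^ 4) := by
        gcongr
        · push_cast; linarith [(Nat.cast_nonneg n : (0 : ℝ) ≤ n)]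
        · exact hb n
    _ = _ := by field_simp

/-- The terms `n` and `-n` of the Fourier series are paired over all natural `n`, so `n = 0` is
counted twice; this is the extra `cosCoeff L 0` on the right. -/
theorem hasSum_cosCoeff_mul_cos {L : ℝ → ℝ} (hL : Continuous L)
    (hper : Function.Periodic L (2 * Real.pi)) (heven : ∀ w, L (-w) = L w)
    (hs : Summable fun n => |cosCoeff L n|) (w : ℝ) :
    HasSum (fun n : ℕ => 2 * (cosCoeff L n * Real.cos (n * w))) (L w + cosCoeff L 0) := by
  have : Fact (0 < 2 * Real.pi) := ⟨by positivity⟩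
  have hper' : Function.Periodic (fun w => (L w : ℂ)) (2 * Real.pi) := fun w => by
    simp only [hper w]
  let F : C(AddCircle (2 * Real.pi), ℂ) :=
    ⟨hper'.lift, continuous_coinduced_dom.mpr (Complex.continuous_ofReal.comp hL)⟩
  have hFapp : ∀ x : ℝ, F (x : AddCircle (2 * Real.pi)) = (L x : ℂ) := fun x =>
    hper'.lift_coe x
  have hi : IntervalIntegrable L volume (-Real.pi) Real.pi := hL.intervalIntegrable _ _
  have hev : ∀ᵐ w, w ∈ uIoc (-Real.pi) Real.pi → L (-w) = L w :=
    Eventually.of_forall fun w _ => heven w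
  have hpi : (Real.pi : ℂ) ≠ 0 := by exact_mod_cast Real.pi_ne_zero
  have hco : ∀ k : ℤ, fourierCoeff F k = (1 / (2 * Real.pi) : ℂ) *
      ∫ x in (-Real.pi)..Real.pi, Complex.exp (-(Complex.I * (k * x))) * (L x : ℂ) := by
    intro k
    rw [fourierCoeff_eq_intervalIntegral F k (-Real.pi),
      show -Real.pi + 2 * Real.pi = Real.pi by ring, Complex.real_smul]
    congr 1
    · push_cast; ring
    · refine intervalIntegral.integral_congr fun x _ => ?_
      simp only [hFapp, fourier_coe_apply, smul_eq_mul]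
      congr 2
      push_cast
      field_simp
  have hcn : ∀ n : ℕ, fourierCoeff F (n : ℤ) = cosCoeff L n := by
    intro n
    have := integral_exp_neg_mul_eq_cosCoeff hi hev n
    rw [hco, Int.cast_natCast, this]
    field_simp
  have hcneg : ∀ n : ℕ, fourierCoeff F (-(n : ℤ)) = cosCoeff L n := by
    intro n
    rw [← hcn, hco, hco]
    congr 1
    have h1 := intervalIntegral.integral_comp_neg (a := -Real.pi) (b := Real.pi)
      (fun x : ℝ => Complex.exp (-(Complex.I * (((n : ℤ) : ℂ) * x))) * (L x : ℂ))
    rw [neg_neg] at h1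
    rw [← h1]
    refine intervalIntegral.integral_congr fun x _ => ?_
    simp only [heven]
    congr 2
    push_cast
    ring
  have hsum : Summable (fourierCoeff F) := by
    refine Summable.of_nat_of_neg ?_ ?_
    · simp_rw [hcn]; exact Complex.summable_ofReal.2 hs.of_abs
    · simp_rw [hcneg]; exact Complex.summable_ofReal.2 hs.of_abs
  have h1 := (has_pointwise_sum_fourier_series_of_summable hsum (w : AddCircle (2 * Real.pi))).nat_add_neg
  have h2 : (fun n : ℕ => fourierCoeff F n • fourier (n : ℤ) (w : AddCircle (2 * Real.pi)) +
      fourierCoeff F (-n) • fourier (-(n : ℤ)) (w : AddCircle (2 * Real.pi))) =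
      fun n : ℕ => ((2 * (cosCoeff L n * Real.cos (n * w)) : ℝ) : ℂ) := by
    funext n
    rw [hcn, hcneg, fourier_coe_apply, fourier_coe_apply]
    have e1 : 2 * (Real.pi : ℂ) * Complex.I * ((n : ℤ) : ℂ) * w / ((2 * Real.pi : ℝ) : ℂ) =
        ((n * w : ℝ) : ℂ) * Complex.I := by push_cast; field_simp
    have e2 : 2 * (Real.pi : ℂ) * Complex.I * ((-(n : ℤ) : ℤ) : ℂ) * w / ((2 * Real.pi : ℝ) : ℂ) =
        -((n * w : ℝ) : ℂ) * Complex.I := by push_cast; field_simp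
    rw [e1, e2, smul_eq_mul, smul_eq_mul, ← mul_add, ← Complex.two_cos]
    push_cast; ring
  rw [h2, hFapp] at h1
  have h3 : (L w : ℂ) + (cosCoeff L 0 : ℂ) • fourier 0 (w : AddCircle (2 * Real.pi)) =
      ((L w + cosCoeff L 0 : ℝ) : ℂ) := by
    rw [fourier_zero]; push_cast; simp
  have h4 : fourierCoeff F 0 = (cosCoeff L 0 : ℂ) := by simpa using hcn 0
  simp only [h4, h3] at h1
  exact_mod_cast h1

/-! ### Autocovariances of one-sided moving averages -/

/-- The extension by zero of a one-sided sequence to the integers. -/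
def intExtend (ψ : ℕ → ℝ) (n : ℤ) : ℝ := if 0 ≤ n then ψ n.toNat else 0

theorem intExtend_natCast (ψ : ℕ → ℝ) (n : ℕ) : intExtend ψ n = ψ n := by
  simp [intExtend]

theorem intExtend_of_neg (ψ : ℕ → ℝ) {n : ℤ} (h : n < 0) : intExtend ψ n = 0 := by
  simp [intExtend, not_le.2 h]

theorem integral_exp_int_mul (m : ℤ) :
    ∫ w in (-Real.pi)..Real.pi, Complex.exp (Complex.I * m * w) =
      if m = 0 then 2 * (Real.pi : ℂ) else 0 := by
  split_ifs with h
  · subst h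
    simp only [Int.cast_zero, mul_zero, zero_mul, Complex.exp_zero,
      intervalIntegral.integral_const, Complex.real_smul]
    push_cast; ring
  · have hm : Complex.I * (m : ℂ) ≠ 0 := mul_ne_zero Complex.I_ne_zero (by exact_mod_cast h)
    rw [integral_exp_mul_complex hm, div_eq_zero_iff]
    left
    rw [sub_eq_zero, Complex.exp_eq_exp_iff_exists_int]
    exact ⟨m, by push_cast; ring⟩

section FourierSeries

variable {a : ℕ → ℝ} {F : ℝ → ℂ}

theorem norm_mul_exp (x : ℝ) (n : ℕ) (w : ℝ) :
    ‖(x : ℂ) * Complex.exp (Complex.I * n * w)‖ = |x| := by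
  have := norm_exp_I_mul (n * w)
  rw [norm_mul, Complex.norm_real, Real.norm_eq_abs, mul_assoc]
  push_cast at this
  rw [this, mul_one]

theorem continuous_of_hasSum_exp (ha : Summable fun n => |a n|)
    (hF : ∀ w : ℝ, HasSum (fun n : ℕ => (a n : ℂ) * Complex.exp (Complex.I * n * w)) (F w)) :
    Continuous F := by
  have : F = fun w : ℝ => ∑' n : ℕ, (a n : ℂ) * Complex.exp (Complex.I * n * w) :=
    funext fun w => (hF w).tsum_eq.symm
  rw [this]
  exact continuous_tsum (fun n => by fun_prop) ha fun n w => (norm_mul_exp _ _ _).le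

theorem integral_exp_mul_of_hasSum (ha : Summable fun n => |a n|)
    (hF : ∀ w : ℝ, HasSum (fun n : ℕ => (a n : ℂ) * Complex.exp (Complex.I * n * w)) (F w)) (m : ℤ) :
    ∫ w in (-Real.pi)..Real.pi, Complex.exp (-(Complex.I * m * w)) * F w =
      2 * Real.pi * (intExtend a m : ℂ) := by
  have key := intervalIntegral.hasSum_integral_of_dominated_convergence (μ := volume)
    (a := -Real.pi) (b := Real.pi)
    (F := fun (n : ℕ) (w : ℝ) => Complex.exp (-(Complex.I * m * w)) *
      ((a n : ℂ) * Complex.exp (Complex.I * n * w)))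
    (f := fun w : ℝ => Complex.exp (-(Complex.I * m * w)) * F w)
    (fun n _ => |a n|) (fun n => Continuous.aestronglyMeasurable (by fun_prop)) ?_
    (Eventually.of_forall fun w _ => ha) intervalIntegrable_const
    (Eventually.of_forall fun w _ => (hF w).mul_left _)
  · have h1 : ∀ n : ℕ, ∫ w in (-Real.pi)..Real.pi, Complex.exp (-(Complex.I * m * w)) *
        ((a n : ℂ) * Complex.exp (Complex.I * n * w)) =
        if (n : ℤ) = m then 2 * Real.pi * (a n : ℂ) else 0 := by
      intro n
      have h2 : ∀ w : ℝ, Complex.exp (-(Complex.I * m * w)) *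
          ((a n : ℂ) * Complex.exp (Complex.I * n * w)) =
          (a n : ℂ) * Complex.exp (Complex.I * ((n - m : ℤ) : ℂ) * w) := by
        intro w
        rw [mul_left_comm, ← Complex.exp_add]
        congr 2
        push_cast; ring
      simp_rw [h2]
      rw [intervalIntegral.integral_const_mul, integral_exp_int_mul]
      by_cases h : (n : ℤ) = m
      · simp [h]; ring
      · rw [if_neg h, if_neg (sub_ne_zero.2 h), mul_zero]
    simp_rw [h1] at key
    refine key.unique ?_
    rcases le_or_gt 0 m with hm | hm
    · lift m to ℕ using hm
      simp only [Int.natCast_inj, intExtend_natCast]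
      have := hasSum_ite_eq m (2 * Real.pi * (a m : ℂ))
      refine this.congr_fun fun n => ?_
      split_ifs with h
      · rw [h]
      · rfl
    · rw [intExtend_of_neg _ hm]
      have : ∀ n : ℕ, (n : ℤ) ≠ m := fun n => by omega
      simp [this, hasSum_zero]
  · intro n
    refine Eventually.of_forall fun w _ => ?_
    have := norm_exp_I_mul (-(m * w))
    push_cast at this
    rw [norm_mul, norm_mul_exp, show -(Complex.I * m * w) = Complex.I * -(m * w) by ring, this,
      one_mul]

/-- Parseval: write `|F|² = F · conj F`, expand only the conjugate factor, and recognise each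
integral as a Fourier coefficient of `F`. -/
theorem hasSum_integral_exp_mul_normSq (ha : Summable fun n => |a n|)
    (hF : ∀ w : ℝ, HasSum (fun n : ℕ => (a n : ℂ) * Complex.exp (Complex.I * n * w)) (F w)) (h : ℤ) :
    HasSum (fun k : ℕ => 2 * Real.pi * ((a k * intExtend a (h + k) : ℝ) : ℂ))
      (∫ w in (-Real.pi)..Real.pi, Complex.exp (-(Complex.I * h * w)) * ((‖F w‖ ^ 2 : ℝ) : ℂ)) := by
  have hFc := continuous_of_hasSum_exp ha hF
  have hFb : ∀ w, ‖F w‖ ≤ ∑' n, |a n| := fun w => by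
    rw [← (hF w).tsum_eq]
    have := norm_tsum_le_tsum_norm (f := fun n : ℕ => (a n : ℂ) * Complex.exp (Complex.I * n * w))
      (by simpa only [norm_mul_exp] using ha)
    simpa only [norm_mul_exp] using this
  have key := intervalIntegral.hasSum_integral_of_dominated_convergence (μ := volume)
    (a := -Real.pi) (b := Real.pi)
    (F := fun (k : ℕ) (w : ℝ) => (a k : ℂ) * (Complex.exp (-(Complex.I * ((h + k : ℤ) : ℂ) * w)) * F w))
    (f := fun w : ℝ => Complex.exp (-(Complex.I * h * w)) * ((‖F w‖ ^ 2 : ℝ) : ℂ))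
    (fun n _ => |a n| * ∑' n, |a n|) (fun n => Continuous.aestronglyMeasurable (by fun_prop)) ?_
    (Eventually.of_forall fun w _ => ha.mul_right _) intervalIntegrable_const ?_
  · refine key.congr_fun fun k => ?_
    rw [intervalIntegral.integral_const_mul, integral_exp_mul_of_hasSum ha hF]
    push_cast; ring
  · intro k
    refine Eventually.of_forall fun w _ => ?_
    have := norm_exp_I_mul (-((h + k : ℤ) * w))
    push_cast at this
    rw [norm_mul, norm_mul, Complex.norm_real, Real.norm_eq_abs]
    push_cast
    rw [show -(Complex.I * (h + k) * w) = Complex.I * -((h + k) * w) by ring, this, one_mul]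
    gcongr
    exact hFb w
  · refine Eventually.of_forall fun w _ => ?_
    have h1 := ((Complex.hasSum_conj'.2 (hF w)).mul_left (Complex.exp (-(Complex.I * h * w)) * F w))
    have h2 : Complex.exp (-(Complex.I * h * w)) * F w * (starRingEnd ℂ) (F w) =
        Complex.exp (-(Complex.I * h * w)) * ((‖F w‖ ^ 2 : ℝ) : ℂ) := by
      rw [mul_assoc, Complex.mul_conj, Complex.normSq_eq_norm_sq]
    rw [h2] at h1
    refine h1.congr_fun fun k => ?_
    rw [map_mul, Complex.conj_ofReal, ← Complex.exp_conj, map_mul, map_mul, Complex.conj_I,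
      Complex.conj_ofReal, Complex.conj_natCast]
    push_cast
    rw [show -(Complex.I * (h + k) * w) = -(Complex.I * h * w) + -Complex.I * k * w by ring,
      Complex.exp_add]
    ring

end FourierSeries

theorem summable_mul_intExtend {ψ : ℕ → ℝ} (hψ : Summable fun j => ψ j ^ 2) (h : ℤ) :
    Summable fun k : ℕ => |ψ k * intExtend ψ (h + k)| := by
  have h1 : Summable fun k : ℕ => intExtend ψ (h + k) ^ 2 := by
    -- After dropping the first `|h|` terms every index `h + k` is nonnegative and the sequence is a
    -- shift of `ψ ^ 2`.
    refine (summable_nat_add_iff h.natAbs).1 ?_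
    have : (fun n : ℕ => intExtend ψ (h + ((n + h.natAbs : ℕ) : ℤ)) ^ 2) =
        fun n : ℕ => ψ (n + (h + h.natAbs).toNat) ^ 2 := by
      funext n
      rw [show h + ((n + h.natAbs : ℕ) : ℤ) = ((n + (h + h.natAbs).toNat : ℕ) : ℤ) by omega,
        intExtend_natCast]
    rw [this]
    exact (summable_nat_add_iff (f := fun j => ψ j ^ 2) _).2 hψ
  refine Summable.of_nonneg_of_le (fun _ => abs_nonneg _) (fun k => ?_) (hψ.add h1)
  rw [abs_mul]
  nlinarith [sq_nonneg (|ψ k| - |intExtend ψ (h + k)|), sq_abs (ψ k), sq_abs (intExtend ψ (h + k)),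
    sq_nonneg (ψ k), sq_nonneg (intExtend ψ (h + k))]

theorem intExtend_mul_pow (ψ : ℕ → ℝ) (r : ℝ) (h : ℤ) :
    intExtend (fun n => ψ n * r ^ n) h = intExtend ψ h * r ^ h.toNat := by
  rw [intExtend, intExtend]
  split_ifs <;> simp

/-- This is Abel's limit for the autocovariances; the terms at `r < 1` are dominated by those at `r
= 1`. -/
theorem tendsto_tsum_mul_intExtend {ψ : ℕ → ℝ} (hψ : Summable fun j => ψ j ^ 2) (h : ℤ) :
    Tendsto (fun r : ℝ => ∑' k : ℕ, (ψ k * r ^ k) * intExtend (fun n => ψ n * r ^ n) (h + k))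
      (𝓝[<] 1) (𝓝 (∑' k : ℕ, ψ k * intExtend ψ (h + k))) := by
  refine tendsto_tsum_of_dominated_convergence (summable_mul_intExtend hψ h) (fun k => ?_) ?_
  · simp_rw [intExtend_mul_pow]
    refine Tendsto.mono_left ?_ nhdsWithin_le_nhds
    have : Continuous fun r : ℝ => ψ k * r ^ k * (intExtend ψ (h + k) * r ^ (h + k).toNat) := by
      fun_prop
    simpa using this.tendsto 1
  · filter_upwards [Ioo_mem_nhdsLT (zero_lt_one (α := ℝ))] with r hr k
    rw [intExtend_mul_pow, norm_mul, norm_mul, norm_mul, Real.norm_eq_abs, Real.norm_eq_abs,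
      Real.norm_eq_abs, Real.norm_eq_abs, abs_mul, abs_of_nonneg (pow_nonneg hr.1.le _),
      abs_of_nonneg (pow_nonneg hr.1.le _)]
    have h1 := pow_le_one₀ hr.1.le hr.2.le (n := k)
    have h2 := pow_le_one₀ hr.1.le hr.2.le (n := (h + k).toNat)
    calc |ψ k| * r ^ k * (|intExtend ψ (h + k)| * r ^ (h + k).toNat)
        ≤ |ψ k| * 1 * (|intExtend ψ (h + k)| * 1) := by
          have := hr.1.le
          gcongr
      _ = _ := by ring

section Covariance

variable {d : ℝ} {l : ℕ → ℝ} {L f : ℝ → ℝ}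

/-- The autocovariances of a spectral density whose logarithm has cosine coefficients
`d / n + l n` are those of the moving average with coefficients `expCoeff (d / n + l n)`. -/
theorem integral_exp_mul_eq_tsum (hd : 0 < d) (hl : Summable fun n => |l n|)
    (hLs : ∀ w : ℝ, HasSum (fun n : ℕ => 2 * (l n * Real.cos (n * w))) (L w + l 0))
    (hLc : Continuous L)
    (hf : IntegrableOn f (Icc (-Real.pi) Real.pi))
    (hfL : f =ᵐ[volume.restrict (Icc (-Real.pi) Real.pi)] fun w =>
      1 / (2 * Real.pi) * ‖1 - Complex.exp (Complex.I * w)‖ ^ (-2 * d) * Real.exp (L w))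
    (hψ : Summable fun j => expCoeff (fun n => d / n + l n) j ^ 2) (h : ℤ) :
    ∫ w in (-Real.pi)..Real.pi, Complex.exp (-(Complex.I * h * w)) * (f w : ℂ) =
      ((Real.exp (l 0) * ∑' k : ℕ, expCoeff (fun n => d / n + l n) k *
        intExtend (expCoeff fun n => d / n + l n) (h + k) : ℝ) : ℂ) := by
  have hpi := Real.pi_pos
  set c : ℕ → ℝ := fun n => d / n + l n with hc
  set ψ := expCoeff c with hψdef
  set l' : ℕ → ℂ := fun n => if n = 0 then 0 else (l n : ℂ) with hl'
  have hl'n : ∀ n, ‖l' n‖ ≤ |l n| := fun n => by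
    simp only [hl']; split_ifs <;> simp
  set H : ℂ → ℂ := fun z => ∑' n, l' n * z ^ n with hH
  have hterm : ∀ z : ℂ, ‖z‖ ≤ 1 → ∀ n, ‖l' n * z ^ n‖ ≤ |l n| := fun z hz n => by
    rw [norm_mul, norm_pow]
    calc ‖l' n‖ * ‖z‖ ^ n ≤ |l n| * 1 := by
          gcongr
          · exact hl'n n
          · exact pow_le_one₀ (norm_nonneg _) hz
      _ = _ := mul_one _
  have hHs : ∀ z : ℂ, ‖z‖ ≤ 1 → HasSum (fun n => l' n * z ^ n) (H z) := fun z hz =>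
    (Summable.of_norm_bounded hl (hterm z hz)).hasSum
  have hHb : ∀ z : ℂ, ‖z‖ ≤ 1 → ‖H z‖ ≤ ∑' n, |l n| := fun z hz =>
    tsum_of_norm_bounded hl.hasSum (hterm z hz)
  have hnr : ∀ {r : ℝ}, 0 ≤ r → ∀ w : ℝ, ‖(r : ℂ) * Complex.exp (Complex.I * w)‖ = r :=
    fun h0 w => by
      rw [norm_mul, norm_exp_I_mul, Complex.norm_real, Real.norm_of_nonneg h0, mul_one]
  -- Square summability of `ψ` does not give absolute convergence on the unit circle, so Parseval is
  -- applied to `exp (S (r e^{iw}))` with `r < 1` and then `r → 1`. Only the smooth part `H` extends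
  -- continuously to the circle.
  set S : ℂ → ℂ := fun z => d * -Complex.log (1 - z) + H z with hS
  have hSs : ∀ z : ℂ, ‖z‖ < 1 →
      HasSum (fun n => (if n = 0 then 0 else (c n : ℂ)) * z ^ n) (S z) := by
    intro z hz
    refine (((Complex.hasSum_taylorSeries_neg_log hz).mul_left (d : ℂ)).add (hHs z hz.le)).congr_fun
      fun n => ?_
    simp only [hl', hc]
    split_ifs with h0
    · simp [h0]
    · push_cast; ring
  have hcb : ∀ n, |c n| ≤ d + ∑' n, |l n| := fun n => by
    refine (abs_add_le _ _).trans (add_le_add ?_ (hl.le_tsum n fun _ _ => abs_nonneg _))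
    rw [abs_of_nonneg (by positivity)]
    rcases Nat.eq_zero_or_pos n with rfl | hn
    · simpa using hd.le
    · exact div_le_self hd.le (by exact_mod_cast hn)
  have hFs : ∀ {r : ℝ}, 0 ≤ r → r < 1 → ∀ w : ℝ, HasSum (fun n : ℕ => ((ψ n * r ^ n : ℝ) : ℂ) *
      Complex.exp (Complex.I * n * w)) (Complex.exp (S (r * Complex.exp (Complex.I * w)))) := by
    intro r h0 h1 w
    refine (hasSum_expCoeff hcb hSs (by rw [hnr h0]; exact h1)).congr_fun fun n => ?_
    rw [mul_pow, ← Complex.exp_nat_mul]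
    push_cast
    rw [show (n : ℂ) * (Complex.I * w) = Complex.I * n * w by ring]
    ring
  have hFsum : ∀ {r : ℝ}, 0 ≤ r → r < 1 → Summable fun n => |ψ n * r ^ n| := by
    intro r h0 h1
    have := (hFs h0 h1 0).summable.norm
    simpa using this
  have hnorm : ∀ z : ℂ, 1 - z ≠ 0 → ‖Complex.exp (S z)‖ ^ 2 =
      ‖1 - z‖ ^ (-2 * d) * Real.exp (2 * (H z).re) := by
    intro z hz
    rw [Complex.norm_exp, ← Real.exp_nat_mul, Real.rpow_def_of_pos (norm_pos_iff.2 hz),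
      ← Real.exp_add]
    congr 1
    simp only [hS, Complex.add_re, Complex.re_ofReal_mul, Complex.neg_re, Complex.log_re]
    push_cast; ring
  -- On the circle `2 Re H` is the cosine series of `L` without its constant term; this is where the
  -- factor `exp (l 0)` of the conclusion comes from.
  have hHe : ∀ w : ℝ, 2 * (H (Complex.exp (Complex.I * w))).re = L w - l 0 := by
    intro w
    have h1 := (Complex.hasSum_re (hHs _ (norm_exp_I_mul w).le)).mul_left 2
    have h2 := (hasSum_nat_add_iff' 1).2 h1
    have h3 := (hasSum_nat_add_iff' 1).2 (hLs w)
    simp only [Finset.range_one, Finset.sum_singleton, hl', if_true, zero_mul, Complex.zero_re,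
      mul_zero, sub_zero, CharP.cast_eq_zero, Real.cos_zero, mul_one, Nat.succ_ne_zero, if_false] at h2 h3
    have h4 := h2.unique (h3.congr_fun fun n => ?_)
    · rw [h4]; ring
    · rw [← Complex.exp_nat_mul, Complex.re_ofReal_mul]
      congr 2
      rw [show ((n + 1 : ℕ) : ℂ) * (Complex.I * w) = (((n + 1 : ℕ) * w : ℝ) : ℂ) * Complex.I by
        push_cast; ring, Complex.exp_ofReal_mul_I_re]
  have hHc : ∀ w : ℝ, Tendsto (fun r : ℝ => H (r * Complex.exp (Complex.I * w))) (𝓝[<] 1)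
      (𝓝 (H (Complex.exp (Complex.I * w)))) := by
    intro w
    refine tendsto_tsum_of_dominated_convergence hl (fun n => ?_) ?_
    · have : Continuous fun r : ℝ => l' n * (r * Complex.exp (Complex.I * w)) ^ n := by fun_prop
      have h1 := this.tendsto 1
      simp only [Complex.ofReal_one, one_mul] at h1
      exact h1.mono_left nhdsWithin_le_nhds
    · filter_upwards [Ioo_mem_nhdsLT (zero_lt_one (α := ℝ))] with r hr n
      exact hterm _ (by rw [hnr hr.1.le]; exact hr.2.le) n
  have hne0 : ∀ᵐ w : ℝ, w ≠ 0 := by simp [ae_iff]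
  have hfL' : ∀ᵐ w : ℝ, w ∈ uIoc (-Real.pi) Real.pi → f w =
      1 / (2 * Real.pi) * ‖1 - Complex.exp (Complex.I * w)‖ ^ (-2 * d) * Real.exp (L w) := by
    have := (ae_restrict_iff' measurableSet_Icc).1 hfL
    filter_upwards [this] with w hw hwI
    rw [uIoc_of_le (by linarith)] at hwI
    exact hw (Ioc_subset_Icc_self hwI)
  have hfi : IntervalIntegrable f volume (-Real.pi) Real.pi :=
    (intervalIntegrable_iff_integrableOn_Icc_of_le (by linarith)).2 hf
  set A := ∑' n, |l n| with hA
  -- The dominating function is a continuous multiple of `f`, so its integrability comes from that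
  -- of `f`. The factor `2 ^ (2 * d)` is the cost of replacing `|1 - r e^{iw}|` by `|1 - e^{iw}|`,
  -- and `exp (2 * A)` bounds the smooth part.
  set C := (2 : ℝ) ^ (2 * d) * Real.exp (2 * A) * (2 * Real.pi) with hC
  have hgl : IntervalIntegrable (fun w => C * (Real.exp (-L w) * f w)) volume
      (-Real.pi) Real.pi :=
    (hfi.continuousOn_mul (Continuous.continuousOn (by fun_prop))).const_mul C
  have key := intervalIntegral.tendsto_integral_filter_of_dominated_convergence (μ := volume)
    (a := -Real.pi) (b := Real.pi) (l := 𝓝[<] (1 : ℝ))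
    (F := fun (r : ℝ) (w : ℝ) => Complex.exp (-(Complex.I * h * w)) *
      ((‖Complex.exp (S (r * Complex.exp (Complex.I * w)))‖ ^ 2 : ℝ) : ℂ))
    (f := fun w : ℝ => (2 * Real.pi * Real.exp (-l 0) : ℂ) *
      (Complex.exp (-(Complex.I * h * w)) * (f w : ℂ)))
    (fun w => C * (Real.exp (-L w) * f w)) ?_ ?_ hgl ?_
  · have h1 : (fun r : ℝ => ∫ w in (-Real.pi)..Real.pi, Complex.exp (-(Complex.I * h * w)) *
        ((‖Complex.exp (S (r * Complex.exp (Complex.I * w)))‖ ^ 2 : ℝ) : ℂ)) =ᶠ[𝓝[<] 1]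
        fun r : ℝ => 2 * Real.pi * ((∑' k : ℕ, (ψ k * r ^ k) *
          intExtend (fun n => ψ n * r ^ n) (h + k) : ℝ) : ℂ) := by
      filter_upwards [Ioo_mem_nhdsLT (zero_lt_one (α := ℝ))] with r hr
      rw [← (hasSum_integral_exp_mul_normSq (hFsum hr.1.le hr.2) (hFs hr.1.le hr.2) h).tsum_eq,
        tsum_mul_left, Complex.ofReal_tsum]
    have h2 := tendsto_nhds_unique (key.congr' h1)
      (((Complex.continuous_ofReal.tendsto _).comp (tendsto_tsum_mul_intExtend hψ h)).const_mul
        (2 * Real.pi : ℂ))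
    rw [intervalIntegral.integral_const_mul] at h2
    have hpi' : (Real.pi : ℂ) ≠ 0 := by exact_mod_cast hpi.ne'
    have h3 : (Real.exp (-l 0) : ℂ) * ∫ w in (-Real.pi)..Real.pi,
        Complex.exp (-(Complex.I * h * w)) * (f w : ℂ) =
        ((∑' k : ℕ, ψ k * intExtend ψ (h + k) : ℝ) : ℂ) := by
      refine mul_left_cancel₀ (mul_ne_zero two_ne_zero hpi') ?_
      rw [← h2]; ring
    rw [Complex.ofReal_mul, ← h3, ← mul_assoc, ← Complex.ofReal_mul, ← Real.exp_add]
    simp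
  · filter_upwards [Ioo_mem_nhdsLT (zero_lt_one (α := ℝ))] with r hr
    have := continuous_of_hasSum_exp (hFsum hr.1.le hr.2) (hFs hr.1.le hr.2)
    exact Continuous.aestronglyMeasurable (by fun_prop)
  · filter_upwards [Ioo_mem_nhdsLT (zero_lt_one (α := ℝ))] with r hr
    filter_upwards [hne0, hfL'] with w hw hfw hwI
    rw [hfw hwI]
    rw [uIoc_of_le (by linarith)] at hwI
    have hpos := norm_one_sub_exp_pos ⟨hwI.1.le, hwI.2⟩ hw
    have hle := norm_one_sub_exp_le hr.1.le hr.2.le w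
    have hpos' : 0 < ‖1 - r * Complex.exp (Complex.I * w)‖ := by linarith
    have hnm := norm_exp_I_mul (-(h * w))
    push_cast at hnm
    rw [norm_mul, show -(Complex.I * h * w) = Complex.I * -(h * w) by ring, hnm, one_mul,
      Complex.norm_real, Real.norm_of_nonneg (by positivity), hnorm _ (norm_pos_iff.1 hpos')]
    have e1 : ‖1 - r * Complex.exp (Complex.I * w)‖ ^ (-2 * d) ≤
        (2 : ℝ) ^ (2 * d) * ‖1 - Complex.exp (Complex.I * w)‖ ^ (-2 * d) := by
      calc _ ≤ (‖1 - Complex.exp (Complex.I * w)‖ / 2) ^ (-2 * d) :=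
            Real.rpow_le_rpow_of_nonpos (by positivity) (by linarith) (by linarith)
        _ = _ := by
            rw [Real.div_rpow hpos.le two_pos.le, show -2 * d = -(2 * d) by ring,
              Real.rpow_neg two_pos.le (2 * d)]
            field_simp
    have e2 : Real.exp (2 * (H (r * Complex.exp (Complex.I * w))).re) ≤ Real.exp (2 * A) := by
      gcongr
      exact (Complex.re_le_norm _).trans (hHb _ (by rw [hnr hr.1.le]; exact hr.2.le))
    calc _ ≤ ((2 : ℝ) ^ (2 * d) * ‖1 - Complex.exp (Complex.I * w)‖ ^ (-2 * d)) * Real.exp (2 * A) :=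
          mul_le_mul e1 e2 (Real.exp_nonneg _) (by positivity)
      _ = C * ((Real.exp (-L w) * Real.exp (L w)) *
          (1 / (2 * Real.pi) * ‖1 - Complex.exp (Complex.I * w)‖ ^ (-2 * d))) := by
          rw [← Real.exp_add, neg_add_cancel, Real.exp_zero, hC]
          field_simp
      _ = _ := by ring
  · filter_upwards [hne0, hfL'] with w hw hfw hwI
    have hfw' := hfw hwI
    rw [uIoc_of_le (by linarith)] at hwI
    have hpos := norm_one_sub_exp_pos ⟨hwI.1.le, hwI.2⟩ hw
    have h1 : Tendsto (fun r : ℝ => ‖1 - r * Complex.exp (Complex.I * w)‖) (𝓝[<] 1)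
        (𝓝 ‖1 - Complex.exp (Complex.I * w)‖) := by
      have : Continuous fun r : ℝ => ‖1 - r * Complex.exp (Complex.I * w)‖ := by fun_prop
      have h2 := this.tendsto 1
      simp only [Complex.ofReal_one, one_mul] at h2
      exact h2.mono_left nhdsWithin_le_nhds
    have h2 : Tendsto (fun r : ℝ => ‖1 - r * Complex.exp (Complex.I * w)‖ ^ (-2 * d) *
        Real.exp (2 * (H (r * Complex.exp (Complex.I * w))).re)) (𝓝[<] 1)
        (𝓝 (‖1 - Complex.exp (Complex.I * w)‖ ^ (-2 * d) * Real.exp (L w - l 0))) := by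
      refine (h1.rpow_const (Or.inl hpos.ne')).mul ?_
      rw [← hHe w]
      exact (Real.continuous_exp.tendsto _).comp
        (((Complex.continuous_re.tendsto _).comp (hHc w)).const_mul 2)
    have h3 : (2 * Real.pi * Real.exp (-l 0) : ℂ) *
        (Complex.exp (-(Complex.I * h * w)) * (f w : ℂ)) = Complex.exp (-(Complex.I * h * w)) *
        ((‖1 - Complex.exp (Complex.I * w)‖ ^ (-2 * d) * Real.exp (L w - l 0) : ℝ) : ℂ) := by
      rw [hfw', mul_left_comm]
      congr 1
      rw [show Real.exp (L w - l 0) = Real.exp (-l 0) * Real.exp (L w) by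
        rw [← Real.exp_add]; ring_nf]
      have : (Real.pi : ℂ) ≠ 0 := by exact_mod_cast hpi.ne'
      push_cast
      field_simp
    rw [h3]
    refine Tendsto.const_mul _ ((Complex.continuous_ofReal.tendsto _).comp (h2.congr' ?_))
    filter_upwards [Ioo_mem_nhdsLT (zero_lt_one (α := ℝ))] with r hr
    have hle := norm_one_sub_exp_le hr.1.le hr.2.le w
    rw [hnorm _ (norm_pos_iff.1 (by linarith))]

end Covariance

/-! ### Inverting a moving average in a Hilbert space -/

section Inversion

variable {ψ π : ℕ → ℝ}

theorem summable_sq_intExtend_sub (hψ : Summable fun j => ψ j ^ 2) (t : ℤ) :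
    Summable fun m : ℤ => intExtend ψ (t - m) ^ 2 := by
  have h1 : Summable fun m : ℤ => intExtend ψ m ^ 2 := by
    refine Summable.of_nat_of_neg_add_one ?_ ?_
    · simpa only [intExtend_natCast] using hψ
    · have : (fun n : ℕ => intExtend ψ (-((n : ℤ) + 1)) ^ 2) = fun _ => 0 := by
        funext n
        rw [intExtend_of_neg _ (by omega)]; simp
      rw [this]; exact summable_zero
  exact h1.comp_injective (Equiv.subLeft t).injective

/-- The moving average with coefficients `ψ` over the standard basis of `ℓ²(ℤ)`, at time `t`. -/
def movingAverage (hψ : Summable fun j => ψ j ^ 2) (t : ℤ) : lp (fun _ : ℤ => ℝ) 2 :=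
  ⟨fun m => intExtend ψ (t - m), by
    change Memℓp _ 2
    rw [memℓp_gen_iff (by norm_num)]
    simpa using summable_sq_intExtend_sub hψ t⟩

theorem movingAverage_apply (hψ : Summable fun j => ψ j ^ 2) (t m : ℤ) :
    movingAverage hψ t m = intExtend ψ (t - m) := rfl

theorem tsum_nat_eq_tsum_int {u : ℤ → ℝ} (h : ∀ m < 0, u m = 0) :
    ∑' k : ℕ, u k = ∑' m : ℤ, u m := by
  refine Function.Injective.tsum_eq (g := fun k : ℕ => (k : ℤ)) Nat.cast_injective fun m hm => ?_
  have : 0 ≤ m := by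
    by_contra hlt
    exact hm (h m (by omega))
  exact ⟨m.toNat, by simp [this]⟩

theorem inner_movingAverage (hψ : Summable fun j => ψ j ^ 2) (s t : ℤ) :
    inner ℝ (movingAverage hψ s) (movingAverage hψ t) =
      ∑' k : ℕ, ψ k * intExtend ψ (t - s + k) := by
  have h1 : ∑' k : ℕ, ψ k * intExtend ψ (t - s + k) =
      ∑' m : ℤ, intExtend ψ m * intExtend ψ (t - s + m) := by
    rw [← tsum_nat_eq_tsum_int fun m hm => by rw [intExtend_of_neg _ hm, zero_mul]]
    simp only [intExtend_natCast]
  rw [h1, lp.inner_eq_tsum, ← (Equiv.subLeft s).tsum_eq]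
  refine tsum_congr fun m => ?_
  simp only [movingAverage_apply, Equiv.subLeft_apply, RCLike.inner_apply, conj_trivial]
  rw [mul_comm]
  congr 2 <;> ring

theorem sum_intExtend_of_convolution
    (hconv : ∀ j, ∑ i ∈ Finset.range (j + 1), π i * ψ (j - i) = if j = 0 then 1 else 0) (n : ℤ) :
    HasSum (fun j : ℕ => π j * intExtend ψ (n - j)) (if n = 0 then 1 else 0) := by
  rcases lt_or_ge n 0 with hn | hn
  · rw [if_neg hn.ne]
    convert! hasSum_zero (α := ℝ) (β := ℕ) using 2 with j
    rw [intExtend_of_neg _ (by omega), mul_zero]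
  · lift n to ℕ using hn
    have h1 : (if (n : ℤ) = 0 then (1 : ℝ) else 0) =
        ∑ j ∈ Finset.range (n + 1), π j * intExtend ψ ((n : ℤ) - j) := by
      rw [Finset.sum_congr rfl fun j hj => ?_, hconv n]
      · simp
      · have hj' : j ≤ n := by simpa [Nat.lt_succ_iff] using hj
        rw [← Nat.cast_sub hj', intExtend_natCast]
    rw [h1]
    refine hasSum_sum_of_ne_finset_zero fun j hj => ?_
    have hj' : n < j := by simpa using hj
    rw [intExtend_of_neg _ (by omega), mul_zero]

/-- All `movingAverage hψ s` have the same norm, so absolute summability of `π` gives convergence in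
`ℓ²`; the sum is then identified coordinatewise, each coordinate being a finite convolution of `π`
and `ψ`. -/
theorem hasSum_smul_movingAverage (hψ : Summable fun j => ψ j ^ 2) (hπ : Summable fun j => |π j|)
    (hconv : ∀ j, ∑ i ∈ Finset.range (j + 1), π i * ψ (j - i) = if j = 0 then 1 else 0) (t : ℤ) :
    HasSum (fun j : ℕ => π j • movingAverage hψ (t - j)) (lp.single 2 t (1 : ℝ)) := by
  have hnorm : ∀ s, ‖movingAverage hψ s‖ = ‖movingAverage hψ 0‖ := by
    intro s
    rw [← sq_eq_sq₀ (norm_nonneg _) (norm_nonneg _), ← real_inner_self_eq_norm_sq,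
      ← real_inner_self_eq_norm_sq, inner_movingAverage, inner_movingAverage]
    simp
  have hs : Summable fun j : ℕ => π j • movingAverage hψ (t - j) := by
    refine Summable.of_norm ?_
    simp_rw [norm_smul, hnorm, Real.norm_eq_abs]
    exact hπ.mul_right _
  convert! hs.hasSum using 1
  ext m
  have h1 := (lp.evalCLM ℝ (fun _ : ℤ => ℝ) 2 m).hasSum hs.hasSum
  have h2 : HasSum (fun j : ℕ => π j * intExtend ψ ((t - m) - j)) ((∑' j : ℕ, π j • movingAverage hψ (t - j)) m) := by
    refine h1.congr_fun fun j => ?_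
    change _ = (π j • movingAverage hψ (t - j)) m
    rw [lp.coeFn_smul, Pi.smul_apply, movingAverage_apply, smul_eq_mul]
    congr 2; ring
  rw [h2.unique (sum_intExtend_of_convolution hconv (t - m)), lp.single_apply]
  by_cases h : t = m
  · subst h; simp
  · rw [if_neg (sub_ne_zero.2 h), Pi.single_eq_of_ne (Ne.symm h)]

variable {E : Type*} [NormedAddCommGroup E] [InnerProductSpace ℝ E] {X Z : ℤ → E} {v : ℝ}

theorem norm_eq_of_inner_eq
    (hX : ∀ s t, inner ℝ (X s) (X t) = v * ∑' k : ℕ, ψ k * intExtend ψ (t - s + k)) (t : ℤ) :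
    ‖X t‖ = ‖X 0‖ := by
  rw [← sq_eq_sq₀ (norm_nonneg _) (norm_nonneg _), ← real_inner_self_eq_norm_sq,
    ← real_inner_self_eq_norm_sq, hX, hX]
  simp

/-- The Gram matrix of `X` is `v` times that of the model in `ℓ²(ℤ)`. The inner product can thus be
computed there, where the inverted series is a basis vector and picks out a single coordinate. -/
theorem inner_innovation_left (hψ : Summable fun j => ψ j ^ 2) (hπ : Summable fun j => |π j|)
    (hconv : ∀ j, ∑ i ∈ Finset.range (j + 1), π i * ψ (j - i) = if j = 0 then 1 else 0)
    (hX : ∀ s t, inner ℝ (X s) (X t) = v * ∑' k : ℕ, ψ k * intExtend ψ (t - s + k))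
    (hZ : ∀ t, HasSum (fun j : ℕ => π j • X (t - j)) (Z t)) (s t : ℤ) :
    inner ℝ (Z s) (X t) = v * intExtend ψ (t - s) := by
  have h1 := (innerSL ℝ (X t)).hasSum (hZ s)
  have h2 := ((innerSL ℝ (movingAverage hψ t)).hasSum
    (hasSum_smul_movingAverage hψ hπ hconv s)).mul_left v
  simp only [innerSL_apply_apply, inner_smul_right, hX, inner_movingAverage] at h1 h2
  have h3 := h1.unique (h2.congr_fun fun j => by ring)
  rw [real_inner_comm, h3, lp.inner_single_right]
  simp [movingAverage_apply]

theorem inner_innovation (hψ : Summable fun j => ψ j ^ 2) (hπ : Summable fun j => |π j|)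
    (hconv : ∀ j, ∑ i ∈ Finset.range (j + 1), π i * ψ (j - i) = if j = 0 then 1 else 0)
    (hX : ∀ s t, inner ℝ (X s) (X t) = v * ∑' k : ℕ, ψ k * intExtend ψ (t - s + k))
    (hZ : ∀ t, HasSum (fun j : ℕ => π j • X (t - j)) (Z t)) (s t : ℤ) :
    inner ℝ (Z s) (Z t) = if s = t then v else 0 := by
  have h1 := (innerSL ℝ (Z s)).hasSum (hZ t)
  simp only [innerSL_apply_apply, inner_smul_right,
    inner_innovation_left hψ hπ hconv hX hZ] at h1
  have h2 := (sum_intExtend_of_convolution hconv (t - s)).mul_left v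
  rw [h1.unique (h2.congr_fun fun j => by
    rw [show t - (j : ℤ) - s = t - s - j by ring]; ring)]
  by_cases h : s = t
  · simp [h]
  · rw [if_neg h, if_neg (sub_ne_zero.2 (Ne.symm h)), mul_zero]

theorem tendsto_norm_sub_sum (hψ : Summable fun j => ψ j ^ 2) (hπ : Summable fun j => |π j|)
    (hconv : ∀ j, ∑ i ∈ Finset.range (j + 1), π i * ψ (j - i) = if j = 0 then 1 else 0)
    (hX : ∀ s t, inner ℝ (X s) (X t) = v * ∑' k : ℕ, ψ k * intExtend ψ (t - s + k))
    (hZ : ∀ t, HasSum (fun j : ℕ => π j • X (t - j)) (Z t)) (t : ℤ) :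
    Tendsto (fun n : ℕ => ‖X t - ∑ j ∈ Finset.range n, ψ j • Z (t - j)‖) atTop (𝓝 0) := by
  -- By orthogonality of the `Z`, the squared error is exactly `v` times the tail of `∑ ψ k ^ 2`.
  have h1 : ∀ n : ℕ, ‖X t - ∑ j ∈ Finset.range n, ψ j • Z (t - j)‖ ^ 2 =
      v * ∑' k, ψ k ^ 2 - v * ∑ j ∈ Finset.range n, ψ j ^ 2 := by
    intro n
    rw [norm_sub_sq_real, ← real_inner_self_eq_norm_sq, ← real_inner_self_eq_norm_sq, hX,
      inner_sum, inner_sum]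
    have e1 : ∀ j ∈ Finset.range n, inner ℝ (X t) (ψ j • Z (t - j)) = v * ψ j ^ 2 := by
      intro j _
      rw [inner_smul_right, real_inner_comm, inner_innovation_left hψ hπ hconv hX hZ,
        show t - (t - (j : ℤ)) = j by ring, intExtend_natCast]
      ring
    have e2 : ∀ i ∈ Finset.range n, inner ℝ (∑ j ∈ Finset.range n, ψ j • Z (t - j))
        (ψ i • Z (t - i)) = v * ψ i ^ 2 := by
      intro i hi
      rw [sum_inner, Finset.sum_eq_single_of_mem i hi]
      · rw [inner_smul_left, inner_smul_right, inner_innovation hψ hπ hconv hX hZ, if_pos rfl]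
        simp only [conj_trivial]; ring
      · intro j _ hji
        rw [inner_smul_left, inner_smul_right, inner_innovation hψ hπ hconv hX hZ, if_neg]
        · simp
        · intro h
          apply hji
          omega
    rw [Finset.sum_congr rfl e1, Finset.sum_congr rfl e2, ← Finset.mul_sum]
    simp only [sub_self, zero_add, intExtend_natCast]
    have : ∑' k, ψ k * ψ k = ∑' k, ψ k ^ 2 := tsum_congr fun k => by ring
    rw [this]
    ring
  have h2 : Tendsto (fun n : ℕ => v * ∑' k, ψ k ^ 2 - v * ∑ j ∈ Finset.range n, ψ j ^ 2) atTop
      (𝓝 0) := by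
    have := (hψ.hasSum.tendsto_sum_nat.const_mul v).const_sub (v * ∑' k, ψ k ^ 2)
    rwa [sub_self] at this
  have h3 := (h2.congr fun n => (h1 n).symm).sqrt
  simpa using h3

end Inversion

/-! ### Gaussian elements of `L²` -/

section Gaussian

variable {Ω : Type*} [MeasurableSpace Ω] {μ : Measure Ω}

theorem integral_abs_le_norm [IsProbabilityMeasure μ] (U : Lp ℝ 2 μ) : ∫ ω, |U ω| ∂μ ≤ ‖U‖ := by
  have h1 : MemLp U 2 μ := Lp.memLp U
  have h2 := eLpNorm_le_eLpNorm_of_exponent_le (μ := μ) (f := U) (p := 1) (q := 2) (by norm_num)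
    h1.aestronglyMeasurable
  rw [Lp.norm_def, ← ENNReal.toReal_ofReal (integral_nonneg fun ω => abs_nonneg (U ω))]
  refine ENNReal.toReal_mono h1.eLpNorm_ne_top (le_trans (le_of_eq ?_) h2)
  rw [eLpNorm_one_eq_lintegral_enorm, ← ofReal_integral_norm_eq_lintegral_enorm
    (h1.integrable (by norm_num))]
  rfl

/-- Centered Gaussian elements of `L²`, characterized by their characteristic function. -/
def centeredGaussianSet (μ : Measure Ω) : Set (Lp ℝ 2 μ) :=
  {U | ∀ r : ℝ, ∫ ω, Complex.exp (r * U ω * Complex.I) ∂μ = Complex.exp (-(‖U‖ ^ 2 * r ^ 2 / 2))}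

theorem integrable_exp_ofReal_mul_I [IsFiniteMeasure μ] {Y : Ω → ℝ} (hY : AEMeasurable Y μ) (r : ℝ) :
    Integrable (fun ω => Complex.exp (r * Y ω * Complex.I)) μ := by
  refine Integrable.of_bound (C := 1) ?_ (Eventually.of_forall fun ω => ?_)
  · exact AEMeasurable.aestronglyMeasurable (by fun_prop)
  · rw [← Complex.ofReal_mul, Complex.norm_exp_ofReal_mul_I]

/-- For fixed `r`, `|e^{ia} - e^{ib}| ≤ |a - b|` and `‖·‖₁ ≤ ‖·‖₂` make the characteristic function
a Lipschitz function of `U`, so each defining equation is a closed condition. -/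
theorem isClosed_centeredGaussianSet [IsProbabilityMeasure μ] : IsClosed (centeredGaussianSet μ) := by
  rw [centeredGaussianSet, ofPred_forall]
  refine isClosed_iInter fun r => isClosed_eq ?_ (by fun_prop)
  refine LipschitzWith.continuous (K := ‖r‖₊) (LipschitzWith.of_dist_le_mul fun U V => ?_)
  have hU := integrable_exp_ofReal_mul_I (Lp.aestronglyMeasurable U).aemeasurable r
  have hV := integrable_exp_ofReal_mul_I (Lp.aestronglyMeasurable V).aemeasurable r
  have hUV : Integrable (fun ω => |r| * |(U - V) ω|) μ :=
    (((Lp.memLp (U - V)).integrable (by norm_num)).abs).const_mul _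
  rw [dist_eq_norm, dist_eq_norm, ← integral_sub hU hV]
  calc _ ≤ ∫ ω, |r| * |(U - V) ω| ∂μ := by
        refine norm_integral_le_of_norm_le hUV ?_
        filter_upwards [Lp.coeFn_sub U V] with ω hω
        rw [hω, Pi.sub_apply, ← abs_mul]
        have h1 : Complex.exp (r * U ω * Complex.I) - Complex.exp (r * V ω * Complex.I) =
            Complex.exp (((r * V ω : ℝ) : ℂ) * Complex.I) *
              (Complex.exp (Complex.I * ((r * (U ω - V ω) : ℝ) : ℂ)) - 1) := by
          rw [mul_sub, ← Complex.exp_add, mul_one]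
          push_cast
          congr 2; ring
        rw [h1, norm_mul, Complex.norm_exp_ofReal_mul_I, one_mul]
        exact Real.norm_exp_I_mul_ofReal_sub_one_le
    _ = |r| * ∫ ω, |(U - V) ω| ∂μ := integral_const_mul _ _
    _ ≤ |r| * ‖U - V‖ := by gcongr; exact integral_abs_le_norm _
    _ = _ := rfl

theorem hasLaw_of_mem_centeredGaussianSet [IsProbabilityMeasure μ] {U : Lp ℝ 2 μ} (hU : U ∈ centeredGaussianSet μ) :
    HasLaw U (gaussianReal 0 (‖U‖ ^ 2).toNNReal) μ where
  aemeasurable := (Lp.aestronglyMeasurable U).aemeasurable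
  map_eq := by
    have hm := (Lp.aestronglyMeasurable U).aemeasurable
    have : IsProbabilityMeasure (μ.map U) := Measure.isProbabilityMeasure_map hm
    refine Measure.ext_of_charFun (funext fun r => ?_)
    rw [charFun_apply_real, charFun_gaussianReal, integral_map hm (by fun_prop), hU r]
    congr 1
    rw [show ((‖U‖ ^ 2).toNNReal : ℂ) = (((‖U‖ ^ 2).toNNReal : ℝ) : ℂ) from rfl,
      Real.coe_toNNReal _ (by positivity)]
    push_cast
    ring

theorem mem_centeredGaussianSet_of_hasGaussianLaw {U : Lp ℝ 2 μ} (hU : HasGaussianLaw U μ)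
    (h0 : ∫ ω, U ω ∂μ = 0) : U ∈ centeredGaussianSet μ := by
  intro r
  have hm := hU.aemeasurable
  have h1 := hU.charFun_map_eq r
  rw [charFun_apply_real, integral_map hm (by fun_prop)] at h1
  rw [h1]
  congr 1
  have h2 : ∫ ω, inner ℝ r (U ω) ∂μ = 0 := by
    simp only [RCLike.inner_apply, conj_trivial]
    rw [integral_mul_const, h0, zero_mul]
  have h3 : Var[fun ω => inner ℝ r (U ω); μ] = ‖U‖ ^ 2 * r ^ 2 := by
    rw [variance_of_integral_eq_zero (by fun_prop) h2, ← real_inner_self_eq_norm_sq, L2.inner_def,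
      ← integral_mul_const]
    refine integral_congr_ae (Eventually.of_forall fun ω => ?_)
    simp only [RCLike.inner_apply, conj_trivial]
    ring
  rw [h2, h3]
  push_cast
  ring

end Gaussian

/-! ### Gaussian innovations -/

section LinearProcess

variable {Ω : Type*} [MeasurableSpace Ω] {μ : Measure Ω}

theorem coeFn_sum_smul {ι : Type*} (s : Finset ι) (a : ι → ℝ) (U : ι → Lp ℝ 2 μ) :
    ⇑(∑ i ∈ s, a i • U i) =ᵐ[μ] fun ω => ∑ i ∈ s, a i * U i ω := by
  classical
  induction s using Finset.induction_on with
  | empty =>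
    filter_upwards [Lp.coeFn_zero ℝ 2 μ] with ω hω
    simpa using hω
  | insert i s hi ih =>
    rw [Finset.sum_insert hi]
    filter_upwards [Lp.coeFn_add (a i • U i) (∑ i ∈ s, a i • U i), Lp.coeFn_smul (a i) (U i), ih]
      with ω h1 h2 h3
    rw [h1, Pi.add_apply, h2, h3, Finset.sum_insert hi]
    rfl

/-- Cramér–Wold: a vector is Gaussian once every linear functional of it is. Joint Gaussianity is
what upgrades zero correlation to independence. -/
theorem hasGaussianLaw_pi_of_span [IsProbabilityMeasure μ] {Z : ℤ → Lp ℝ 2 μ}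
    (hZ : ∀ (s : Finset ℤ) (a : s → ℝ), ∑ i, a i • Z i ∈ centeredGaussianSet μ) (s : Finset ℤ) :
    HasGaussianLaw (fun ω (t : s) => Z t ω) μ where
  isGaussian_map := by
    have hm : AEMeasurable (fun ω (t : s) => Z t ω) μ :=
      aemeasurable_pi_iff.2 fun t => (Lp.aestronglyMeasurable (Z t)).aemeasurable
    refine isGaussian_of_map_eq_gaussianReal fun L => ?_
    have h1 := hasLaw_of_mem_centeredGaussianSet (hZ s fun i => L (Pi.single i 1))
    refine ⟨0, _, Eq.trans ?_ h1.map_eq⟩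
    rw [AEMeasurable.map_map_of_aemeasurable (by fun_prop) hm]
    refine Measure.map_congr ?_
    filter_upwards [coeFn_sum_smul Finset.univ (fun i : s => L (Pi.single i 1)) fun i => Z i]
      with ω hω
    rw [hω, Function.comp_apply]
    have h2 : (fun t : s => Z t ω) = ∑ i : s, (Z i ω) • (Pi.single i (1 : ℝ) : s → ℝ) := by
      ext t
      simp [Finset.sum_apply, Pi.single_apply]
    rw [h2, map_sum]
    refine Finset.sum_congr rfl fun i _ => ?_
    rw [map_smul, smul_eq_mul, mul_comm]

variable {X : ℤ → Ω → ℝ} {ψ π : ℕ → ℝ} {v : ℝ}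

/-- A centered Gaussian process whose autocovariances are those of an invertible moving average
is the moving average of its Gaussian innovations. -/
theorem exists_gaussian_innovations [IsProbabilityMeasure μ] (hG : IsGaussianProcess X μ)
    (hmean : ∀ t, ∫ ω, X t ω ∂μ = 0)
    (hcov : ∀ s t, cov[X s, X t; μ] = v * ∑' k : ℕ, ψ k * intExtend ψ (t - s + k))
    (hψ : Summable fun j => ψ j ^ 2) (hπ : Summable fun j => |π j|)
    (hconv : ∀ j, ∑ i ∈ Finset.range (j + 1), π i * ψ (j - i) = if j = 0 then 1 else 0)
    (hπ0 : π 0 = 1) :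
    ∃ Z : ℤ → Ω → ℝ, iIndepFun Z μ ∧
      (∀ t, HasLaw (Z t) (gaussianReal 0 v.toNNReal) μ) ∧
      IsInnovation X Z μ ∧ IsLinearSequence X Z ψ μ := by
  have hmem : ∀ t, MemLp (X t) 2 μ := fun t => (hG.hasGaussianLaw_eval t).memLp_two
  set Xh : ℤ → Lp ℝ 2 μ := fun t => (hmem t).toLp (X t) with hXh
  have hXc : ∀ t, Xh t =ᵐ[μ] X t := fun t => (hmem t).coeFn_toLp
  have hin : ∀ U V : Lp ℝ 2 μ, inner ℝ U V = ∫ ω, U ω * V ω ∂μ := by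
    intro U V
    rw [L2.inner_def]
    refine integral_congr_ae (Eventually.of_forall fun ω => ?_)
    simp only [RCLike.inner_apply, conj_trivial]
    ring
  have hX : ∀ s t, inner ℝ (Xh s) (Xh t) = v * ∑' k : ℕ, ψ k * intExtend ψ (t - s + k) := by
    intro s t
    rw [← hcov, covariance_eq_sub (hmem s) (hmem t), hmean, hmean, hin, mul_zero, sub_zero]
    refine integral_congr_ae ?_
    filter_upwards [hXc s, hXc t] with ω h1 h2
    rw [h1, h2]; rfl
  have hnorm := norm_eq_of_inner_eq hX
  have hsummable : ∀ t : ℤ, Summable fun j : ℕ => π j • Xh (t - j) := by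
    intro t
    refine Summable.of_norm ?_
    simp_rw [norm_smul, hnorm (_ - _), Real.norm_eq_abs]
    exact hπ.mul_right _
  set Zh : ℤ → Lp ℝ 2 μ := fun t => ∑' j : ℕ, π j • Xh (t - j) with hZh
  have hZ : ∀ t, HasSum (fun j : ℕ => π j • Xh (t - j)) (Zh t) := fun t => (hsummable t).hasSum
  have hspan : ∀ U ∈ Submodule.span ℝ (range Xh), U ∈ centeredGaussianSet μ := by
    intro U hU
    obtain ⟨c, rfl⟩ := (Finsupp.mem_span_range_iff_exists_finsupp).1 hU
    have h1 : ⇑(c.sum fun i a => a • Xh i) =ᵐ[μ] fun ω => ∑ i ∈ c.support, c i * X i ω := by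
      refine (coeFn_sum_smul c.support c Xh).trans ?_
      have : ∀ᵐ ω ∂μ, ∀ t, Xh t ω = X t ω := ae_all_iff.2 hXc
      filter_upwards [this] with ω hω
      exact Finset.sum_congr rfl fun i _ => by rw [hω]
    refine mem_centeredGaussianSet_of_hasGaussianLaw ?_ ?_
    · refine HasGaussianLaw.congr ?_ h1.symm
      have h2 := (hG.hasGaussianLaw c.support).map
        (∑ i : c.support, c i • ContinuousLinearMap.proj (R := ℝ) (φ := fun _ => ℝ) i)
      convert! h2 using 1
      funext ω
      simp only [Function.comp_apply, sum_apply, smul_apply,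
        ContinuousLinearMap.proj_apply, Finset.restrict, smul_eq_mul]
      exact (Finset.sum_coe_sort c.support fun i => c i * X i ω).symm
    · rw [integral_congr_ae h1, integral_finsetSum _ fun i _ =>
        ((hmem i).integrable (by norm_num)).const_mul _]
      simp_rw [integral_const_mul, hmean]
      simp
  have hclos : ∀ U ∈ (Submodule.span ℝ (range Xh)).topologicalClosure,
      U ∈ centeredGaussianSet μ := by
    intro U hU
    exact closure_minimal hspan isClosed_centeredGaussianSet hU
  have hZmem : ∀ t, Zh t ∈ (Submodule.span ℝ (range Xh)).topologicalClosure := by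
    intro t
    refine (Submodule.isClosed_topologicalClosure _).mem_of_tendsto (hZ t)
      (Eventually.of_forall fun s => ?_)
    refine Submodule.le_topologicalClosure _ (Submodule.sum_mem _ fun j _ =>
      Submodule.smul_mem _ _ (Submodule.subset_span (mem_range_self _)))
  have hZZ := inner_innovation hψ hπ hconv hX hZ
  have hZX := inner_innovation_left hψ hπ hconv hX hZ
  have hlaw : ∀ t, HasLaw (Zh t) (gaussianReal 0 v.toNNReal) μ := by
    intro t
    have := hasLaw_of_mem_centeredGaussianSet (hclos _ (hZmem t))
    rwa [← real_inner_self_eq_norm_sq, hZZ, if_pos rfl] at this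
  have hZmean : ∀ t, ∫ ω, Zh t ω ∂μ = 0 := by
    intro t
    rw [(hlaw t).integral_eq, integral_id_gaussianReal]
  refine ⟨fun t => Zh t, ?_, hlaw, ?_, ?_⟩
  · rw [iIndepFun_iff_finset]
    intro s
    have hgauss := hasGaussianLaw_pi_of_span (Z := Zh) (fun s a => hclos _ (Submodule.sum_mem _
      fun i _ => Submodule.smul_mem _ _ (hZmem i))) s
    refine HasGaussianLaw.iIndepFun_of_covariance_eq_zero (X := fun (t : s) => ⇑(Zh t)) hgauss ?_
    intro i j hij
    rw [covariance_eq_sub (Lp.memLp _) (Lp.memLp _), hZmean, hZmean, mul_zero, sub_zero]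
    have := hZZ i j
    rw [if_neg (fun h => hij (Subtype.ext h)), hin] at this
    exact this
  · intro t
    refine ⟨Lp.memLp _, fun s hs => ?_, fun δ hδ => ?_⟩
    · have h1 := hZX t s
      rw [intExtend_of_neg _ (by omega), mul_zero, hin] at h1
      rw [← h1]
      refine integral_congr_ae ?_
      filter_upwards [hXc s] with ω hω
      rw [hω]
    -- As `π 0 = 1`, the predictor is `X_t - Z_t = -∑_{j ≥ 1} π_j X_{t-j}`; its truncations are the
    -- required finite combinations of the strict past.
    · have h1 := ((hasSum_nat_add_iff' 1).2 (hZ t)).tendsto_sum_nat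
      simp only [Finset.range_one, Finset.sum_singleton, hπ0, one_smul, Nat.cast_zero,
        sub_zero] at h1
      obtain ⟨n, hn⟩ := ((Metric.tendsto_atTop.1 h1) δ hδ)
      have h2 := hn n le_rfl
      rw [dist_eq_norm] at h2
      set c : ℤ →₀ ℝ := ∑ j ∈ Finset.range n, Finsupp.single (t - ((j + 1 : ℕ) : ℤ)) (-π (j + 1))
        with hc
      have hlin : ∑ s ∈ c.support, c s • Xh s =
          -∑ j ∈ Finset.range n, π (j + 1) • Xh (t - ((j + 1 : ℕ) : ℤ)) := by
        have : Finsupp.linearCombination ℝ Xh c = ∑ s ∈ c.support, c s • Xh s := rfl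
        rw [← this, hc, map_sum, ← Finset.sum_neg_distrib]
        refine Finset.sum_congr rfl fun j _ => ?_
        rw [Finsupp.linearCombination_single, neg_smul]
      refine ⟨c, fun s hs => ?_, ?_⟩
      · have h3 := Finsupp.support_finsetSum hs
        rw [Finset.mem_biUnion] at h3
        obtain ⟨j, _, hj⟩ := h3
        have := Finsupp.support_single_subset hj
        rw [Finset.mem_singleton] at this
        omega
      · have h3 : (fun ω => X t ω - Zh t ω - ∑ s ∈ c.support, c s * X s ω) =ᵐ[μ]
            ⇑(Xh t - Zh t - ∑ s ∈ c.support, c s • Xh s) := by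
          have : ∀ᵐ ω ∂μ, ∀ t, Xh t ω = X t ω := ae_all_iff.2 hXc
          filter_upwards [this, coeFn_sum_smul c.support c Xh, Lp.coeFn_sub (Xh t) (Zh t),
            Lp.coeFn_sub (Xh t - Zh t) (∑ s ∈ c.support, c s • Xh s)] with ω e1 e2 e3 e4
          rw [e4, Pi.sub_apply, e3, Pi.sub_apply, e2, e1]
          simp only [e1]
        rw [eLpNorm_congr_ae h3, ← Lp.enorm_def, ← ofReal_norm, ENNReal.ofReal_lt_ofReal_iff hδ,
          hlin]
        convert! h2 using 2
        abel
  · intro t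
    have h1 := tendsto_norm_sub_sum hψ hπ hconv hX hZ t
    have h2 := ENNReal.tendsto_ofReal h1
    rw [ENNReal.ofReal_zero] at h2
    refine h2.congr fun n => ?_
    rw [ofReal_norm, Lp.enorm_def]
    refine eLpNorm_congr_ae ?_
    filter_upwards [hXc t, coeFn_sum_smul (Finset.range n) ψ fun j : ℕ => Zh (t - j),
      Lp.coeFn_sub (Xh t) (∑ j ∈ Finset.range n, ψ j • Zh (t - j))] with ω e1 e2 e3
    rw [e3, Pi.sub_apply, e1, e2]

end LinearProcess

/-! ### Power-law sequences and summability -/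

theorem isEquivalent_of_tendsto_mul_rpow {u : ℕ → ℝ} {d K : ℝ} (hK : K ≠ 0)
    (hu : Tendsto (fun j : ℕ => u j * (j : ℝ) ^ (1 - d)) atTop (𝓝 K)) :
    u ~[atTop] fun j : ℕ => K * (j : ℝ) ^ (d - 1) := by
  refine (isEquivalent_iff_tendsto_one ?_).2 ?_
  · filter_upwards [eventually_ge_atTop 1] with j hj
    have : (0 : ℝ) < j := by exact_mod_cast hj
    positivity
  · have h1 := hu.mul_const K⁻¹
    rw [mul_inv_cancel₀ hK] at h1
    refine h1.congr' ?_
    filter_upwards [eventually_ge_atTop 1] with j hj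
    have : (0 : ℝ) < j := by exact_mod_cast hj
    rw [Pi.div_apply, show (1 - d) = -(d - 1) by ring, Real.rpow_neg this.le]
    field_simp

theorem summable_sq_of_isEquivalent {u : ℕ → ℝ} {d K : ℝ} (hd : d < 1 / 2)
    (hu : u ~[atTop] fun j : ℕ => K * (j : ℝ) ^ (d - 1)) : Summable fun j => u j ^ 2 := by
  have h1 : u =O[atTop] fun j : ℕ => (j : ℝ) ^ (d - 1) :=
    hu.isBigO.trans (isBigO_const_mul_self _ _ _)
  have h2 : Summable fun j : ℕ => (j : ℝ) ^ (2 * (d - 1)) :=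
    Real.summable_nat_rpow.2 (by linarith)
  refine summable_of_isBigO_nat h2 ((h1.pow 2).congr_right fun j => ?_)
  rw [mul_comm 2, Real.rpow_mul (Nat.cast_nonneg j)]
  norm_num

theorem summable_abs_convolution {a b : ℕ → ℝ} (ha : Summable fun n => |a n|)
    (hb : Summable fun n => |b n|) :
    Summable fun j => |∑ i ∈ Finset.range (j + 1), a i * b (j - i)| :=
  summable_norm_sum_mul_range_of_summable_norm (f := a) (g := b) ha hb

/-! ### Aggregated spectral densities -/

section MixtureDensity

variable {φ : ℝ → ℝ}

theorem norm_one_sub_mul_exp_sq (x w : ℝ) :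
    ‖1 - (x : ℂ) * Complex.exp (Complex.I * w)‖ ^ 2 = 1 + x ^ 2 - 2 * x * Real.cos w := by
  rw [← Complex.normSq_eq_norm_sq, mul_comm Complex.I, Complex.normSq_apply]
  simp only [Complex.sub_re, Complex.one_re, Complex.re_ofReal_mul, Complex.exp_ofReal_mul_I_re,
    Complex.sub_im, Complex.one_im, Complex.im_ofReal_mul, Complex.exp_ofReal_mul_I_im]
  linear_combination x ^ 2 * Real.sin_sq_add_cos_sq w

/-- The minimum over real `x` is attained at `x = cos w`. Away from the zeros of the sine the kernel
is therefore bounded in `x`, and integrability of `φ` alone suffices. -/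
theorem sin_sq_le_norm_one_sub_mul_exp_sq (x w : ℝ) :
    Real.sin w ^ 2 ≤ ‖1 - (x : ℂ) * Complex.exp (Complex.I * w)‖ ^ 2 := by
  rw [norm_one_sub_mul_exp_sq]
  nlinarith [sq_nonneg (x - Real.cos w), Real.sin_sq_add_cos_sq w]

theorem norm_one_sub_mul_exp_sq_le {x : ℝ} (hx : x ∈ Icc (-1 : ℝ) 1) (w : ℝ) :
    ‖1 - (x : ℂ) * Complex.exp (Complex.I * w)‖ ^ 2 ≤ 4 := by
  have h1 : ‖1 - (x : ℂ) * Complex.exp (Complex.I * w)‖ ≤ 2 := by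
    refine (norm_sub_le _ _).trans ?_
    rw [norm_one, norm_mul, norm_exp_I_mul, mul_one, Complex.norm_real]
    linarith [abs_le.2 hx, Real.norm_eq_abs x]
  nlinarith [norm_nonneg (1 - (x : ℂ) * Complex.exp (Complex.I * w))]

theorem integrable_div_norm_sq (hφ : Integrable φ) {w : ℝ} (hw : Real.sin w ≠ 0) :
    Integrable fun x => φ x / ‖1 - (x : ℂ) * Complex.exp (Complex.I * w)‖ ^ 2 := by
  simp_rw [div_eq_mul_inv]
  refine hφ.mul_bdd (c := (Real.sin w ^ 2)⁻¹) ?_ (Eventually.of_forall fun x => ?_)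
  · exact Measurable.aestronglyMeasurable (by fun_prop)
  · rw [norm_inv, Real.norm_of_nonneg (by positivity)]
    have : 0 < Real.sin w ^ 2 := by positivity
    exact inv_anti₀ this (sin_sq_le_norm_one_sub_mul_exp_sq x w)

theorem IsMixtureDensity.integral_Ioc (hφ : IsMixtureDensity φ) (u : ℝ → ℝ) :
    ∫ x in (-1 : ℝ)..1, φ x / u x = ∫ x, φ x / u x := by
  rw [intervalIntegral.integral_of_le (by norm_num), ← integral_Icc_eq_integral_Ioc]
  refine setIntegral_eq_integral_of_ae_compl_eq_zero ?_
  filter_upwards [hφ.support] with x hx hx'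
  rw [hx hx', zero_div]

/-- The kernel is at least `1/4` for `x` in `[-1, 1]`, and `φ` has mass `1`. -/
theorem aggregatedDensity_ge (hφ : IsMixtureDensity φ) {s : ℝ} (hs : 0 < s) {w : ℝ}
    (hw : Real.sin w ≠ 0) : s / (8 * Real.pi) ≤ aggregatedDensity φ s w := by
  have hpi := Real.pi_pos
  rw [aggregatedDensity, hφ.integral_Ioc]
  have h1 : ∫ x, φ x * (1 / 4) ≤
      ∫ x, φ x / ‖1 - (x : ℂ) * Complex.exp (Complex.I * w)‖ ^ 2 := by
    refine integral_mono_ae (hφ.integrable.mul_const _) (integrable_div_norm_sq hφ.integrable hw) ?_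
    filter_upwards [hφ.nonneg, hφ.support] with x h0 hx
    by_cases hxI : x ∈ Icc (-1 : ℝ) 1
    · have h2 := norm_one_sub_mul_exp_sq_le hxI w
      have h3 := sin_sq_le_norm_one_sub_mul_exp_sq x w
      have h4 : 0 < Real.sin w ^ 2 := by positivity
      rw [mul_one_div]
      exact div_le_div_of_nonneg_left h0 (by linarith) h2
    · rw [hx hxI]; simp
  rw [integral_mul_const, hφ.integral_eq_one] at h1
  calc s / (8 * Real.pi) = s / (2 * Real.pi) * (1 * (1 / 4)) := by field_simp; norm_num
    _ ≤ _ := by gcongr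

theorem aggregatedDensity_neg (s w : ℝ) :
    aggregatedDensity φ s (-w) = aggregatedDensity φ s w := by
  rw [aggregatedDensity, aggregatedDensity]
  simp_rw [norm_one_sub_mul_exp_sq, Real.cos_neg]

theorem ae_sin_ne_zero : ∀ᵐ w : ℝ ∂volume.restrict (Icc (-Real.pi) Real.pi), Real.sin w ≠ 0 := by
  refine ae_restrict_of_ae ?_
  have : {w : ℝ | ¬ Real.sin w ≠ 0} ⊆ range fun n : ℤ => (n : ℝ) * Real.pi := by
    intro w hw
    have hw' : Real.sin w = 0 := not_not.1 hw
    exact Real.sin_eq_zero_iff.1 hw'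
  exact measure_mono_null this ((countable_range _).measure_zero volume)

end MixtureDensity

/-! ### Positivity and evenness of `g` -/

section AssociatedAnalytic

variable {φ g : ℝ → ℝ}

theorem analyticAt_of_periodic (hper : Function.Periodic g (2 * Real.pi))
    (han : AnalyticOnNhd ℝ g (Icc (-Real.pi) Real.pi)) (w : ℝ) : AnalyticAt ℝ g w := by
  obtain ⟨n, hn⟩ : ∃ n : ℤ, w - n * (2 * Real.pi) ∈ Ico (-Real.pi) (-Real.pi + 2 * Real.pi) := by
    have := existsUnique_sub_zsmul_mem_Ico (by positivity : (0 : ℝ) < 2 * Real.pi) w (-Real.pi)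
    obtain ⟨n, hn, _⟩ := this
    exact ⟨n, by simpa using hn⟩
  have h1 := han _ ⟨hn.1, by linarith [hn.2]⟩
  have h2 : g = fun x => g (x - n * (2 * Real.pi)) := funext fun x => (hper.sub_int_mul_eq n).symm
  rw [h2]
  exact AnalyticAt.fun_comp (g := g) (f := fun x => x - n * (2 * Real.pi)) h1 (by fun_prop)

theorem exists_lower_bound_of_isAssociated (hper : Function.Periodic g (2 * Real.pi))
    (hg : Continuous g) (hφ : IsAssociated φ g) : ∃ m, 0 < m ∧ ∀ w, m ≤ g w := by
  obtain ⟨s, hs, hgs⟩ := hφ.exists_variance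
  have hpi := Real.pi_pos
  refine ⟨s / (8 * Real.pi), by positivity, ?_⟩
  -- The a.e. lower bound is phrased as an equality of two continuous functions, which then holds on
  -- the whole interval.
  have h1 : (fun w => max (s / (8 * Real.pi)) (g w)) =ᵐ[volume.restrict (Icc (-Real.pi) Real.pi)]
      g := by
    filter_upwards [hgs, ae_sin_ne_zero] with w hw hsin
    rw [hw]
    exact max_eq_right (aggregatedDensity_ge hφ.isMixtureDensity hs hsin)
  have h2 := Measure.eqOn_Icc_of_ae_eq volume (by linarith) h1
    (Continuous.continuousOn (by fun_prop)) hg.continuousOn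
  intro w
  obtain ⟨y, hy, hwy⟩ := hper.exists_mem_Ioc (by positivity) w (-Real.pi)
  rw [hwy]
  have := h2 ⟨hy.1.le, by linarith [hy.2]⟩
  exact max_eq_right_iff.1 this

theorem even_of_isAssociated (hper : Function.Periodic g (2 * Real.pi))
    (hg : Continuous g) (hφ : IsAssociated φ g) (w : ℝ) : g (-w) = g w := by
  obtain ⟨s, hs, hgs⟩ := hφ.exists_variance
  have hpi := Real.pi_pos
  have h0 := (ae_restrict_iff' measurableSet_Icc).1 hgs
  have h0' : ∀ᵐ w : ℝ, -w ∈ Icc (-Real.pi) Real.pi → g (-w) = aggregatedDensity φ s (-w) :=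
    (Measure.measurePreserving_neg (volume : Measure ℝ)).quasiMeasurePreserving.ae h0
  have h1 : (fun w => g (-w)) =ᵐ[volume.restrict (Icc (-Real.pi) Real.pi)] g := by
    refine (ae_restrict_iff' measurableSet_Icc).2 ?_
    filter_upwards [h0, h0'] with w h1 h2 hw
    rw [h1 hw, h2 ⟨by linarith [hw.2], by linarith [hw.1]⟩, aggregatedDensity_neg]
  have h2 := Measure.eqOn_Icc_of_ae_eq volume (by linarith) h1
    (Continuous.continuousOn (by fun_prop)) hg.continuousOn
  have hper' : Function.Periodic (fun w => g (-w) - g w) (2 * Real.pi) := by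
    intro x
    simp only [hper x, neg_add, ← sub_eq_add_neg, hper.sub_eq]
  obtain ⟨y, hy, hwy⟩ := hper'.exists_mem_Ioc (by positivity) w (-Real.pi)
  have h3 : g (-y) = g y := h2 ⟨hy.1.le, by linarith [hy.2]⟩
  simp only [h3, sub_self] at hwy
  linarith

end AssociatedAnalytic

/-! ### The logarithm of the spectral density -/

section LogSpectralDensity

variable {d : ℝ} {f g : ℝ → ℝ}

theorem ae_log_eq (hg0 : ∀ w, 0 < g w)
    (hf : f =ᵐ[volume.restrict (Icc (-Real.pi) Real.pi)] fun w => farimaDensity d w * g w) :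
    ∀ᵐ w, w ∈ uIoc (-Real.pi) Real.pi → Real.log (f w) = -Real.log (2 * Real.pi) +
      (-2 * d) * Real.log ‖1 - Complex.exp (Complex.I * w)‖ + Real.log (g w) := by
  have hpi := Real.pi_pos
  have hne0 : ∀ᵐ w : ℝ, w ≠ 0 := by simp [ae_iff]
  filter_upwards [(ae_restrict_iff' measurableSet_Icc).1 hf, hne0] with w hw hw0 hwI
  rw [uIoc_of_le (by linarith)] at hwI
  have hwI' := Ioc_subset_Icc_self hwI
  have hpos := norm_one_sub_exp_pos hwI' hw0
  rw [hw hwI', farimaDensity, ← norm_one_sub_exp_eq hwI',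
    Real.log_mul (by positivity) (hg0 w).ne', Real.log_mul (by positivity) (by positivity),
    Real.log_rpow hpos, one_div, Real.log_inv]

theorem intervalIntegrable_log (hg : Continuous g) (hg0 : ∀ w, 0 < g w)
    (hf : f =ᵐ[volume.restrict (Icc (-Real.pi) Real.pi)] fun w => farimaDensity d w * g w) :
    IntervalIntegrable (fun w => Real.log (f w)) volume (-Real.pi) Real.pi := by
  have h1 : IntervalIntegrable (fun w : ℝ => -Real.log (2 * Real.pi) +
      (-2 * d) * Real.log ‖1 - Complex.exp (Complex.I * w)‖ + Real.log (g w)) volume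
      (-Real.pi) Real.pi :=
    (intervalIntegrable_const.add (intervalIntegrable_log_norm_one_sub_exp.const_mul _)).add
      ((hg.log fun w => (hg0 w).ne').intervalIntegrable _ _)
  refine h1.congr_ae ?_
  refine (ae_restrict_iff' measurableSet_uIoc).2 ?_
  filter_upwards [ae_log_eq hg0 hf] with w hw hwI using (hw hwI).symm

/-- The constant `-log (2π)` has no `n`-th coefficient, and the FARIMA factor contributes `-2d · (-1
/ (2n)) = d / n`. -/
theorem cosCoeff_log (hg : Continuous g) (hg0 : ∀ w, 0 < g w)
    (hf : f =ᵐ[volume.restrict (Icc (-Real.pi) Real.pi)] fun w => farimaDensity d w * g w)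
    {n : ℕ} (hn : n ≠ 0) :
    cosCoeff (fun w => Real.log (f w)) n = d / n + cosCoeff (fun w => Real.log (g w)) n := by
  have h1 := intervalIntegrable_log_norm_one_sub_exp
  have h2 : IntervalIntegrable (fun w => Real.log (g w)) volume (-Real.pi) Real.pi :=
    (hg.log fun w => (hg0 w).ne').intervalIntegrable _ _
  have hcos : ContinuousOn (fun w : ℝ => Real.cos (n * w)) (uIcc (-Real.pi) Real.pi) := by
    fun_prop
  have h3 := cosCoeff_log_norm_one_sub_exp hn
  rw [cosCoeff] at h3 ⊢
  have h4 : ∫ w in (-Real.pi)..Real.pi, Real.cos (n * w) * Real.log (f w) =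
      ∫ w in (-Real.pi)..Real.pi, ((-Real.log (2 * Real.pi)) * Real.cos (n * w) +
        (-2 * d) * (Real.cos (n * w) * Real.log ‖1 - Complex.exp (Complex.I * w)‖) +
        Real.cos (n * w) * Real.log (g w)) := by
    refine intervalIntegral.integral_congr_ae ?_
    filter_upwards [ae_log_eq hg0 hf] with w hw hwI
    rw [hw hwI]; ring
  have hc := integral_cos_int_mul (m := n) (by exact_mod_cast hn)
  rw [Int.cast_natCast] at hc
  rw [h4, intervalIntegral.integral_add _ (h2.continuousOn_mul hcos),
    intervalIntegral.integral_add _ ((h1.continuousOn_mul hcos).const_mul _),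
    intervalIntegral.integral_const_mul, intervalIntegral.integral_const_mul, hc, cosCoeff]
  · have hn' : (n : ℝ) ≠ 0 := by exact_mod_cast hn
    rw [mul_zero, zero_add, mul_add, mul_left_comm, h3]
    field_simp
  · exact (hcos.intervalIntegrable).const_mul _
  · exact ((hcos.intervalIntegrable).const_mul _).add ((h1.continuousOn_mul hcos).const_mul _)

theorem integral_log_farima_mul (hg : Continuous g) (hg0 : ∀ w, 0 < g w)
    (hf : f =ᵐ[volume.restrict (Icc (-Real.pi) Real.pi)] fun w => farimaDensity d w * g w) :
    ∫ w in (-Real.pi)..Real.pi, Real.log (f w) = -(2 * Real.pi * Real.log (2 * Real.pi)) +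
      ∫ w in (-Real.pi)..Real.pi, Real.log (g w) := by
  have h1 := intervalIntegrable_log_norm_one_sub_exp
  rw [intervalIntegral.integral_congr_ae (ae_log_eq hg0 hf),
    intervalIntegral.integral_add (intervalIntegrable_const.add (h1.const_mul _))
      ((hg.log fun w => (hg0 w).ne').intervalIntegrable _ _),
    intervalIntegral.integral_add intervalIntegrable_const (h1.const_mul _),
    intervalIntegral.integral_const_mul, integral_log_norm_one_sub_exp,
    intervalIntegral.integral_const]
  simp only [smul_eq_mul]
  ring

/-- The mean of `log |1 - e^{iw}|` is zero, so the FARIMA factor enters only through `1 / (2π)`,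
which cancels the prefactor. -/
theorem innovationVariance_eq (hg : Continuous g) (hg0 : ∀ w, 0 < g w)
    (hf : f =ᵐ[volume.restrict (Icc (-Real.pi) Real.pi)] fun w => farimaDensity d w * g w) :
    innovationVariance f =
      Real.exp (1 / (2 * Real.pi) * ∫ w in (-Real.pi)..Real.pi, Real.log (g w)) := by
  have hpi := Real.pi_pos
  rw [innovationVariance, integral_log_farima_mul hg hg0 hf, mul_add, Real.exp_add]
  have : 1 / (2 * Real.pi) * -(2 * Real.pi * Real.log (2 * Real.pi)) =
      -Real.log (2 * Real.pi) := by field_simp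
  rw [this, Real.exp_neg, Real.exp_log (by positivity)]
  field_simp

end LogSpectralDensity

/-! ### The moving average representation -/

/-- The moving average representation of a Gaussian process whose spectral density is a FARIMA
density times a positive, even, periodic and smooth function. -/
theorem movingAverage_of_hasSpectralDensity {d : ℝ} (hd0 : 0 < d) (hd1 : d < 1 / 2) {f g : ℝ → ℝ}
    (hper : Function.Periodic g (2 * Real.pi)) (hg4 : ContDiff ℝ 4 g) (hg0 : ∀ w, 0 < g w)
    (hgeven : ∀ w, g (-w) = g w)
    (hf : f =ᵐ[volume.restrict (Icc (-Real.pi) Real.pi)] fun w => farimaDensity d w * g w)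
    {Ω : Type*} [MeasurableSpace Ω] (μ : Measure Ω) [IsProbabilityMeasure μ]
    (X : ℤ → Ω → ℝ) (hX : IsGaussianProcess X μ) (hmean : ∀ t, ∫ ω, X t ω ∂μ = 0)
    (hXf : HasSpectralDensity X μ f) :
    IntervalIntegrable (fun w => Real.log (f w)) volume (-Real.pi) Real.pi ∧
      innovationVariance f =
        Real.exp (1 / (2 * Real.pi) * ∫ w in (-Real.pi)..Real.pi, Real.log (g w)) ∧
      innovationVariance f = innovationVariance g / (2 * Real.pi) ∧
      (∃ Z : ℤ → Ω → ℝ, iIndepFun Z μ ∧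
        (∀ t, HasLaw (Z t) (gaussianReal 0 (innovationVariance f).toNNReal) μ) ∧
        IsInnovation X Z μ ∧
        IsLinearSequence X Z (maCoeff f) μ) ∧
      Summable (fun j => maCoeff f j ^ 2) ∧
      maCoeff f 0 = 1 ∧
      Summable (fun k => |maCoeff g k|) ∧
      ∑' k, maCoeff g k ≠ 0 ∧
      (maCoeff f ~[atTop]
        fun j : ℕ => (∑' k, maCoeff g k) / Real.Gamma d * (j : ℝ) ^ (d - 1)) ∧
      ((fun j : ℕ => |maCoeff f j - maCoeff f (j + 1)|) =O[atTop]
        fun j : ℕ => (j : ℝ) ^ (d - 2)) ∧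
      AssumptionA X μ d := by
  have hpi := Real.pi_pos
  have hgc : Continuous g := hg4.continuous
  have hint := intervalIntegrable_log hgc hg0 hf
  have hvar := innovationVariance_eq hgc hg0 hf
  set L : ℝ → ℝ := fun w => Real.log (g w) with hL
  have hL4 : ContDiff ℝ 4 L := hg4.log fun w => (hg0 w).ne'
  have hLper : Function.Periodic L (2 * Real.pi) := fun w => by simp only [hL, hper w]
  have hLeven : ∀ w, L (-w) = L w := fun w => by simp only [hL, hgeven]
  set l := cosCoeff L with hl
  have hls := summable_mul_cosCoeff hL4 hLper
  have hls' : Summable fun n : ℕ => (n : ℝ) * (n + 1) * |-l n| := by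
    simpa only [abs_neg] using hls
  have hlabs : Summable fun n => |l n| := by
    refine (summable_nat_add_iff 1).1 (Summable.of_nonneg_of_le (fun n => abs_nonneg _)
      (fun n => ?_) ((summable_nat_add_iff 1).2 hls))
    refine le_mul_of_one_le_left (abs_nonneg _) ?_
    push_cast
    nlinarith [(Nat.cast_nonneg n : (0 : ℝ) ≤ n)]
  have hlogg : IntervalIntegrable L volume (-Real.pi) Real.pi :=
    hL4.continuous.intervalIntegrable _ _
  have hmag : maCoeff g = expCoeff l :=
    maCoeff_eq_expCoeff hlogg (Eventually.of_forall fun w _ => hLeven w)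
  have hfeven : ∀ᵐ w, w ∈ uIoc (-Real.pi) Real.pi → Real.log (f (-w)) = Real.log (f w) := by
    have h0 := ae_log_eq hg0 hf
    have h0' := (Measure.measurePreserving_neg (volume : Measure ℝ)).quasiMeasurePreserving.ae h0
    -- Negation does not preserve the half-open interval `(-π, π]`; the endpoint is discarded.
    have hne : ∀ᵐ w : ℝ, w ≠ Real.pi := by simp [ae_iff]
    filter_upwards [h0, h0', hne] with w h1 h2 h3 hw
    have hw' : -w ∈ uIoc (-Real.pi) Real.pi := by
      rw [uIoc_of_le (by linarith)] at hw ⊢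
      exact ⟨neg_lt_neg (lt_of_le_of_ne hw.2 h3), by linarith [hw.1]⟩
    have hn : ‖1 - Complex.exp (Complex.I * ((-w : ℝ) : ℂ))‖ = ‖1 - Complex.exp (Complex.I * w)‖ := by
      rw [uIoc_of_le (by linarith)] at hw hw'
      rw [norm_one_sub_exp_eq (Ioc_subset_Icc_self hw'), norm_one_sub_exp_eq
        (Ioc_subset_Icc_self hw), abs_neg]
    rw [h1 hw, h2 hw', hn, hgeven]
  set c : ℕ → ℝ := fun n => d / n + l n with hc
  have hmaf : maCoeff f = expCoeff c := by
    rw [maCoeff_eq_expCoeff hint hfeven]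
    exact expCoeff_congr fun n => cosCoeff_log hgc hg0 hf n.succ_ne_zero
  have hgsq := summable_sq_mul_expCoeff hls
  have hgabs := summable_abs_of_summable_sq_mul hgsq
  have hgnabs := summable_abs_of_summable_sq_mul (summable_sq_mul_expCoeff hls')
  have hgne : ∑' k, expCoeff l k ≠ 0 := tsum_expCoeff_ne_zero hgabs hgnabs
  have hconvψ : ∀ j, expCoeff c j = ∑ i ∈ Finset.range (j + 1), expCoeff l i * powCoeff d (j - i) := by
    intro j
    have : c = fun n : ℕ => l n + d / n := funext fun n => add_comm _ _
    rw [this, expCoeff_add]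
    rfl
  have hK : (∑' k, expCoeff l k) / Real.Gamma d ≠ 0 :=
    div_ne_zero hgne (Real.Gamma_pos_of_pos hd0).ne'
  have hequiv : expCoeff c ~[atTop]
      fun j : ℕ => (∑' k, expCoeff l k) / Real.Gamma d * (j : ℝ) ^ (d - 1) := by
    refine isEquivalent_of_tendsto_mul_rpow hK ?_
    obtain ⟨C, _, hC⟩ := powCoeff_le hd0
    simp_rw [hconvψ]
    exact tendsto_convolution_mul_rpow hd0 (by linarith)
      (fun j => by rw [abs_of_nonneg (powCoeff_nonneg hd0.le j)]; exact hC j)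
      (tendsto_powCoeff hd0) hgsq
  have hdiff : (fun j : ℕ => |expCoeff c j - expCoeff c (j + 1)|) =O[atTop]
      fun j : ℕ => (j : ℝ) ^ (d - 2) := by
    obtain ⟨C, _, hC⟩ := abs_powCoeff_sub_le hd0 (by linarith)
    simp_rw [hconvψ]
    exact abs_convolution_sub_le hd0 (by linarith) hC hgsq
  have hsq : Summable fun j => expCoeff c j ^ 2 := summable_sq_of_isEquivalent hd1 hequiv
  have hcneg : (fun n => -c n) = fun n : ℕ => -d / n + -l n := by
    funext n; simp only [hc]; ring
  -- The reciprocal series is `(1 - z)^d` times the exponential belonging to `-l`, both with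
  -- absolutely summable coefficients.
  have hπ : Summable fun j => |expCoeff (fun n => -c n) j| := by
    rw [hcneg]
    simp_rw [expCoeff_add]
    exact summable_abs_convolution (summable_abs_powCoeff_neg hd0 (by linarith)) hgnabs
  have hvar' : innovationVariance f = Real.exp (l 0) := by
    rw [hvar, hl, cosCoeff]
    simp
  have hcov : ∀ s t, cov[X s, X t; μ] = innovationVariance f *
      ∑' k : ℕ, expCoeff c k * intExtend (expCoeff c) (t - s + k) := by
    intro s t
    have h1 := hXf.covariance s t
    have h2 := integral_exp_mul_eq_tsum (L := L) hd0 hlabs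
      (fun w => hasSum_cosCoeff_mul_cos hL4.continuous hLper hLeven hlabs w) hL4.continuous
      hXf.integrable ?_ hsq (t - s)
    · rw [← hvar'] at h2
      -- The lag is taken as `t - s` with a negative exponent, matching the sign convention of the
      -- Fourier coefficients.
      have h3 : ∫ w in (-Real.pi)..Real.pi,
          Complex.exp (Complex.I * ((s - t : ℤ) : ℂ) * w) * (f w : ℂ) =
          ∫ w in (-Real.pi)..Real.pi,
          Complex.exp (-(Complex.I * ((t - s : ℤ) : ℂ) * w)) * (f w : ℂ) := by
        refine intervalIntegral.integral_congr fun w _ => ?_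
        congr 2
        push_cast; ring
      rw [h3, h2] at h1
      exact_mod_cast h1
    · have hmem := ae_restrict_mem (μ := (volume : Measure ℝ))
        (measurableSet_Icc (a := -Real.pi) (b := Real.pi))
      filter_upwards [hf, hmem] with w hw hwI
      rw [hw, farimaDensity, norm_one_sub_exp_eq hwI, hL, Real.exp_log (hg0 w)]
  have hconv : ∀ j, ∑ i ∈ Finset.range (j + 1), expCoeff (fun n => -c n) i * expCoeff c (j - i) =
      if j = 0 then 1 else 0 := by
    intro j
    have := sum_expCoeff_mul_expCoeff_neg (fun n => -c n) j
    simpa only [neg_neg] using this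
  obtain ⟨Z, hZind, hZlaw, hZinn, hZlin⟩ := exists_gaussian_innovations hX hmean hcov hsq hπ hconv
    (expCoeff_zero _)
  refine ⟨hint, hvar, ?_, ⟨Z, hZind, hZlaw, hZinn, ?_⟩, ?_, ?_, ?_, ?_, ?_, ?_, ?_⟩
  · rw [hvar, innovationVariance]
    field_simp
    rfl
  · rw [hmaf]; exact hZlin
  · rw [hmaf]; exact hsq
  · rw [hmaf]; exact expCoeff_zero _
  · rw [hmag]; exact hgabs
  · rw [hmag]; exact hgne
  · rw [hmaf, hmag]; exact hequiv
  · rw [hmaf]; exact hdiff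
  · refine ⟨hd0, hd1, Z, expCoeff c, _, hZind, fun t => ?_, ?_, ?_, hZlin, hK, hequiv, hdiff⟩
    · exact ⟨(hZlaw t).aemeasurable, (hZlaw 0).aemeasurable,
        (hZlaw t).map_eq.trans (hZlaw 0).map_eq.symm⟩
    · rw [(hZlaw 0).integral_eq, integral_id_gaussianReal]
    · exact (hZlaw 0).hasGaussianLaw.memLp (by norm_num)

/-! ### Uniqueness of the mixture density -/

/-- Weierstrass approximation extends the vanishing from monomials to continuous functions, and
smooth test functions then detect `u` almost everywhere. -/
theorem ae_eq_zero_of_setIntegral_mul_pow_eq_zero {u : ℝ → ℝ} {a b : ℝ}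
    (hu : IntegrableOn u (Icc a b)) (h : ∀ n : ℕ, ∫ x in Icc a b, u x * x ^ n = 0) :
    u =ᵐ[volume.restrict (Icc a b)] 0 := by
  have hpoly : ∀ p : Polynomial ℝ, ∫ x in Icc a b, u x * p.eval x = 0 := by
    intro p
    simp_rw [Polynomial.eval_eq_sum_range, Finset.mul_sum]
    rw [integral_finsetSum]
    · refine Finset.sum_eq_zero fun i _ => ?_
      simp_rw [mul_left_comm (u _)]
      rw [integral_const_mul, h, mul_zero]
    · intro i _
      exact hu.mul_continuousOn (by fun_prop) isCompact_Icc
  have hcont : ∀ v : ℝ → ℝ, Continuous v → ∫ x in Icc a b, u x * v x = 0 := by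
    intro v hv
    set K := ∫ x in Icc a b, ‖u x‖ with hK
    have hK0 : 0 ≤ K := integral_nonneg fun _ => norm_nonneg _
    have key : ∀ ε : ℝ, 0 < ε → ‖∫ x in Icc a b, u x * v x‖ ≤ ε * K := by
      intro ε hε
      obtain ⟨p, hp⟩ := exists_polynomial_near_of_continuousOn a b v hv.continuousOn ε hε
      have h1 : ∫ x in Icc a b, u x * v x = ∫ x in Icc a b, u x * (v x - p.eval x) := by
        simp_rw [mul_sub]
        rw [integral_sub (hu.mul_continuousOn hv.continuousOn isCompact_Icc)
          (hu.mul_continuousOn (by fun_prop) isCompact_Icc), hpoly, sub_zero]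
      rw [h1, hK, ← integral_const_mul]
      refine norm_integral_le_of_norm_le (hu.norm.const_mul ε) ?_
      filter_upwards [ae_restrict_mem measurableSet_Icc] with x hx
      rw [norm_mul, mul_comm, Real.norm_eq_abs (v x - _), abs_sub_comm]
      gcongr
      exact (hp x hx).le
    have h2 : ‖∫ x in Icc a b, u x * v x‖ ≤ 0 := by
      refine le_of_forall_pos_le_add fun ε hε => ?_
      have := key (ε / (K + 1)) (by positivity)
      refine this.trans ?_
      rw [zero_add, div_mul_eq_mul_div, div_le_iff₀ (by positivity)]
      nlinarith
    exact norm_le_zero_iff.1 h2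
  have h3 : ∀ᵐ x, (Icc a b).indicator u x = 0 := by
    refine ae_eq_zero_of_integral_contDiff_smul_eq_zero (μ := volume)
      ((integrable_indicator_iff measurableSet_Icc).2 hu).locallyIntegrable fun v hv _ => ?_
    rw [← hcont v hv.continuous, ← integral_indicator measurableSet_Icc]
    refine integral_congr_ae (Eventually.of_forall fun x => ?_)
    by_cases hx : x ∈ Icc a b <;> simp [hx, mul_comm]
  filter_upwards [ae_restrict_of_ae h3, ae_restrict_mem measurableSet_Icc] with x hx hxI
  simpa [hxI] using hx

theorem one_sub_ofReal_mul_exp_ne_zero {x : ℝ} (hx : |x| < 1) (w : ℝ) :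
    1 - (x : ℂ) * Complex.exp (Complex.I * w) ≠ 0 := by
  intro h
  have h1 : ‖(x : ℂ) * Complex.exp (Complex.I * w)‖ = 1 := by
    rw [← sub_eq_zero.1 h, norm_one]
  rw [norm_mul, norm_exp_I_mul, mul_one, Complex.norm_real, Real.norm_eq_abs] at h1
  exact hx.ne h1

theorem continuous_inv_norm_one_sub_mul_exp_sq {x : ℝ} (hx : |x| < 1) :
    Continuous fun w : ℝ => (‖1 - (x : ℂ) * Complex.exp (Complex.I * w)‖ ^ 2)⁻¹ :=
  Continuous.inv₀ (by fun_prop) fun w =>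
    pow_ne_zero 2 (norm_ne_zero_iff.2 (one_sub_ofReal_mul_exp_ne_zero hx w))

/-- Parseval for `(1 - x e^{iw})⁻¹ = ∑ x^k e^{ikw}` gives `2π ∑ x^k x^{n+k}`, the autocovariance of
an AR(1) process. -/
theorem integral_cos_mul_inv_norm_sq {x : ℝ} (hx : |x| < 1) (n : ℕ) :
    ∫ w in (-Real.pi)..Real.pi,
      Real.cos (n * w) * (‖1 - (x : ℂ) * Complex.exp (Complex.I * w)‖ ^ 2)⁻¹ =
      2 * Real.pi * (x ^ n / (1 - x ^ 2)) := by
  have hF : ∀ w : ℝ, HasSum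
      (fun k : ℕ => ((x ^ k : ℝ) : ℂ) * Complex.exp (Complex.I * k * w))
      (1 - (x : ℂ) * Complex.exp (Complex.I * w))⁻¹ := by
    intro w
    have : ‖(x : ℂ) * Complex.exp (Complex.I * w)‖ < 1 := by
      rwa [norm_mul, norm_exp_I_mul, mul_one, Complex.norm_real]
    refine (hasSum_geometric_of_norm_lt_one this).congr_fun fun k => ?_
    rw [mul_pow, ← Complex.exp_nat_mul, Complex.ofReal_pow]
    congr 2
    ring
  have h1 := hasSum_integral_exp_mul_normSq (a := fun k => x ^ k)
    (by simpa only [abs_pow] using summable_geometric_of_lt_one (abs_nonneg x) hx) hF n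
  have hx2 : |x ^ 2| < 1 := by
    rw [abs_pow]; exact pow_lt_one₀ (abs_nonneg x) hx two_ne_zero
  have h2 := (((hasSum_geometric_of_abs_lt_one hx2).mul_left (2 * Real.pi * x ^ n)))
  have h3 := h1.unique ((Complex.hasSum_ofReal.2 h2).congr_fun fun k => by
    rw [← Nat.cast_add, intExtend_natCast]
    push_cast
    ring)
  have h4 := congrArg Complex.re h3
  rw [Complex.ofReal_re] at h4
  rw [div_eq_mul_inv, ← mul_assoc, ← h4]
  have h5 : IntervalIntegrable (fun w : ℝ => Complex.exp (-(Complex.I * ((n : ℤ) : ℂ) * w)) *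
      ((‖(1 - (x : ℂ) * Complex.exp (Complex.I * w))⁻¹‖ ^ 2 : ℝ) : ℂ)) volume
      (-Real.pi) Real.pi := by
    refine Continuous.intervalIntegrable ?_ _ _
    simp_rw [norm_inv, inv_pow]
    exact Continuous.mul (by fun_prop)
      (Complex.continuous_ofReal.comp (continuous_inv_norm_one_sub_mul_exp_sq hx))
  have h6 := Complex.reCLM.intervalIntegral_comp_comm h5
  simp only [Complex.reCLM_apply] at h6
  rw [← h6]
  refine intervalIntegral.integral_congr fun w _ => ?_
  rw [Complex.re_mul_ofReal, norm_inv, inv_pow]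
  congr 1
  rw [show -(Complex.I * ((n : ℤ) : ℂ) * (w : ℂ)) = ((-(n * w) : ℝ) : ℂ) * Complex.I by
    push_cast; ring, Complex.exp_ofReal_mul_I_re, Real.cos_neg]

section Moments

variable {φ : ℝ → ℝ}

theorem IsMixtureDensity.ae_abs_lt_one_or (hφ : IsMixtureDensity φ) :
    ∀ᵐ x, |x| < 1 ∨ φ x = 0 := by
  filter_upwards [hφ.support, Measure.ae_ne volume (1 : ℝ), Measure.ae_ne volume (-1 : ℝ)]
    with x hx h1 h2
  by_cases hxI : x ∈ Icc (-1 : ℝ) 1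
  · exact Or.inl (abs_lt.2 ⟨lt_of_le_of_ne hxI.1 (Ne.symm h2), lt_of_le_of_ne hxI.2 h1⟩)
  · exact Or.inr (hx hxI)

theorem IsMixtureDensity.integrable_div_one_sub_sq (hφ : IsMixtureDensity φ) :
    Integrable fun x => φ x / (1 - x ^ 2) := by
  refine hφ.integrable_div.integrable_of_ae_notMem_eq_zero ?_
  filter_upwards [hφ.support] with x hx hxI
  rw [hx hxI, zero_div]

/-- Integrating out `w` leaves `2π φ(x) / (1 - x²)`, so the integrability condition on mixture
densities is exactly what Tonelli needs. -/
theorem IsMixtureDensity.integrable_prod (hφ : IsMixtureDensity φ) :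
    Integrable (fun p : ℝ × ℝ =>
      φ p.1 * (‖1 - (p.1 : ℂ) * Complex.exp (Complex.I * p.2)‖ ^ 2)⁻¹)
      (volume.prod (volume.restrict (Ioc (-Real.pi) Real.pi))) := by
  have hpi : -Real.pi ≤ Real.pi := by linarith [Real.pi_pos]
  refine (integrable_prod_iff ?_).2 ⟨?_, ?_⟩
  · refine AEStronglyMeasurable.mul hφ.integrable.aestronglyMeasurable.comp_fst ?_
    exact Measurable.aestronglyMeasurable (by fun_prop)
  · filter_upwards [hφ.ae_abs_lt_one_or] with x hx
    rcases hx with hx | hx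
    · exact ((continuous_inv_norm_one_sub_mul_exp_sq hx).integrableOn_Ioc).const_mul _
    · simp [hx]
  · refine ((hφ.integrable_div_one_sub_sq.norm).const_mul (2 * Real.pi)).congr ?_
    filter_upwards [hφ.ae_abs_lt_one_or] with x hx
    rcases hx with hx | hx
    · have h0 : 0 < 1 - x ^ 2 := by nlinarith [abs_lt.1 hx]
      have h1 := integral_cos_mul_inv_norm_sq hx 0
      simp only [Nat.cast_zero, zero_mul, Real.cos_zero, one_mul, pow_zero] at h1
      rw [intervalIntegral.integral_of_le hpi] at h1
      simp_rw [norm_mul, norm_inv, norm_pow, norm_norm]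
      rw [integral_const_mul, h1, norm_div, Real.norm_of_nonneg h0.le]
      ring
    · simp [hx]

theorem IsMixtureDensity.integral_cos_mul_aggregatedDensity (hφ : IsMixtureDensity φ)
    (s : ℝ) (n : ℕ) :
    ∫ w in (-Real.pi)..Real.pi, Real.cos (n * w) * aggregatedDensity φ s w =
      s * ∫ x, φ x / (1 - x ^ 2) * x ^ n := by
  have hpi : -Real.pi ≤ Real.pi := by linarith [Real.pi_pos]
  have hint : Integrable (fun p : ℝ × ℝ => Real.cos (n * p.2) *
      (φ p.1 * (‖1 - (p.1 : ℂ) * Complex.exp (Complex.I * p.2)‖ ^ 2)⁻¹))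
      (volume.prod (volume.restrict (Ioc (-Real.pi) Real.pi))) := by
    refine hφ.integrable_prod.bdd_mul (c := 1) ?_ (Eventually.of_forall fun p => ?_)
    · exact Measurable.aestronglyMeasurable (by fun_prop)
    · exact Real.abs_cos_le_one _
  simp_rw [aggregatedDensity, hφ.integral_Ioc]
  rw [intervalIntegral.integral_of_le hpi]
  simp_rw [mul_left_comm (Real.cos _)]
  rw [integral_const_mul]
  simp_rw [← integral_const_mul (Real.cos _), div_eq_mul_inv (φ _)]
  rw [← integral_integral_swap hint]
  have h1 : ∀ᵐ x, ∫ w in Ioc (-Real.pi) Real.pi, Real.cos (n * w) *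
      (φ x * (‖1 - (x : ℂ) * Complex.exp (Complex.I * w)‖ ^ 2)⁻¹) =
      2 * Real.pi * (φ x * (1 - x ^ 2)⁻¹ * x ^ n) := by
    filter_upwards [hφ.ae_abs_lt_one_or] with x hx
    rcases hx with hx | hx
    · simp_rw [mul_left_comm (Real.cos _)]
      rw [integral_const_mul, ← intervalIntegral.integral_of_le hpi,
        integral_cos_mul_inv_norm_sq hx]
      ring
    · simp [hx]
  rw [integral_congr_ae h1, integral_const_mul]
  have := Real.pi_pos
  field_simp

/-- The cosine coefficients are the moments of `s φ(x) / (1 - x²)` on a compact interval, so they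
determine `s φ`; total mass `1` then separates `s` from `φ`. -/
theorem ae_eq_of_aggregatedDensity_ae_eq {φ₁ φ₂ : ℝ → ℝ} (h₁ : IsMixtureDensity φ₁)
    (h₂ : IsMixtureDensity φ₂) {s₁ s₂ : ℝ} (hs₁ : 0 < s₁)
    (h : aggregatedDensity φ₁ s₁ =ᵐ[volume.restrict (Icc (-Real.pi) Real.pi)]
      aggregatedDensity φ₂ s₂) : φ₁ =ᵐ[volume] φ₂ := by
  have hpi : -Real.pi ≤ Real.pi := by linarith [Real.pi_pos]
  have hmom : ∀ n : ℕ, s₁ * ∫ x, φ₁ x / (1 - x ^ 2) * x ^ n =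
      s₂ * ∫ x, φ₂ x / (1 - x ^ 2) * x ^ n := by
    intro n
    rw [← h₁.integral_cos_mul_aggregatedDensity, ← h₂.integral_cos_mul_aggregatedDensity,
      intervalIntegral.integral_of_le hpi, intervalIntegral.integral_of_le hpi,
      ← integral_Icc_eq_integral_Ioc, ← integral_Icc_eq_integral_Ioc]
    refine integral_congr_ae ?_
    filter_upwards [h] with w hw
    rw [hw]
  have hset : ∀ φ : ℝ → ℝ, IsMixtureDensity φ → ∀ n : ℕ, ∫ x, φ x / (1 - x ^ 2) * x ^ n =
      ∫ x in Icc (-1 : ℝ) 1, φ x / (1 - x ^ 2) * x ^ n := by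
    intro φ hφ n
    refine (setIntegral_eq_integral_of_ae_compl_eq_zero ?_).symm
    filter_upwards [hφ.support] with x hx hxI
    rw [hx hxI, zero_div, zero_mul]
  have h3 := ae_eq_zero_of_setIntegral_mul_pow_eq_zero (a := -1) (b := 1)
    (u := fun x => s₁ * (φ₁ x / (1 - x ^ 2)) - s₂ * (φ₂ x / (1 - x ^ 2)))
    (by exact (h₁.integrable_div.const_mul s₁).sub (h₂.integrable_div.const_mul s₂)) fun n => by
      simp_rw [sub_mul, mul_assoc]
      rw [integral_sub, integral_const_mul, integral_const_mul, ← hset _ h₁, ← hset _ h₂, hmom,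
        sub_self]
      · exact (h₁.integrable_div.mul_continuousOn (by fun_prop) isCompact_Icc).const_mul s₁
      · exact (h₂.integrable_div.mul_continuousOn (by fun_prop) isCompact_Icc).const_mul s₂
  have h4 : ∀ᵐ x, s₁ * φ₁ x = s₂ * φ₂ x := by
    filter_upwards [(ae_restrict_iff' measurableSet_Icc).1 h3, h₁.support, h₂.support,
      Measure.ae_ne volume (1 : ℝ), Measure.ae_ne volume (-1 : ℝ)] with x hx hx1 hx2 h5 h6
    by_cases hxI : x ∈ Icc (-1 : ℝ) 1
    · have h7 := hx hxI
      have h8 : 1 - x ^ 2 ≠ 0 := by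
        intro h9
        rcases mul_eq_zero.1 (show (1 - x) * (1 + x) = 0 by linarith) with h | h
        · exact h5 (by linarith)
        · exact h6 (by linarith)
      simp only [Pi.zero_apply] at h7
      field_simp at h7
      linarith
    · rw [hx1 hxI, hx2 hxI, mul_zero, mul_zero]
  have h5 : s₁ = s₂ := by
    have := integral_congr_ae h4
    rwa [integral_const_mul, integral_const_mul, h₁.integral_eq_one, h₂.integral_eq_one,
      mul_one, mul_one] at this
  filter_upwards [h4] with x hx
  rw [← h5] at hx
  exact mul_left_cancel₀ hs₁.ne' hx

end Moments

/-! ### The FARIMA mixture -/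

/-- The unnormalized mixture density associated with the FARIMA(0, d, 0) spectral density. -/
def farimaMixing (d : ℝ) : ℝ → ℝ :=
  (Ioo (0 : ℝ) 1).indicator fun x => x ^ (d - 1) * (1 - x) ^ (1 - 2 * d) * (1 + x)

theorem farimaMixing_of_mem {d x : ℝ} (hx : x ∈ Ioo (0 : ℝ) 1) :
    farimaMixing d x = x ^ (d - 1) * (1 - x) ^ (1 - 2 * d) * (1 + x) := indicator_of_mem hx _

theorem farimaMixing_of_notMem {d x : ℝ} (hx : x ∉ Ioo (0 : ℝ) 1) : farimaMixing d x = 0 :=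
  indicator_of_notMem hx _

theorem farimaMixing_pos {d x : ℝ} (hx : x ∈ Ioo (0 : ℝ) 1) : 0 < farimaMixing d x := by
  rw [farimaMixing_of_mem hx]
  have h0 := hx.1
  have h1 : 0 < 1 - x := sub_pos.2 hx.2
  positivity

theorem farimaMixing_nonneg (d x : ℝ) : 0 ≤ farimaMixing d x := by
  by_cases hx : x ∈ Ioo (0 : ℝ) 1
  · exact (farimaMixing_pos hx).le
  · exact (farimaMixing_of_notMem hx).ge

theorem integrableOn_rpow_mul_one_sub_rpow {a b : ℝ} (ha : 0 < a) (hb : 0 < b) :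
    IntegrableOn (fun x : ℝ => x ^ (a - 1) * (1 - x) ^ (b - 1)) (Ioo 0 1) := by
  have h := Complex.betaIntegral_convergent (u := a) (v := b) (by simpa) (by simpa)
  rw [intervalIntegrable_iff_integrableOn_Ioo_of_le zero_le_one] at h
  refine (Integrable.re h).congr ?_
  filter_upwards [ae_restrict_mem measurableSet_Ioo] with x hx
  have h1 : (x : ℂ) ^ ((a : ℂ) - 1) * (1 - (x : ℂ)) ^ ((b : ℂ) - 1) =
      ((x ^ (a - 1) * (1 - x) ^ (b - 1) : ℝ) : ℂ) := by
    rw [Complex.ofReal_mul, Complex.ofReal_cpow hx.1.le,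
      Complex.ofReal_cpow (sub_nonneg.2 hx.2.le)]
    push_cast
    rfl
  rw [h1]
  exact Complex.ofReal_re _

theorem integrable_farimaMixing_div {d : ℝ} (hd0 : 0 < d) (hd1 : d < 1 / 2) :
    Integrable fun x => farimaMixing d x * (1 - x ^ 2)⁻¹ := by
  have h := integrableOn_rpow_mul_one_sub_rpow hd0 (show 0 < 1 - 2 * d by linarith)
  rw [← integrable_indicator_iff measurableSet_Ioo] at h
  refine h.congr (Eventually.of_forall fun x => ?_)
  by_cases hx : x ∈ Ioo (0 : ℝ) 1
  · simp only [indicator_of_mem hx, farimaMixing_of_mem hx]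
    have h1 : 0 < 1 - x := sub_pos.2 hx.2
    have h2 : 0 < 1 + x := by linarith [hx.1]
    rw [Real.rpow_sub_one h1.ne', show 1 - x ^ 2 = (1 - x) * (1 + x) by ring]
    field_simp
  · simp only [indicator_of_notMem hx, farimaMixing_of_notMem hx, zero_mul]

theorem integrable_farimaMixing {d : ℝ} (hd0 : 0 < d) (hd1 : d < 1 / 2) :
    Integrable (farimaMixing d) := by
  refine ((integrable_farimaMixing_div hd0 hd1).bdd_mul (c := 1)
    (f := fun x => (Ioo (0 : ℝ) 1).indicator (fun x => 1 - x ^ 2) x)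
    ((Measurable.indicator (by fun_prop) measurableSet_Ioo).aestronglyMeasurable)
    (Eventually.of_forall fun x => ?_)).congr (Eventually.of_forall fun x => ?_)
  · by_cases hx : x ∈ Ioo (0 : ℝ) 1
    · rw [indicator_of_mem hx, Real.norm_eq_abs, abs_le]
      constructor <;> nlinarith [hx.1, hx.2]
    · simp [indicator_of_notMem hx]
  · by_cases hx : x ∈ Ioo (0 : ℝ) 1
    · simp only [indicator_of_mem hx]
      have : 1 - x ^ 2 ≠ 0 := by nlinarith [hx.1, hx.2]
      field_simp
    · simp only [farimaMixing_of_notMem hx, zero_mul, mul_zero]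

theorem image_one_sub_sq_div : (fun x : ℝ => (1 - x) ^ 2 / x) '' Ioo 0 1 = Ioi 0 := by
  ext v
  constructor
  · rintro ⟨x, hx, rfl⟩
    have h0 := hx.1
    have h1 : 0 < 1 - x := sub_pos.2 hx.2
    exact div_pos (by positivity) h0
  · intro hv
    have hv' : 0 < v := hv
    have hc : ContinuousOn (fun x : ℝ => (1 - x) ^ 2 - v * x) (Icc 0 1) := by fun_prop
    obtain ⟨x, hx, hxv⟩ := intermediate_value_Ioo' zero_le_one hc
      (show (0 : ℝ) ∈ Ioo _ _ by refine ⟨?_, ?_⟩ <;> norm_num; exact hv')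
    refine ⟨x, hx, ?_⟩
    have h0 := hx.1
    simp only at hxv ⊢
    rw [div_eq_iff h0.ne']
    linarith

theorem injOn_one_sub_sq_div : InjOn (fun x : ℝ => (1 - x) ^ 2 / x) (Ioo 0 1) := by
  intro x hx y hy h
  have hx0 := hx.1
  have hy0 := hy.1
  simp only at h
  rw [div_eq_div_iff hx0.ne' hy0.ne'] at h
  have h1 : (x - y) * (1 - x * y) = 0 := by linarith
  have h2 : 1 - x * y ≠ 0 := by nlinarith [hx.2, hy.2]
  exact sub_eq_zero.1 ((mul_eq_zero.1 h1).resolve_right h2)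

/-- Substitute `v = (1 - x)² / x`, a bijection from `(0, 1)` to `(0, ∞)` for which `|1 - x e^{iw}|²
= x (v + 2 - 2 cos w)`. The weight is the Jacobian times powers chosen to leave `v^{-d}`; scaling
`v` then extracts `(2 - 2 cos w)^{-d}`. -/
theorem integral_farimaMixing_eq_integral_Ioi (d w : ℝ) :
    ∫ x, farimaMixing d x * (‖1 - (x : ℂ) * Complex.exp (Complex.I * w)‖ ^ 2)⁻¹ =
      ∫ v in Ioi (0 : ℝ), v ^ (-d) / (v + (2 - 2 * Real.cos w)) := by
  have hderiv : ∀ x ∈ Ioo (0 : ℝ) 1, HasDerivWithinAt (fun x : ℝ => (1 - x) ^ 2 / x)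
      (-(1 - x ^ 2) / x ^ 2) (Ioo 0 1) x := by
    intro x hx
    have h1 : HasDerivAt (fun x : ℝ => (1 - x) ^ 2 / x) _ x :=
      ((((hasDerivAt_id x).const_sub 1).pow 2).div (hasDerivAt_id x) hx.1.ne')
    refine (h1.congr_deriv ?_).hasDerivWithinAt
    simp only [id, Pi.pow_apply]
    have := hx.1
    field_simp
    ring
  rw [← image_one_sub_sq_div, integral_image_eq_integral_abs_deriv_smul measurableSet_Ioo hderiv
    injOn_one_sub_sq_div, ← integral_indicator measurableSet_Ioo]
  congr 1
  ext x
  by_cases hx : x ∈ Ioo (0 : ℝ) 1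
  · rw [indicator_of_mem hx, farimaMixing_of_mem hx, norm_one_sub_mul_exp_sq]
    have h0 := hx.1
    have h1 : 0 < 1 - x := sub_pos.2 hx.2
    have h2 : 0 < 1 - x ^ 2 := by nlinarith
    have h3 : 0 < 1 + x ^ 2 - 2 * x * Real.cos w := by
      nlinarith [Real.cos_le_one w]
    rw [neg_div, abs_neg, abs_of_pos (by positivity), smul_eq_mul, Real.div_rpow (by positivity)
      h0.le, ← Real.rpow_natCast (1 - x), ← Real.rpow_mul h1.le, Real.rpow_neg h0.le,
      Real.rpow_sub_one h0.ne', show (1 - 2 * d) = ((2 : ℕ) : ℝ) * -d + 1 by push_cast; ring,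
      Real.rpow_add_one h1.ne']
    have h4 : (1 - x) ^ ((2 : ℕ) : ℝ) / x + (2 - 2 * Real.cos w) =
        (1 + x ^ 2 - 2 * x * Real.cos w) / x := by
      rw [Real.rpow_natCast]
      field_simp
      ring
    rw [h4]
    have h5 : 0 < x ^ d := by positivity
    field_simp
    ring
  · rw [indicator_of_notMem hx, farimaMixing_of_notMem hx, zero_mul]

theorem integral_Ioi_rpow_div_add (d : ℝ) {c : ℝ} (hc : 0 < c) :
    ∫ v in Ioi (0 : ℝ), v ^ (-d) / (v + c) =
      c ^ (-d) * ∫ v in Ioi (0 : ℝ), v ^ (-d) / (v + 1) := by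
  have h := integral_comp_mul_left_Ioi' (fun v : ℝ => v ^ (-d) / (v + c)) 0 hc
  rw [mul_zero] at h
  rw [← h, smul_eq_mul, ← integral_const_mul, ← integral_const_mul]
  refine setIntegral_congr_fun measurableSet_Ioi fun v hv => ?_
  have hv' : 0 < v := hv
  rw [Real.mul_rpow hc.le hv'.le]
  have : c * v + c = c * (v + 1) := by ring
  rw [this]
  field_simp

theorem integral_farimaMixing_div_norm_sq (d : ℝ) {w : ℝ} (hw : Real.sin w ≠ 0) :
    ∫ x, farimaMixing d x * (‖1 - (x : ℂ) * Complex.exp (Complex.I * w)‖ ^ 2)⁻¹ =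
      (2 - 2 * Real.cos w) ^ (-d) * ∫ v in Ioi (0 : ℝ), v ^ (-d) / (v + 1) := by
  have h : Real.cos w < 1 := by
    refine lt_of_le_of_ne (Real.cos_le_one w) fun h => hw ?_
    have := Real.sin_sq_add_cos_sq w
    rw [h] at this
    exact pow_eq_zero_iff two_ne_zero |>.1 (by linarith)
  rw [integral_farimaMixing_eq_integral_Ioi, integral_Ioi_rpow_div_add d (by linarith)]

theorem integrable_farimaMixing_mul_inv_norm_sq {d : ℝ} (hd0 : 0 < d) (hd1 : d < 1 / 2) {w : ℝ}
    (hw : Real.sin w ≠ 0) : Integrable fun x =>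
      farimaMixing d x * (‖1 - (x : ℂ) * Complex.exp (Complex.I * w)‖ ^ 2)⁻¹ := by
  simpa only [div_eq_mul_inv] using integrable_div_norm_sq (integrable_farimaMixing hd0 hd1) hw

theorem integral_Ioi_rpow_div_add_one_pos {d : ℝ} (hd0 : 0 < d) (hd1 : d < 1 / 2) :
    0 < ∫ v in Ioi (0 : ℝ), v ^ (-d) / (v + 1) := by
  -- Reading the mixture formula at `w = π / 2` transfers positivity from the `x` side, where
  -- integrability is already known.
  have hw : Real.sin (Real.pi / 2) ≠ 0 := by simp
  have h1 := integral_farimaMixing_div_norm_sq d hw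
  have h2 : 0 < ∫ x, farimaMixing d x *
      (‖1 - (x : ℂ) * Complex.exp (Complex.I * (Real.pi / 2 : ℝ))‖ ^ 2)⁻¹ := by
    rw [integral_pos_iff_support_of_nonneg]
    · refine lt_of_lt_of_le ?_ (measure_mono (s := Ioo (0 : ℝ) 1) fun x hx => ?_)
      · simp
      · refine (mul_pos (farimaMixing_pos hx) (inv_pos.2 ?_)).ne'
        refine lt_of_lt_of_le ?_ (sin_sq_le_norm_one_sub_mul_exp_sq x (Real.pi / 2))
        positivity
    · exact fun x => mul_nonneg (farimaMixing_nonneg d x) (by positivity)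
    · exact integrable_farimaMixing_mul_inv_norm_sq hd0 hd1 hw
  rw [h1] at h2
  exact pos_of_mul_pos_right h2 (by simp; positivity)

theorem farimaDensity_eq (d : ℝ) {w : ℝ} (hw : w ∈ Icc (-Real.pi) Real.pi) :
    farimaDensity d w = 1 / (2 * Real.pi) * (2 - 2 * Real.cos w) ^ (-d) := by
  have h1 : 2 - 2 * Real.cos w = (2 * Real.sin (|w| / 2)) ^ 2 := by
    rw [← Real.cos_abs w, show |w| = 2 * (|w| / 2) by ring, Real.cos_two_mul,
      show 2 * (|w| / 2) / 2 = |w| / 2 by ring]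
    nlinarith [Real.sin_sq_add_cos_sq (|w| / 2)]
  have h2 : 0 ≤ Real.sin (|w| / 2) :=
    Real.sin_nonneg_of_nonneg_of_le_pi (by positivity) (by
      linarith [abs_le.2 hw, Real.pi_pos])
  rw [farimaDensity, h1, ← Real.rpow_natCast, ← Real.rpow_mul (by positivity)]
  congr 2
  push_cast
  ring

/-! ### Products of spectral densities by partial fractions -/

section ProductMixing

variable {A B : ℝ → ℝ}

/-- For `A` supported in `(0, 1)` and `B` supported in `(-1, 0)`, the unnormalized mixture density
of the product of the aggregated spectral densities of `A` and `B`. -/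
def productMixing (A B : ℝ → ℝ) (x : ℝ) : ℝ :=
  A x * (∫ y, B y * (x / ((x - y) * (1 - x * y)))) +
    B x * ∫ y, A y * (-x / ((y - x) * (1 - y * x)))

theorem sub_mul_one_sub_mul_pos {x y : ℝ} (hx : 0 < x) (hy : y < 0) :
    0 < (x - y) * (1 - x * y) :=
  mul_pos (by linarith) (by nlinarith)

/-- With `x > 0 > y` every term of `(x - y)(1 - xy) = x - y - x²y + xy²` is nonnegative. The
opposite signs keep the partial fraction coefficients nonnegative and away from their pole at `x =
y`. -/
theorem partialFraction_left_mem {x y : ℝ} (hx : 0 < x) (hy : y < 0) :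
    x / ((x - y) * (1 - x * y)) ∈ Icc (0 : ℝ) 1 := by
  have h := sub_mul_one_sub_mul_pos hx hy
  refine ⟨by positivity, (div_le_one h).2 ?_⟩
  nlinarith [mul_pos hx hx, mul_pos hx (neg_pos.2 hy), mul_pos (mul_pos hx hx) (neg_pos.2 hy),
    mul_nonneg hx.le (sq_nonneg y)]

theorem partialFraction_right_mem {x y : ℝ} (hx : 0 < x) (hy : y < 0) :
    -y / ((x - y) * (1 - x * y)) ∈ Icc (0 : ℝ) 1 := by
  have h := sub_mul_one_sub_mul_pos hx hy
  have hy' : 0 < -y := neg_pos.2 hy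
  refine ⟨by positivity, (div_le_one h).2 ?_⟩
  nlinarith [mul_pos hx hx, mul_pos hx (neg_pos.2 hy), mul_pos (mul_pos hx hx) (neg_pos.2 hy),
    mul_nonneg hx.le (sq_nonneg y)]

theorem productMixing_nonneg (hA0 : ∀ x, 0 ≤ A x) (hB0 : ∀ x, 0 ≤ B x)
    (hA : ∀ x, x ∉ Ioo (0 : ℝ) 1 → A x = 0) (hB : ∀ x, x ∉ Ioo (-1 : ℝ) 0 → B x = 0) (x : ℝ) :
    0 ≤ productMixing A B x := by
  refine add_nonneg ?_ ?_
  · by_cases hx : x ∈ Ioo (0 : ℝ) 1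
    · refine mul_nonneg (hA0 x) (integral_nonneg fun y => ?_)
      by_cases hy : y ∈ Ioo (-1 : ℝ) 0
      · exact mul_nonneg (hB0 y) (partialFraction_left_mem hx.1 hy.2).1
      · simp [hB y hy]
    · simp [hA x hx]
  · by_cases hx : x ∈ Ioo (-1 : ℝ) 0
    · refine mul_nonneg (hB0 x) (integral_nonneg fun y => ?_)
      by_cases hy : y ∈ Ioo (0 : ℝ) 1
      · exact mul_nonneg (hA0 y) (partialFraction_right_mem hy.1 hx.2).1
      · simp [hA y hy]
    · simp [hB x hx]

/-- This is Fubini for a general test function `ρ`: with `ρ = 1` it yields the total mass, with `(1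
- x²)⁻¹` the mixture condition, and with the AR(1) kernel the spectral density. -/
theorem integrable_productMixing_mul
    (hA : ∀ x, x ∉ Ioo (0 : ℝ) 1 → A x = 0) (hB : ∀ x, x ∉ Ioo (-1 : ℝ) 0 → B x = 0)
    (hAi : Integrable A) (hBi : Integrable B) {ρ : ℝ → ℝ}
    (hAρ : Integrable fun x => A x * ρ x) (hBρ : Integrable fun x => B x * ρ x) :
    Integrable (fun x => productMixing A B x * ρ x) ∧
      ∫ x, productMixing A B x * ρ x = ∫ p : ℝ × ℝ, A p.1 * B p.2 *
        (p.1 / ((p.1 - p.2) * (1 - p.1 * p.2)) * ρ p.1 +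
          -p.2 / ((p.1 - p.2) * (1 - p.1 * p.2)) * ρ p.2) ∂(volume.prod volume) := by
  have h1 : Integrable (fun p : ℝ × ℝ => A p.1 * ρ p.1 *
      (B p.2 * (p.1 / ((p.1 - p.2) * (1 - p.1 * p.2))))) (volume.prod volume) := by
    refine (hAρ.mul_prod hBi).mono ?_ (Eventually.of_forall fun p => ?_)
    · exact hAρ.aestronglyMeasurable.comp_fst.mul (hBi.aestronglyMeasurable.comp_snd.mul
        (Measurable.aestronglyMeasurable (by fun_prop)))
    · by_cases hx : p.1 ∈ Ioo (0 : ℝ) 1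
      · by_cases hy : p.2 ∈ Ioo (-1 : ℝ) 0
        · have := partialFraction_left_mem hx.1 hy.2
          rw [← mul_assoc, norm_mul]
          refine mul_le_of_le_one_right (norm_nonneg _) ?_
          rw [Real.norm_of_nonneg this.1]
          exact this.2
        · simp [hB _ hy]
      · simp [hA _ hx]
  have h2 : Integrable (fun p : ℝ × ℝ => B p.2 * ρ p.2 *
      (A p.1 * (-p.2 / ((p.1 - p.2) * (1 - p.1 * p.2))))) (volume.prod volume) := by
    refine (hAi.mul_prod hBρ).mono ?_ (Eventually.of_forall fun p => ?_)
    · exact hBρ.aestronglyMeasurable.comp_snd.mul (hAi.aestronglyMeasurable.comp_fst.mul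
        (Measurable.aestronglyMeasurable (by fun_prop)))
    · by_cases hx : p.1 ∈ Ioo (0 : ℝ) 1
      · by_cases hy : p.2 ∈ Ioo (-1 : ℝ) 0
        · have := partialFraction_right_mem hx.1 hy.2
          rw [← mul_assoc, norm_mul, mul_comm (B p.2 * ρ p.2)]
          refine mul_le_of_le_one_right (norm_nonneg _) ?_
          rw [Real.norm_of_nonneg this.1]
          exact this.2
        · simp [hB _ hy]
      · simp [hA _ hx]
  have h3 : ∀ x, productMixing A B x * ρ x =
      (∫ y, A x * ρ x * (B y * (x / ((x - y) * (1 - x * y))))) +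
        ∫ y, B x * ρ x * (A y * (-x / ((y - x) * (1 - y * x)))) := by
    intro x
    rw [integral_const_mul, integral_const_mul, productMixing]
    ring
  simp_rw [h3]
  have i1 := h1.integral_prod_left
  have i2 := h2.integral_prod_right
  refine ⟨i1.add i2, ?_⟩
  rw [integral_add i1 i2, ← integral_prod _ h1, ← integral_prod_symm _ h2, ← integral_add h1 h2]
  refine integral_congr_ae (Eventually.of_forall fun p => ?_)
  simp only
  ring

theorem integral_productMixing_pos (hA0 : ∀ x, 0 ≤ A x) (hB0 : ∀ x, 0 ≤ B x)
    (hA : ∀ x, x ∉ Ioo (0 : ℝ) 1 → A x = 0) (hB : ∀ x, x ∉ Ioo (-1 : ℝ) 0 → B x = 0)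
    (hAi : Integrable A) (hBi : Integrable B) (hAp : 0 < ∫ x, A x) (hBp : 0 < ∫ x, B x) :
    Integrable (productMixing A B) ∧ 0 < ∫ x, productMixing A B x := by
  have h := integrable_productMixing_mul hA hB hAi hBi (ρ := fun _ => 1) (by simpa) (by simpa)
  simp only [mul_one] at h
  refine ⟨h.1, ?_⟩
  rw [h.2]
  -- The two coefficients add up to `1 / (1 - xy)`, which is at least `1/2` because `-1 < xy < 0`.
  have h1 : ∫ p : ℝ × ℝ, A p.1 * B p.2 * (1 / 2) ∂(volume.prod volume) ≤
      ∫ p : ℝ × ℝ, A p.1 * B p.2 * (p.1 / ((p.1 - p.2) * (1 - p.1 * p.2)) +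
          -p.2 / ((p.1 - p.2) * (1 - p.1 * p.2))) ∂(volume.prod volume) := by
    have hle : ∀ p : ℝ × ℝ, A p.1 * B p.2 * (1 / 2) ≤
        A p.1 * B p.2 * (p.1 / ((p.1 - p.2) * (1 - p.1 * p.2)) +
          -p.2 / ((p.1 - p.2) * (1 - p.1 * p.2))) ∧
        A p.1 * B p.2 * (p.1 / ((p.1 - p.2) * (1 - p.1 * p.2)) +
          -p.2 / ((p.1 - p.2) * (1 - p.1 * p.2))) ≤ A p.1 * B p.2 * 2 := by
      intro p
      by_cases hx : p.1 ∈ Ioo (0 : ℝ) 1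
      · by_cases hy : p.2 ∈ Ioo (-1 : ℝ) 0
        · have h0 := mul_nonneg (hA0 p.1) (hB0 p.2)
          have h1 := partialFraction_left_mem hx.1 hy.2
          have h2 := partialFraction_right_mem hx.1 hy.2
          refine ⟨mul_le_mul_of_nonneg_left ?_ h0,
            mul_le_mul_of_nonneg_left (by linarith [h1.2, h2.2]) h0⟩
          have h3 : 0 < p.1 - p.2 := by linarith [hx.1, hy.2]
          have h4 : 0 < 1 - p.1 * p.2 := by nlinarith [hx.1, hy.2]
          rw [← add_div, ← sub_eq_add_neg, div_mul_cancel_left₀ h3.ne', one_div]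
          refine inv_anti₀ h4 ?_
          nlinarith [hx.1, hx.2, hy.1, hy.2]
        · simp [hB _ hy]
      · simp [hA _ hx]
    have hAB := hAi.mul_prod hBi
    refine integral_mono (hAB.mul_const _) ?_ fun p => (hle p).1
    refine (hAB.mul_const 2).mono ?_ (Eventually.of_forall fun p => ?_)
    · exact hAB.aestronglyMeasurable.mul (Measurable.aestronglyMeasurable (by fun_prop))
    · have h0 := mul_nonneg (hA0 p.1) (hB0 p.2)
      rw [Real.norm_of_nonneg (by linarith [(hle p).1]), Real.norm_of_nonneg (by linarith)]
      exact (hle p).2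
  refine lt_of_lt_of_le ?_ h1
  rw [integral_mul_const, integral_prod_mul]
  positivity

/-- With `D(x) = 1 + x² - 2x cos w`, the identity `x D(y) - y D(x) = (x - y)(1 - xy)` splits `1 /
(D(x) D(y))` into single kernels. -/
theorem integral_productMixing_div_norm_sq
    (hA : ∀ x, x ∉ Ioo (0 : ℝ) 1 → A x = 0) (hB : ∀ x, x ∉ Ioo (-1 : ℝ) 0 → B x = 0)
    (hAi : Integrable A) (hBi : Integrable B) {w : ℝ} (hw : Real.sin w ≠ 0) :
    ∫ x, productMixing A B x * (‖1 - (x : ℂ) * Complex.exp (Complex.I * w)‖ ^ 2)⁻¹ =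
      (∫ x, A x * (‖1 - (x : ℂ) * Complex.exp (Complex.I * w)‖ ^ 2)⁻¹) *
        ∫ x, B x * (‖1 - (x : ℂ) * Complex.exp (Complex.I * w)‖ ^ 2)⁻¹ := by
  have h := integrable_productMixing_mul hA hB hAi hBi
    (ρ := fun x => (‖1 - (x : ℂ) * Complex.exp (Complex.I * w)‖ ^ 2)⁻¹)
    (by simpa only [div_eq_mul_inv] using integrable_div_norm_sq hAi hw)
    (by simpa only [div_eq_mul_inv] using integrable_div_norm_sq hBi hw)
  rw [h.2, ← integral_prod_mul]
  refine integral_congr_ae (Eventually.of_forall fun p => ?_)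
  simp only
  by_cases hx : p.1 ∈ Ioo (0 : ℝ) 1
  · by_cases hy : p.2 ∈ Ioo (-1 : ℝ) 0
    · have hs : 0 < Real.sin w ^ 2 := by positivity
      have h1 := hs.trans_le (sin_sq_le_norm_one_sub_mul_exp_sq p.1 w)
      have h2 := hs.trans_le (sin_sq_le_norm_one_sub_mul_exp_sq p.2 w)
      have h3 : 0 < p.1 - p.2 := by linarith [hx.1, hy.2]
      have h4 : 0 < 1 - p.1 * p.2 := by nlinarith [hx.1, hy.2]
      rw [norm_one_sub_mul_exp_sq] at h1 h2 ⊢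
      rw [norm_one_sub_mul_exp_sq]
      have key : p.1 / ((p.1 - p.2) * (1 - p.1 * p.2)) *
            (1 + p.1 ^ 2 - 2 * p.1 * Real.cos w)⁻¹ +
          -p.2 / ((p.1 - p.2) * (1 - p.1 * p.2)) * (1 + p.2 ^ 2 - 2 * p.2 * Real.cos w)⁻¹ =
          (1 + p.1 ^ 2 - 2 * p.1 * Real.cos w)⁻¹ * (1 + p.2 ^ 2 - 2 * p.2 * Real.cos w)⁻¹ := by
        set D₁ := 1 + p.1 ^ 2 - 2 * p.1 * Real.cos w with hD₁
        set D₂ := 1 + p.2 ^ 2 - 2 * p.2 * Real.cos w with hD₂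
        have h5 : p.1 * D₂ - p.2 * D₁ = (p.1 - p.2) * (1 - p.1 * p.2) := by
          rw [hD₁, hD₂]; ring
        field_simp
        linear_combination h5
      rw [key]
      ring
    · simp [hB _ hy]
  · simp [hA _ hx]

theorem continuousAt_integral_partialFraction (hB : ∀ x, x ∉ Ioo (-1 : ℝ) 0 → B x = 0)
    (hBi : Integrable B) :
    ContinuousAt (fun x => ∫ y, B y * (x / ((x - y) * (1 - x * y)))) 1 := by
  refine continuousAt_of_dominated (bound := fun y => ‖B y‖) ?_ ?_ hBi.norm ?_
  · exact Eventually.of_forall fun x =>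
      hBi.aestronglyMeasurable.mul (Measurable.aestronglyMeasurable (by fun_prop))
  · filter_upwards [lt_mem_nhds (zero_lt_one' ℝ)] with x hx
    refine Eventually.of_forall fun y => ?_
    by_cases hy : y ∈ Ioo (-1 : ℝ) 0
    · have := partialFraction_left_mem hx hy.2
      rw [norm_mul, Real.norm_of_nonneg this.1]
      exact mul_le_of_le_one_right (norm_nonneg _) this.2
    · simp [hB y hy]
  · refine Eventually.of_forall fun y => ?_
    by_cases hy : y ∈ Ioo (-1 : ℝ) 0
    · have := sub_mul_one_sub_mul_pos one_pos hy.2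
      fun_prop (disch := exact this.ne')
    · simp only [hB y hy, zero_mul]
      exact continuousAt_const

theorem integral_partialFraction_one_pos (hB0 : ∀ x, 0 ≤ B x)
    (hB : ∀ x, x ∉ Ioo (-1 : ℝ) 0 → B x = 0) (hBi : Integrable B) (hBp : 0 < ∫ x, B x) :
    0 < ∫ y, B y * (1 / ((1 - y) * (1 - 1 * y))) := by
  have h1 : ∫ y, B y * (1 / 4) ≤ ∫ y, B y * (1 / ((1 - y) * (1 - 1 * y))) := by
    refine integral_mono (hBi.mul_const _) (hBi.mono ?_ (Eventually.of_forall fun y => ?_))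
      fun y => ?_
    · exact hBi.aestronglyMeasurable.mul (Measurable.aestronglyMeasurable (by fun_prop))
    · by_cases hy : y ∈ Ioo (-1 : ℝ) 0
      · have := partialFraction_left_mem one_pos hy.2
        rw [norm_mul, Real.norm_of_nonneg this.1]
        exact mul_le_of_le_one_right (norm_nonneg _) this.2
      · simp [hB y hy]
    · by_cases hy : y ∈ Ioo (-1 : ℝ) 0
      · refine mul_le_mul_of_nonneg_left ?_ (hB0 y)
        exact one_div_le_one_div_of_le (by nlinarith [hy.1, hy.2]) (by nlinarith [hy.1, hy.2])
      · simp [hB y hy]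
  refine lt_of_lt_of_le ?_ h1
  rw [integral_mul_const]
  positivity

end ProductMixing

/-! ### Mixture densities associated with `f` -/

theorem exists_isAssociated_farimaDensity_mul {d : ℝ} (hd0 : 0 < d) (hd1 : d < 1 / 2)
    {f g φg : ℝ → ℝ} (hφg : IsAssociated φg g)
    (hf : f =ᵐ[volume.restrict (Icc (-Real.pi) Real.pi)] fun w => farimaDensity d w * g w)
    (hsupp : ∀ᵐ x, x ∉ Icc (-1 : ℝ) 0 → φg x = 0) :
    ∃ B : ℝ → ℝ, (∀ x, 0 ≤ B x) ∧ (∀ x, x ∉ Ioo (-1 : ℝ) 0 → B x = 0) ∧ Integrable B ∧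
      0 < ∫ x, B x ∧ ∃ K, 0 < K ∧
      IsAssociated (fun x => K * productMixing (farimaMixing d) B x) f := by
  have hpi := Real.pi_pos
  obtain ⟨s, hs, hgs⟩ := hφg.exists_variance
  have hφ := hφg.isMixtureDensity
  set A := farimaMixing d with hAdef
  -- `B` is a version of `φg` with sign and support conditions valid everywhere, not only almost
  -- everywhere.
  set B : ℝ → ℝ := (Ioo (-1 : ℝ) 0).indicator fun x => max (φg x) 0 with hBdef
  have hB0 : ∀ x, 0 ≤ B x := fun x => indicator_nonneg (fun _ _ => le_max_right _ _) x
  have hB : ∀ x, x ∉ Ioo (-1 : ℝ) 0 → B x = 0 := fun x hx => indicator_of_notMem hx _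
  have hA0 : ∀ x, 0 ≤ A x := farimaMixing_nonneg d
  have hA : ∀ x, x ∉ Ioo (0 : ℝ) 1 → A x = 0 := fun x hx => farimaMixing_of_notMem hx
  have hBφ : B =ᵐ[volume] φg := by
    filter_upwards [hφ.nonneg, hsupp, Measure.ae_ne volume (0 : ℝ), Measure.ae_ne volume (-1 : ℝ)]
      with x h0 hx h1 h2
    by_cases hxI : x ∈ Ioo (-1 : ℝ) 0
    · rw [hBdef, indicator_of_mem hxI, max_eq_left h0]
    · rw [hB x hxI, hx fun h => hxI ⟨lt_of_le_of_ne h.1 (Ne.symm h2), lt_of_le_of_ne h.2 h1⟩]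
  have hBi : Integrable B := hφ.integrable.congr hBφ.symm
  have hB1 : ∫ x, B x = 1 := by rw [integral_congr_ae hBφ, hφ.integral_eq_one]
  have hBp : 0 < ∫ x, B x := by rw [hB1]; exact one_pos
  have hAi : Integrable A := integrable_farimaMixing hd0 hd1
  have hAp : 0 < ∫ x, A x := by
    rw [integral_pos_iff_support_of_nonneg hA0 hAi]
    refine lt_of_lt_of_le ?_ (measure_mono (s := Ioo (0 : ℝ) 1) fun x hx =>
      (farimaMixing_pos hx).ne')
    simp
  obtain ⟨hPi, hPp⟩ := integral_productMixing_pos hA0 hB0 hA hB hAi hBi hAp hBp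
  set M₀ := ∫ x, productMixing A B x with hM₀
  set M := ∫ v in Ioi (0 : ℝ), v ^ (-d) / (v + 1) with hM
  have hMp : 0 < M := integral_Ioi_rpow_div_add_one_pos hd0 hd1
  have hmix : IsMixtureDensity fun x => M₀⁻¹ * productMixing A B x := by
    refine ⟨Eventually.of_forall fun x => mul_nonneg (inv_nonneg.2 hPp.le)
      (productMixing_nonneg hA0 hB0 hA hB x), Eventually.of_forall fun x hx => ?_,
      hPi.const_mul _, ?_, ?_⟩
    · rw [productMixing, hA x fun h => hx ⟨by linarith [h.1], h.2.le⟩,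
        hB x fun h => hx ⟨h.1.le, by linarith [h.2]⟩]
      simp
    · rw [integral_const_mul, ← hM₀, inv_mul_cancel₀ hPp.ne']
    · have h1 := (integrable_productMixing_mul hA hB hAi hBi (ρ := fun x => (1 - x ^ 2)⁻¹)
        (integrable_farimaMixing_div hd0 hd1) ?_).1
      · simp_rw [div_eq_mul_inv, mul_assoc]
        exact (h1.const_mul _).integrableOn
      · refine hφ.integrable_div_one_sub_sq.congr ?_
        filter_upwards [hBφ] with x hx
        rw [hx, div_eq_mul_inv]
  -- The noise variance compensates for the normalisation `M₀` of the mixture, the FARIMA constant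
  -- `M`, and the two factors `1 / (2π)` of the product against the single one of an aggregated
  -- density.
  refine ⟨B, hB0, hB, hBi, hBp, M₀⁻¹, by positivity, hmix, s * M₀ / (2 * Real.pi * M),
    by positivity, ?_⟩
  filter_upwards [hf, hgs, ae_sin_ne_zero, ae_restrict_mem measurableSet_Icc] with w hfw hgw hw hwI
  have h1 : ∫ x, φg x * (‖1 - (x : ℂ) * Complex.exp (Complex.I * w)‖ ^ 2)⁻¹ =
      ∫ x, B x * (‖1 - (x : ℂ) * Complex.exp (Complex.I * w)‖ ^ 2)⁻¹ := by
    refine integral_congr_ae ?_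
    filter_upwards [hBφ] with x hx
    rw [hx]
  rw [hfw, hgw, farimaDensity_eq d hwI, aggregatedDensity, aggregatedDensity, hmix.integral_Ioc,
    hφ.integral_Ioc]
  simp_rw [div_eq_mul_inv (_ : ℝ) (‖_‖ ^ 2), mul_assoc M₀⁻¹]
  rw [integral_const_mul, integral_productMixing_div_norm_sq hA hB hAi hBi hw, h1, hAdef,
    integral_farimaMixing_div_norm_sq d hw, ← hM]
  generalize ∫ x, B x * (‖1 - (x : ℂ) * Complex.exp (Complex.I * w)‖ ^ 2)⁻¹ = b
  field_simp

theorem assumptionB_const_mul_productMixing {d : ℝ} (hd0 : 0 < d) (hd1 : d < 1 / 2)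
    {B φ : ℝ → ℝ} {K : ℝ} (hK : 0 < K) (hB0 : ∀ x, 0 ≤ B x)
    (hB : ∀ x, x ∉ Ioo (-1 : ℝ) 0 → B x = 0) (hBi : Integrable B) (hBp : 0 < ∫ x, B x)
    (hφ : IsMixtureDensity φ)
    (hφB : φ =ᵐ[volume] fun x => K * productMixing (farimaMixing d) B x) : AssumptionB φ d := by
  have hP0 : ∀ x, 0 ≤ K * productMixing (farimaMixing d) B x := fun x =>
    mul_nonneg hK.le (productMixing_nonneg (farimaMixing_nonneg d) hB0
      (fun x hx => farimaMixing_of_notMem hx) hB x)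
  set Ψ : ℝ → ℝ := fun x => K * (x ^ (d - 1) * (1 + x) *
    ∫ y, B y * (x / ((x - y) * (1 - x * y)))) with hΨ
  have hΨ0 : ∀ x, 0 < x → 0 ≤ Ψ x := by
    intro x hx
    have : 0 ≤ ∫ y, B y * (x / ((x - y) * (1 - x * y))) := by
      refine integral_nonneg fun y => ?_
      by_cases hy : y ∈ Ioo (-1 : ℝ) 0
      · exact mul_nonneg (hB0 y) (partialFraction_left_mem hx hy.2).1
      · simp [hB y hy]
    simp only [hΨ]
    positivity
  have hΨc : ContinuousAt Ψ 1 := by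
    refine continuousAt_const.mul (ContinuousAt.mul ?_
      (continuousAt_integral_partialFraction hB hBi))
    exact (Real.continuousAt_rpow_const 1 (d - 1) (Or.inl one_ne_zero)).mul (by fun_prop)
  have hΨ1 : Ψ 1 ≠ 0 := by
    have := integral_partialFraction_one_pos hB0 hB hBi hBp
    simp only [hΨ]
    positivity
  -- On `(0, 1]` the value is the continuous `Ψ`, including at `1`, where the mixture itself
  -- vanishes; on `[-1, 0]` division by the power is harmless because `1 - x ≥ 1`.
  set ψ : ℝ → ℝ := fun x => if x ∈ Ioc (0 : ℝ) 1 then Ψ x else if x ∈ Icc (-1 : ℝ) 0 then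
    K * productMixing (farimaMixing d) B x * ((1 - x) ^ (1 - 2 * d))⁻¹ else 0 with hψ
  have hψΨ : ∀ x ∈ Ioc (0 : ℝ) 1, ψ x = Ψ x := fun x hx => if_pos hx
  have h1mem : (1 : ℝ) ∈ Ioc (0 : ℝ) 1 := ⟨one_pos, le_rfl⟩
  refine ⟨hφ, hd0, hd1, ψ, fun x => ?_, fun x hx => ?_, ?_, ?_, ?_⟩
  · simp only [hψ]
    split_ifs with h1 h2
    · exact hΨ0 x h1.1
    · have : 0 < 1 - x := by linarith [h2.2]
      exact mul_nonneg (hP0 x) (by positivity)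
    · exact le_rfl
  · simp only [hψ]
    rw [if_neg fun h => hx ⟨by linarith [h.1], h.2⟩, if_neg fun h => hx ⟨h.1, by linarith [h.2]⟩]
  · refine hΨc.continuousWithinAt.congr_of_eventuallyEq ?_ (hψΨ 1 h1mem)
    filter_upwards [self_mem_nhdsWithin, mem_nhdsWithin_of_mem_nhds (lt_mem_nhds (zero_lt_one' ℝ))]
      with x hx1 hx0
    exact hψΨ x ⟨hx0, hx1⟩
  · rw [hψΨ 1 h1mem]
    exact hΨ1
  · filter_upwards [hφB, Measure.ae_ne volume (1 : ℝ)] with x hx hx1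
    rw [hx]
    by_cases h1 : x ∈ Ioc (0 : ℝ) 1
    · have hxI : x ∈ Ioo (0 : ℝ) 1 := ⟨h1.1, lt_of_le_of_ne h1.2 hx1⟩
      rw [hψΨ x h1, productMixing, farimaMixing_of_mem hxI, hB x fun h => by linarith [h.2, h1.1]]
      simp only [hΨ]
      ring
    · by_cases h2 : x ∈ Icc (-1 : ℝ) 0
      · have h3 : 0 < (1 - x) ^ (1 - 2 * d) := Real.rpow_pos_of_pos (by linarith [h2.2]) _
        simp only [hψ]
        rw [if_neg h1, if_pos h2]
        field_simp
      · simp only [hψ]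
        rw [if_neg h1, if_neg h2, productMixing,
          farimaMixing_of_notMem fun h => h1 ⟨h.1, h.2.le⟩, hB x fun h => h2 ⟨h.1.le, h.2.le⟩]
        simp

theorem exists_isAssociated_and_assumptionB {d : ℝ} (hd0 : 0 < d) (hd1 : d < 1 / 2)
    {f g φg : ℝ → ℝ} (hφg : IsAssociated φg g)
    (hf : f =ᵐ[volume.restrict (Icc (-Real.pi) Real.pi)] fun w => farimaDensity d w * g w)
    (hsupp : ∀ᵐ x, x ∉ Icc (-1 : ℝ) 0 → φg x = 0) :
    (∃ φ : ℝ → ℝ, IsAssociated φ f) ∧ ∀ φ : ℝ → ℝ, IsAssociated φ f → AssumptionB φ d := by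
  obtain ⟨B, hB0, hB, hBi, hBp, K, hK, hass⟩ :=
    exists_isAssociated_farimaDensity_mul hd0 hd1 hφg hf hsupp
  refine ⟨⟨_, hass⟩, fun φ hφ => ?_⟩
  obtain ⟨s₁, hs₁, h₁⟩ := hφ.exists_variance
  obtain ⟨s₂, -, h₂⟩ := hass.exists_variance
  exact assumptionB_const_mul_productMixing hd0 hd1 hK hB0 hB hBi hBp hφ.isMixtureDensity
    (ae_eq_of_aggregatedDensity_ae_eq hφ.isMixtureDensity hass.isMixtureDensity hs₁
      (h₁.symm.trans h₂))

end

theorem proposition3p2 (d : ℝ) (hd0 : 0 < d) (hd1 : d < 1 / 2)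
    (f g φg : ℝ → ℝ)
    (hg_periodic : Function.Periodic g (2 * Real.pi))
    (hg_analytic : AnalyticOnNhd ℝ g (Icc (-Real.pi) Real.pi))
    (hφg : IsAssociated φg g)
    (hf : f =ᵐ[volume.restrict (Icc (-Real.pi) Real.pi)] fun w => farimaDensity d w * g w) :
    -- (i)
    ((∃ a : ℝ, 0 < a ∧ a < 1 ∧ ∀ᵐ x, x ∉ Icc (-a) 0 → φg x = 0) →
      (∃ φ : ℝ → ℝ, IsAssociated φ f) ∧
      ∀ φ : ℝ → ℝ, IsAssociated φ f → AssumptionB φ d) ∧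
    -- (ii)
    (∀ {Ω : Type*} [MeasurableSpace Ω] (μ : Measure Ω) [IsProbabilityMeasure μ]
        (X : ℤ → Ω → ℝ), IsAggregatedProcess X μ → HasSpectralDensity X μ f →
      IntervalIntegrable (fun w => Real.log (f w)) volume (-Real.pi) Real.pi ∧
      innovationVariance f =
        Real.exp (1 / (2 * Real.pi) * ∫ w in (-Real.pi)..Real.pi, Real.log (g w)) ∧
      innovationVariance f = innovationVariance g / (2 * Real.pi) ∧
      (∃ Z : ℤ → Ω → ℝ, iIndepFun Z μ ∧
        (∀ t, HasLaw (Z t) (gaussianReal 0 (innovationVariance f).toNNReal) μ) ∧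
        IsInnovation X Z μ ∧
        IsLinearSequence X Z (maCoeff f) μ) ∧
      Summable (fun j => maCoeff f j ^ 2) ∧
      maCoeff f 0 = 1 ∧
      Summable (fun k => |maCoeff g k|) ∧
      ∑' k, maCoeff g k ≠ 0 ∧
      (maCoeff f ~[atTop]
        fun j : ℕ => (∑' k, maCoeff g k) / Real.Gamma d * (j : ℝ) ^ (d - 1)) ∧
      ((fun j : ℕ => |maCoeff f j - maCoeff f (j + 1)|) =O[atTop]
        fun j : ℕ => (j : ℝ) ^ (d - 2)) ∧
      AssumptionA X μ d) := by
  have hg : ∀ w, AnalyticAt ℝ g w := analyticAt_of_periodic hg_periodic hg_analytic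
  have hgc : Continuous g := continuous_iff_continuousAt.2 fun w => (hg w).continuousAt
  obtain ⟨m, hm, hgm⟩ := exists_lower_bound_of_isAssociated hg_periodic hgc hφg
  refine ⟨?_, fun μ _ X hX hXf => movingAverage_of_hasSpectralDensity hd0 hd1 hg_periodic
    (contDiff_iff_contDiffAt.2 fun w => (hg w).contDiffAt) (fun w => hm.trans_le (hgm w))
    (even_of_isAssociated hg_periodic hgc hφg) hf μ X hX.gaussian hX.mean_zero hXf⟩
  rintro ⟨a, -, ha1, hsupp⟩
  refine exists_isAssociated_and_assumptionB hd0 hd1 hφg hf ?_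
  filter_upwards [hsupp] with x hx hxI
  exact hx fun h => hxI ⟨by linarith [h.1], h.2⟩
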